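/- Let $(\Omega,P)$ be a probability space with expectation $\mathbb{E}$, and let $G=\sum_{l\ge 1} w_l\,\delta_{\xi_l}$ be a random atomic probability measure on the closed unit ball of $\ell_2$: the weights $w_l\ge 0$ and the points $\xi_l$ of the unit ball are random variables, $\sum_l w_l=1$, $w_1\ge w_2\ge\dots$, and the points $\xi_l$ with $w_l>0$ are distinct (if $G$ has finitely many atoms, the remaining weights are $0$ and the remaining points are arbitrary). Let $Q=(\xi_l\cdot\xi_{l'})_{l,l'\ge1}$. For a function $f$ of $n$ points put $$\langle f\rangle=\sum_{l_1,\dots,l_n\ge1}w_{l_1}\cdots w_{l_n}\,f(\xi_{l_1},\dots,\xi_{l_n}),$$ so that $\langle\cdot\rangle$ is the average over independent replicas $\sigma^1,\sigma^2,\dots$ sampled from $G$, and write $R_{l,l'}=\sigma^l\cdot\sigma^{l'}$. Let $q^*$ be the supremum of the support of the distribution of $R_{1,2}$ under $\mathbb{E}G^{\otimes2}$, and for $p\ge1$ let $b_p=(q^*)^p-\mathbb{E}\langle R_{1,2}^p\rangle$. For an integer $p\ge1$ let $(g_p(\xi_l))_{l\ge1}$ be a sequence that, conditionally on $(w_l)$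 and $(\xi_l)$, is centered Gaussian with covariance $\mathrm{Cov}(g_p(\xi_l),g_p(\xi_{l'}))=(\xi_l\cdot\xi_{l'})^p$. For $t\in\mathbb{R}$ let $$w_l^t=\frac{w_l e^{t g_p(\xi_l)}}{\sum_{j\ge1}w_j e^{t g_p(\xi_j)}},$$ let $\pi$ be the permutation of the indices that arranges $(w^t_l)$ in non-increasing order (ties being broken by the original index), and let $w_l^\pi=w^t_{\pi(l)}$ and $Q^\pi=(\xi_{\pi(l)}\cdot\xi_{\pi(l')})_{l,l'\ge1}$. - $G$ satisfies the Ghirlanda–Guerra identities if for all integers $n\ge2$ and $p\ge1$ and every bounded measurable function $f$ of the overlaps $(R_{l,l'})_{l,l'\le n}$, $$\mathbb{E}\langle f R_{1,n+1}^p\rangle=\frac1n\,\mathbb{E}\langle f\rangle\,\mathbb{E}\langle R_{1,2}^p\rangle+\frac1n\sum_{l=2}^n\mathbb{E}\langle f R_{1,l}^p\rangle.$$ - $G$ satisfies the Aizenman–Contucci stochastic stability if for all integers $p\ge1$ and all $t\in\mathbb{R}$ the arrays $\bigl((w_l^\pi)_{l\ge1},Q^\pi\bigr)$ and $\bigl((w_l)_{l\ge1},Q\bigr)$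 have the same finite-dimensional distributions. Theorem. $G$ satisfies both the Ghirlanda–Guerra identities and the Aizenman–Contucci stochastic stability if and only if both of the following hold: with probability one $G$ is concentrated on the sphere $\{x\in\ell_2:\|x\|=\sqrt{q^*}\}$; and for all integers $p\ge1$ and all $t\in\mathbb{R}$ the arrays $$\Bigl((w_l^\pi)_{l\ge1},\ \bigl(g_p(\xi_{\pi(l)})-b_p t\bigr)_{l\ge1},\ Q^\pi\Bigr)\quad\text{and}\quad\Bigl((w_l)_{l\ge1},\ \bigl(g_p(\xi_l)\bigr)_{l\ge1},\ Q\Bigr)$$ have the same finite-dimensional distributions. -/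

import Mathlib

open MeasureTheory ProbabilityTheory
open scoped ENNReal lp

noncomputable section

namespace SpinGlass

/-! ### Sorting a sequence in non-increasing order -/

/-- `π` lists the terms of `v` in non-increasing order, ties being broken by the original index:
`v (π 0) ≥ v (π 1) ≥ …`. -/
def IsSorting (v : ℕ → ℝ) (π : Equiv.Perm ℕ) : Prop :=
  ∀ i j : ℕ, i < j → v (π j) < v (π i) ∨ (v (π j) = v (π i) ∧ π i < π j)

/-- There is at most one sorting permutation. -/
theorem IsSorting.unique {v : ℕ → ℝ} {π ρ : Equiv.Perm ℕ} (hπ : IsSorting v π)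
    (hρ : IsSorting v ρ) : π = ρ := by
  have key : ∀ {π ρ : Equiv.Perm ℕ}, IsSorting v π → IsSorting v ρ →
      StrictMono (fun i => ρ.symm (π i)) := by
    intro π ρ hπ hρ i j hij
    by_contra hcon
    have hle : ρ.symm (π j) ≤ ρ.symm (π i) := not_lt.mp hcon
    have hne : ρ.symm (π j) ≠ ρ.symm (π i) := by
      intro h
      exact hij.ne' (π.injective (ρ.symm.injective h))
    have h1 := hρ _ _ (lt_of_le_of_ne hle hne)
    have h2 := hπ i j hij
    simp only [Equiv.apply_symm_apply] at h1
    rcases h1 with h1 | h1 <;> rcases h2 with h2 | h2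
    · linarith
    · linarith [h2.1]
    · linarith [h1.1]
    · omega
  ext i
  have h1 : i ≤ ρ.symm (π i) := (key hπ hρ).le_apply
  have h2 : ρ.symm (π i) ≤ π.symm (ρ (ρ.symm (π i))) := (key hρ hπ).le_apply
  simp only [Equiv.apply_symm_apply, Equiv.symm_apply_apply] at h2
  have h3 : i = ρ.symm (π i) := le_antisymm h1 h2
  exact (ρ.symm_apply_eq.mp h3.symm)

open Classical in
/-- The sorting permutation of a sequence (the identity if there is none). -/
def sortPerm (v : ℕ → ℝ) : Equiv.Perm ℕ :=
  if h : ∃ π, IsSorting v π then h.choose else 1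

theorem sortPerm_eq {v : ℕ → ℝ} {π : Equiv.Perm ℕ} (h : IsSorting v π) : sortPerm v = π := by
  have hex : ∃ π, IsSorting v π := ⟨π, h⟩
  rw [sortPerm, dif_pos hex]
  exact hex.choose_spec.unique h

/-! ### Centered Gaussian sequences with a prescribed covariance -/

/-- The law of a sequence of independent standard Gaussian random variables. -/
def stdGaussianSeq : Measure (ℕ → ℝ) := Measure.infinitePi fun _ => gaussianReal 0 1

instance : IsProbabilityMeasure stdGaussianSeq := by
  unfold stdGaussianSeq; infer_instance

/-- The matrix that is left of `C` after the pivots `0, …, m - 1` have been eliminated. -/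
def residual (C : Matrix ℕ ℕ ℝ) : ℕ → Matrix ℕ ℕ ℝ
  | 0 => C
  | m + 1 => Matrix.of fun i j =>
      residual C m i j - residual C m i m * residual C m m j / residual C m m m

/-- The centered Gaussian sequence with covariance matrix `C`, as the image of a sequence `γ` of
independent standard Gaussian variables under the lower triangular (Cholesky) root of `C`. -/
def gaussianSeq (C : Matrix ℕ ℕ ℝ) (γ : ℕ → ℝ) (l : ℕ) : ℝ :=
  ∑ m ∈ Finset.range (l + 1), residual C m l m / √(residual C m m m) * γ m

theorem residual_succ_apply (C : Matrix ℕ ℕ ℝ) (m i j : ℕ) : residual C (m + 1) i j =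
    residual C m i j - residual C m i m * residual C m m j / residual C m m m := rfl

theorem quadratic_nonneg {K : Matrix ℕ ℕ ℝ} (hK : K.PosSemidef) (s : Finset ℕ) (f : ℕ → ℝ) :
    0 ≤ ∑ i ∈ s, ∑ j ∈ s, f i * K i j * f j := by
  have h := hK.2 (Finsupp.indicator s fun i _ => f i)
  rw [Finsupp.sum_of_support_subset (s := s) _ (Finsupp.support_indicator_subset ..) _
    (by simp)] at h
  refine h.trans_eq (Finset.sum_congr rfl fun i hi => ?_)
  rw [Finsupp.sum_of_support_subset (s := s) _ (Finsupp.support_indicator_subset ..) _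
    (by simp)]
  refine Finset.sum_congr rfl fun j hj => ?_
  simp [Finsupp.indicator_apply, hi, hj]

theorem residual_posSemidef {C : Matrix ℕ ℕ ℝ} (hC : C.PosSemidef) (m : ℕ) :
    (residual C m).PosSemidef := by
  induction m with
  | zero => exact hC
  | succ m ih =>
    have hsymm : ∀ i j, residual C m i j = residual C m j i := fun i j => by
      simpa using (ih.1.apply i j).symm
    constructor
    · ext i j
      simp only [Matrix.conjTranspose_apply, star_trivial, residual_succ_apply]
      rw [hsymm j i, hsymm j m, hsymm m i, mul_comm]
    · intro x
      set K := residual C m with hKdef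
      set s : Finset ℕ := insert m x.support with hs
      have hm : m ∈ s := Finset.mem_insert_self _ _
      have hsub : x.support ⊆ s := Finset.subset_insert _ _
      have hgoal : (x.sum fun i xi => x.sum fun j xj => star xi * residual C (m + 1) i j * xj) =
          (∑ i ∈ s, ∑ j ∈ s, x i * K i j * x j) - (∑ j ∈ s, K m j * x j) ^ 2 / K m m := by
        rw [Finsupp.sum_of_support_subset _ hsub _ (by simp)]
        have : ∀ i ∈ s, (x.sum fun j xj => star (x i) * residual C (m + 1) i j * xj) =
            (∑ j ∈ s, x i * K i j * x j) - (K m i * x i) * (∑ j ∈ s, K m j * x j) / K m m := by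
          intro i _
          rw [Finsupp.sum_of_support_subset _ hsub _ (by simp), Finset.mul_sum, Finset.sum_div,
            ← Finset.sum_sub_distrib]
          refine Finset.sum_congr rfl fun j _ => ?_
          simp only [residual_succ_apply, star_trivial, ← hKdef]
          rw [hsymm i m]
          ring
        rw [Finset.sum_congr rfl this, Finset.sum_sub_distrib, ← Finset.sum_div,
          ← Finset.sum_mul, sq]
      rw [hgoal]
      set S := ∑ i ∈ s, ∑ j ∈ s, x i * K i j * x j with hS
      set T := ∑ j ∈ s, K m j * x j with hT
      have key : ∀ c : ℝ, 0 ≤ S + 2 * c * T + c ^ 2 * K m m := by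
        intro c
        have h := quadratic_nonneg ih s fun i => x i + if i = m then c else 0
        refine h.trans_eq ?_
        have h1 : ∀ i ∈ s, (∑ j ∈ s, (x i + if i = m then c else 0) * K i j *
            (x j + if j = m then c else 0)) =
            (∑ j ∈ s, x i * K i j * x j) + c * (K m i * x i) +
              (if i = m then c * T + c ^ 2 * K m m else 0) := by
          intro i _
          have h2 : ∀ j ∈ s, (x i + if i = m then c else 0) * K i j *
              (x j + if j = m then c else 0) = x i * K i j * x j +
              (if j = m then c * (x i * K i j) else 0) +
              (if i = m then c * (K i j * x j) + if j = m then c ^ 2 * K i j else 0 else 0) := by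
            intro j _
            split_ifs <;> ring
          rw [Finset.sum_congr rfl h2, Finset.sum_add_distrib, Finset.sum_add_distrib,
            Finset.sum_ite_eq' s m, if_pos hm, hsymm i m]
          by_cases hi : i = m
          · subst hi
            simp only [if_true, Finset.sum_add_distrib, ← Finset.mul_sum, Finset.sum_ite_eq',
              hm, ← hT]
            ring
          · simp only [hi, if_false, Finset.sum_const_zero]
            ring
        rw [Finset.sum_congr rfl h1, Finset.sum_add_distrib, Finset.sum_add_distrib,
          Finset.sum_ite_eq' s m, if_pos hm, ← Finset.mul_sum]
        ring
      by_cases h0 : K m m = 0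
      · simpa [h0] using key 0
      · have := key (-T / K m m)
        refine this.trans_eq ?_
        field_simp
        ring

theorem residual_eq_zero {C : Matrix ℕ ℕ ℝ} (hC : C.PosSemidef) {l N : ℕ} (h : l < N) (j : ℕ) :
    residual C N l j = 0 := by
  induction N, h using Nat.le_induction generalizing j with
  | base =>
    by_cases h0 : residual C l l l = 0
    · have hd := ((residual_posSemidef hC l).submatrix ![l, j]).det_nonneg
      have hs : residual C l j l = residual C l l j := by
        simpa using (residual_posSemidef hC l).1.apply l j
      simp only [Matrix.det_fin_two, Matrix.submatrix_apply, Matrix.cons_val_zero,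
        Matrix.cons_val_one, h0, hs] at hd
      have : residual C l l j = 0 := by nlinarith
      simp [residual_succ_apply, this]
    · simp only [residual_succ_apply]
      field_simp
      simp
  | succ N hN ih => simp [residual_succ_apply, ih]

theorem isGaussianProcess_gaussianSeq (C : Matrix ℕ ℕ ℝ) :
    IsGaussianProcess (fun l γ => gaussianSeq C γ l) stdGaussianSeq := by
  have hind : iIndepFun (fun (i : ℕ) (γ : ℕ → ℝ) => γ i) stdGaussianSeq :=
    iIndepFun_infinitePi (P := fun _ : ℕ => gaussianReal 0 1) (X := fun _ x => x)
      fun _ => measurable_id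
  have hev : ∀ i : ℕ, HasGaussianLaw (fun γ : ℕ → ℝ => γ i) stdGaussianSeq := fun i => by
    constructor
    have : stdGaussianSeq.map (fun γ : ℕ → ℝ => γ i) = gaussianReal 0 1 :=
      Measure.infinitePi_map_eval _ i
    rw [this]
    infer_instance
  have hX : IsGaussianProcess (fun (i : ℕ) (γ : ℕ → ℝ) => γ i) stdGaussianSeq :=
    ⟨fun I => iIndepFun.hasGaussianLaw (X := fun (i : I) (γ : ℕ → ℝ) => γ i) (fun i => hev i)
      (hind.precomp Subtype.val_injective)⟩
  refine hX.of_isGaussianProcess fun l => ⟨Finset.range (l + 1),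
    ∑ m : Finset.range (l + 1), (residual C m l m / √(residual C m m m)) •
      ContinuousLinearMap.proj (R := ℝ) (φ := fun _ : Finset.range (l + 1) => ℝ) m, fun γ => ?_⟩
  simp only [gaussianSeq, sum_apply, smul_apply,
    ContinuousLinearMap.proj_apply, smul_eq_mul, Finset.restrict]
  exact (Finset.sum_coe_sort (Finset.range (l + 1))
    fun m => residual C m l m / √(residual C m m m) * γ m).symm

theorem memLp_eval (i : ℕ) : MemLp (fun γ : ℕ → ℝ => γ i) 2 stdGaussianSeq :=
  (memLp_id_gaussianReal (μ := 0) (v := 1) 2).comp_measurePreserving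
    (measurePreserving_eval_infinitePi (fun _ : ℕ => gaussianReal 0 1) i)

theorem integral_gaussianSeq (C : Matrix ℕ ℕ ℝ) (l : ℕ) :
    ∫ γ, gaussianSeq C γ l ∂stdGaussianSeq = 0 := by
  have h0 : ∀ m : ℕ, ∫ γ : ℕ → ℝ, γ m ∂stdGaussianSeq = 0 := fun m => by
    have h := (measurePreserving_eval_infinitePi (fun _ : ℕ => gaussianReal 0 1) m).map_eq
    have h2 := integral_map (μ := stdGaussianSeq) (φ := Function.eval m) (f := fun x : ℝ => x)
      (measurable_pi_apply m).aemeasurable (by fun_prop)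
    rw [show stdGaussianSeq.map (Function.eval m) = gaussianReal 0 1 from h] at h2
    simpa using h2.symm
  simp only [gaussianSeq]
  rw [integral_finsetSum _ fun m _ => ((memLp_eval m).integrable one_le_two).const_mul _]
  simp [integral_const_mul, h0]

theorem covariance_gaussianSeq {C : Matrix ℕ ℕ ℝ} (hC : C.PosSemidef) (l l' : ℕ) :
    cov[fun γ => gaussianSeq C γ l, fun γ => gaussianSeq C γ l'; stdGaussianSeq] = C l l' := by
  have hcov : ∀ i j : ℕ, cov[fun γ : ℕ → ℝ => γ i, fun γ : ℕ → ℝ => γ j; stdGaussianSeq] =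
      if i = j then 1 else 0 := by
    intro i j
    split_ifs with hij
    · subst hij
      rw [covariance_self (memLp_eval i).aestronglyMeasurable.aemeasurable]
      have h := (measurePreserving_eval_infinitePi (fun _ : ℕ => gaussianReal 0 1) i).map_eq
      have h2 := variance_map (μ := stdGaussianSeq) (Y := Function.eval i) (X := fun x : ℝ => x)
        (by fun_prop) (measurable_pi_apply i).aemeasurable
      rw [show stdGaussianSeq.map (Function.eval i) = gaussianReal 0 1 from h] at h2
      simpa [Function.comp_def] using h2.symm
    · have hind : iIndepFun (fun (i : ℕ) (γ : ℕ → ℝ) => γ i) stdGaussianSeq :=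
        iIndepFun_infinitePi (P := fun _ : ℕ => gaussianReal 0 1) (X := fun _ x => x)
          fun _ => measurable_id
      exact (hind.indepFun hij).covariance_eq_zero (memLp_eval i) (memLp_eval j)
  set N := max l l' + 1 with hN
  have hpad : ∀ k, k < N → ∀ γ, gaussianSeq C γ k =
      ∑ m ∈ Finset.range N, residual C m k m / √(residual C m m m) * γ m := by
    intro k hk γ
    refine Finset.sum_subset (Finset.range_subset_range.mpr hk) fun m _ hm => ?_
    rw [residual_eq_zero hC (by simpa using hm)]
    simp
  simp only [hpad l (by omega), hpad l' (by omega)]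
  rw [covariance_fun_sum_fun_sum' (fun m _ => (memLp_eval m).const_mul _)
    (fun m _ => (memLp_eval m).const_mul _)]
  simp only [covariance_const_mul_left, covariance_const_mul_right, hcov]
  have hterm : ∀ m ∈ Finset.range N, (∑ k ∈ Finset.range N,
      residual C k l' k / √(residual C k k k) * (residual C m l m / √(residual C m m m) *
        if m = k then 1 else 0)) = residual C m l l' - residual C (m + 1) l l' := by
    intro m hm
    simp only [mul_ite, mul_one, mul_zero, Finset.sum_ite_eq, hm, if_true]
    have hs : residual C m l' m = residual C m m l' := by
      simpa using (residual_posSemidef hC m).1.apply m l'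
    rw [mul_comm, div_mul_div_comm, Real.mul_self_sqrt (residual_posSemidef hC m).diag_nonneg, hs]
    simp [residual_succ_apply]
  rw [Finset.sum_congr rfl hterm, Finset.sum_range_sub', residual_eq_zero hC (l := l) (N := N) (by omega), sub_zero]
  rfl

theorem posSemidef_gram {E : Type*} [NormedAddCommGroup E] [InnerProductSpace ℝ E]
    (v : ℕ → E) : (Matrix.of fun i j => (inner ℝ (v i) (v j) : ℝ)).PosSemidef := by
  refine ⟨by ext i j; simp [real_inner_comm], fun x => ?_⟩
  have h : 0 ≤ (inner ℝ (x.sum fun i xi => xi • v i) (x.sum fun i xi => xi • v i) : ℝ) :=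
    real_inner_self_nonneg
  refine h.trans_eq ?_
  simp only [Finsupp.sum, sum_inner, inner_sum, real_inner_smul_left, real_inner_smul_right,
    Matrix.of_apply, star_trivial]
  refine Finset.sum_congr rfl fun i _ => Finset.sum_congr rfl fun j _ => ?_
  rw [real_inner_comm (v i) (v j)]
  ring

/-- The entrywise powers of a Gram matrix are positive semidefinite. -/
theorem posSemidef_gram_pow {E : Type*} [NormedAddCommGroup E] [InnerProductSpace ℝ E]
    (v : ℕ → E) (p : ℕ) :
    (Matrix.of fun i j => (inner ℝ (v i) (v j) : ℝ) ^ p).PosSemidef := by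
  induction p with
  | zero => simpa using posSemidef_gram fun _ => (1 : ℝ)
  | succ p ih =>
    have h : (Matrix.of fun i j => (inner ℝ (v i) (v j) : ℝ) ^ (p + 1)) =
        (Matrix.of fun i j => (inner ℝ (v i) (v j) : ℝ) ^ p).hadamard
          (Matrix.of fun i j => (inner ℝ (v i) (v j) : ℝ)) := by
      ext i j
      simp [pow_succ]
    rw [h]
    exact ih.hadamard (posSemidef_gram v)

/-! ### Random atomic measures on the unit ball of `ℓ²` -/

instance : MeasurableSpace ℓ²(ℕ, ℝ) := borel _

instance : BorelSpace ℓ²(ℕ, ℝ) := ⟨rfl⟩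

/-- A random atomic probability measure `∑ w_l δ_{ξ_l}` on the unit ball of `ℓ²`, with weights in
non-increasing order. The atoms are distinct; a measure with finitely many atoms is
listed with weights that are eventually zero (the points of zero weight are irrelevant). -/
structure RandomAtomicMeasure (Ω : Type*) [MeasurableSpace Ω] where
  /-- the weights -/
  w : ℕ → Ω → ℝ
  /-- the atoms -/
  ξ : ℕ → Ω → ℓ²(ℕ, ℝ)
  measurable_w : ∀ l, Measurable (w l)
  measurable_ξ : ∀ l, Measurable (ξ l)
  w_nonneg : ∀ l ω, 0 ≤ w l ω
  w_antitone : ∀ ω, Antitone fun l => w l ω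
  hasSum_w : ∀ ω, HasSum (fun l => w l ω) 1
  norm_ξ_le : ∀ l ω, ‖ξ l ω‖ ≤ 1
  ξ_ne : ∀ ω l l', l ≠ l' → 0 < w l ω → 0 < w l' ω → ξ l ω ≠ ξ l' ω

namespace RandomAtomicMeasure

variable {Ω : Type*} [MeasurableSpace Ω]

/-- The measure `G = ∑ w_l δ_{ξ_l}`. -/
def toMeasure (G : RandomAtomicMeasure Ω) (ω : Ω) : Measure ℓ²(ℕ, ℝ) :=
  Measure.sum fun l => ENNReal.ofReal (G.w l ω) • Measure.dirac (G.ξ l ω)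

/-- The matrix `Q` of scalar products of the atoms. -/
def Q (G : RandomAtomicMeasure Ω) (ω : Ω) : Matrix ℕ ℕ ℝ :=
  Matrix.of fun l l' => inner ℝ (G.ξ l ω) (G.ξ l' ω)

/-- The average `⟨f⟩` of a function of `n` replicas with respect to `G^{⊗ n}`. -/
def avg (G : RandomAtomicMeasure Ω) (n : ℕ) (f : (Fin n → ℓ²(ℕ, ℝ)) → ℝ) (ω : Ω) : ℝ :=
  ∑' l : Fin n → ℕ, (∏ i, G.w (l i) ω) * f fun i => G.ξ (l i) ω

/-- `𝔼⟨f⟩`. -/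
def meanAvg (G : RandomAtomicMeasure Ω) (P : Measure Ω) (n : ℕ)
    (f : (Fin n → ℓ²(ℕ, ℝ)) → ℝ) : ℝ :=
  ∫ ω, G.avg n f ω ∂P

/-- The overlaps `R_{l,l'} = σ^l · σ^{l'}` of `n` replicas. -/
def overlap {n : ℕ} (σ : Fin n → ℓ²(ℕ, ℝ)) (l l' : Fin n) : ℝ := inner ℝ (σ l) (σ l')

/-- The Ghirlanda–Guerra identities. -/
def GhirlandaGuerra (G : RandomAtomicMeasure Ω) (P : Measure Ω) : Prop :=
  ∀ (n : ℕ) (hn : 2 ≤ n) (f : (Fin n → Fin n → ℝ) → ℝ), Measurable f → (∃ B, ∀ R, |f R| ≤ B) →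
    ∀ p : ℕ, 1 ≤ p →
      G.meanAvg P (n + 1) (fun σ =>
          f (overlap fun i : Fin n => σ i.castSucc) * overlap σ 0 (Fin.last n) ^ p) =
        1 / (n : ℝ) * (G.meanAvg P n (fun σ => f (overlap σ)) *
          G.meanAvg P 2 (fun σ => overlap σ 0 1 ^ p)) +
        1 / (n : ℝ) * ∑ l : Fin n with l ≠ ⟨0, by omega⟩,
          G.meanAvg P n (fun σ => f (overlap σ) * overlap σ ⟨0, by omega⟩ l ^ p)

/-- The Gaussian sequence `(g_p(ξ_l))`: conditionally on `ω` it is centered Gaussian with covariance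
`(ξ_l · ξ_{l'})^p`. It lives on `Ω × ℝ^ℕ`, equipped with `P ⊗ stdGaussianSeq`. -/
def field (G : RandomAtomicMeasure Ω) (p : ℕ) (x : Ω × (ℕ → ℝ)) (l : ℕ) : ℝ :=
  gaussianSeq (Matrix.of fun i j => G.Q x.1 i j ^ p) x.2 l

/-- For every fixed `ω`, the sequence `(g_p(ξ_l))` is a centered Gaussian process with covariance
`(ξ_l · ξ_{l'})^p`. -/
theorem field_law (G : RandomAtomicMeasure Ω) (p : ℕ) (ω : Ω) :
    IsGaussianProcess (fun l γ => G.field p (ω, γ) l) stdGaussianSeq ∧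
      (∀ l, ∫ γ, G.field p (ω, γ) l ∂stdGaussianSeq = 0) ∧
      ∀ l l', cov[fun γ => G.field p (ω, γ) l, fun γ => G.field p (ω, γ) l'; stdGaussianSeq] =
        (inner ℝ (G.ξ l ω) (G.ξ l' ω) : ℝ) ^ p :=
  ⟨isGaussianProcess_gaussianSeq (Matrix.of fun i j => G.Q ω i j ^ p),
    integral_gaussianSeq (Matrix.of fun i j => G.Q ω i j ^ p),
    covariance_gaussianSeq (posSemidef_gram_pow (fun l => G.ξ l ω) p)⟩

/-- The weights `w_l^t`, after the change of density proportional to `exp (t g_p)`. -/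
def tiltedWeight (G : RandomAtomicMeasure Ω) (p : ℕ) (t : ℝ) (x : Ω × (ℕ → ℝ)) (l : ℕ) : ℝ :=
  G.w l x.1 * Real.exp (t * G.field p x l) /
    ∑' j, G.w j x.1 * Real.exp (t * G.field p x j)

/-- The permutation `π` that arranges the weights `w_l^t` in non-increasing order. -/
def perm (G : RandomAtomicMeasure Ω) (p : ℕ) (t : ℝ) (x : Ω × (ℕ → ℝ)) : Equiv.Perm ℕ :=
  sortPerm (G.tiltedWeight p t x)

/-- The weights `w_l^π`, i.e. the weights `w_l^t` in non-increasing order. -/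
def sortedWeight (G : RandomAtomicMeasure Ω) (p : ℕ) (t : ℝ) (x : Ω × (ℕ → ℝ)) (l : ℕ) : ℝ :=
  G.tiltedWeight p t x (G.perm p t x l)

/-- The matrix `Q^π`. -/
def sortedQ (G : RandomAtomicMeasure Ω) (p : ℕ) (t : ℝ) (x : Ω × (ℕ → ℝ)) : Matrix ℕ ℕ ℝ :=
  Matrix.of fun l l' => G.Q x.1 (G.perm p t x l) (G.perm p t x l')

/-- The Aizenman–Contucci stochastic stability: `((w_l^π), Q^π)` and `((w_l), Q)` have the
same finite-dimensional distributions. -/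
def AizenmanContucci (G : RandomAtomicMeasure Ω) (P : Measure Ω) : Prop :=
  ∀ p : ℕ, 1 ≤ p → ∀ (t : ℝ) (n : ℕ),
    IdentDistrib
      (fun x : Ω × (ℕ → ℝ) =>
        ((fun l : Fin n => G.sortedWeight p t x l),
          (fun l l' : Fin n => G.sortedQ p t x l l')))
      (fun ω : Ω =>
        ((fun l : Fin n => G.w l ω),
          (fun l l' : Fin n => G.Q ω l l')))
      (P.prod stdGaussianSeq) P

/-- The distribution of the overlap `R_{1,2}` under `𝔼 G^{⊗ 2}`. -/
def overlapLaw (G : RandomAtomicMeasure Ω) (P : Measure Ω) : Measure ℝ :=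
  Measure.sum fun l : ℕ × ℕ =>
    (P.withDensity fun ω => ENNReal.ofReal (G.w l.1 ω * G.w l.2 ω)).map fun ω => G.Q ω l.1 l.2

/-- `q^*`, the supremum of the support of the distribution of the overlap. -/
def qStar (G : RandomAtomicMeasure Ω) (P : Measure Ω) : ℝ := sSup (G.overlapLaw P).support

/-- `b_p = (q^*)^p - 𝔼⟨R_{1,2}^p⟩`. -/
def b (G : RandomAtomicMeasure Ω) (P : Measure Ω) (p : ℕ) : ℝ :=
  G.qStar P ^ p - G.meanAvg P 2 fun σ => overlap σ 0 1 ^ p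

/-- With probability one, `G` is concentrated on the sphere of radius `√q^*`. -/
def ConcentratedOnSphere (G : RandomAtomicMeasure Ω) (P : Measure Ω) : Prop :=
  ∀ᵐ ω ∂P, ∀ᵐ σ ∂(G.toMeasure ω), ‖σ‖ = √(G.qStar P)

/-- The unified stability property: `((w_l^π), (g_p(ξ_{π(l)}) - b_p t), Q^π)` and
`((w_l), (g_p(ξ_l)), Q)` have the same finite-dimensional distributions. -/
def UnifiedStability (G : RandomAtomicMeasure Ω) (P : Measure Ω) : Prop :=
  ∀ p : ℕ, 1 ≤ p → ∀ (t : ℝ) (n : ℕ),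
    IdentDistrib
      (fun x : Ω × (ℕ → ℝ) =>
        ((fun l : Fin n => G.sortedWeight p t x l),
          (fun l : Fin n => G.field p x (G.perm p t x l) - G.b P p * t),
          (fun l l' : Fin n => G.sortedQ p t x l l')))
      (fun x : Ω × (ℕ → ℝ) =>
        ((fun l : Fin n => G.w l x.1),
          (fun l : Fin n => G.field p x l),
          (fun l l' : Fin n => G.Q x.1 l l')))
      (P.prod stdGaussianSeq) (P.prod stdGaussianSeq)

end RandomAtomicMeasure

end SpinGlass

end

/-! Both stability properties are read through replicas. A replica law records, for finitely many
independent samples from the tilted weights, the field at the samples and their overlaps; it does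
not depend on how the atoms are listed (`replLaw_eq_of_identDistrib`). Write 𝔼⟨·⟩_t for the
resulting averages.

The engine is Gaussian integration by parts: 𝔼⟨f g_p(σ^k)⟩_t = t 𝔼⟨f (∑_{i ≤ n} R_{k,i}^p - n
R_{k,n+1}^p)⟩_t for functions f of n overlaps. Stochastic stability replaces the tilted law of the
overlaps by the untilted one. When R_{k,k} = q*, the Ghirlanda–Guerra identity says exactly that the
remaining average is b_p 𝔼⟨f⟩, so the tilt shifts the field by b_p t. Read backwards, with t = 1,
this gives the converse: unified stability makes the shifted field centered against every f, which
is the identity (`UnifiedStability.ghirlandaGuerra`).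

For the direct implication the same cancellation is iterated. By induction on the degree, the
moments of linear combinations of g_p(σ^i) - b_p t, weighted by a function of the overlaps, are
those of a Gaussian vector with covariance R^p, whatever t is (`integral_comb_pow`). Exponential
moments turn this into equality of replica laws (`replLaw_tilted_eq`).

It remains to recover the sorted arrays from replicas. On the sphere an overlap equals q* only if
the two atoms coincide, so further replicas measure the weight of a sampled atom and the power sums
of all weights. Polynomials in these statistics are averages of functions of overlaps, and
Stone–Weierstrass determines their joint law with the replica data (`map_weightStat_eq`). If the
weights are positive and have no ties, the power sums detect the event that the n replicas are the n
heaviest atoms in order; dividing by its conditional probability yields the law of the array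
(`lintegral_leading_eq`).

Three facts make this applicable. The identities force concentration on the sphere
(`GhirlandaGuerra.concentratedOnSphere`), and they leave either a single atom or infinitely many
(`GhirlandaGuerra.ae_w_pos`): in both cases a bad event would persist for all numbers of replicas,
while the identities make its probability decay along a divergent harmonic series. Ties are excluded
because a Gaussian tilt breaks them and stability carries this back to the original weights
(`AizenmanContucci.ae_w_strictAnti`). -/

noncomputable section

namespace SpinGlass

/-! ### Replicas sampled from random weights -/

section Replicas

variable {X : Type*} [MeasurableSpace X]

/-- The joint law of a point `x` and of replicas `l i`, `i : ι`, that are sampled independently from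
the weights `v · x`. -/
def repl (μ : Measure X) (v : ℕ → X → ℝ) (ι : Type) [Fintype ι] : Measure ((ι → ℕ) × X) :=
  (Measure.count.prod μ).withDensity fun z => ∏ i, ENNReal.ofReal (v (z.1 i) z.2)

/-- Random weights. -/
structure IsWeights (μ : Measure X) (v : ℕ → X → ℝ) : Prop where
  measurable : ∀ l, Measurable (v l)
  nonneg : ∀ l x, 0 ≤ v l x
  hasSum : ∀ᵐ x ∂μ, HasSum (fun l => v l x) 1

theorem measurable_of_countable_fst {α β γ : Type*} [Countable α] [MeasurableSpace α]
    [MeasurableSingletonClass α] [MeasurableSpace β] [MeasurableSpace γ] {f : α × β → γ}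
    (hf : ∀ a, Measurable fun b => f (a, b)) : Measurable f :=
  measurable_from_prod_countable_right hf

variable {μ : Measure X} {v : ℕ → X → ℝ} {ι κ : Type} [Fintype ι] [Fintype κ]

theorem measurable_prod_ofReal (hv : ∀ l, Measurable (v l)) :
    Measurable fun z : (ι → ℕ) × X => ∏ i, ENNReal.ofReal (v (z.1 i) z.2) :=
  measurable_of_countable_fst fun l =>
    Finset.measurable_fun_prod _ fun i _ => (hv (l i)).ennreal_ofReal

theorem lintegral_repl [SFinite μ] (hv : ∀ l, Measurable (v l)) {F : (ι → ℕ) × X → ℝ≥0∞}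
    (hF : Measurable F) :
    ∫⁻ z, F z ∂repl μ v ι = ∑' l : ι → ℕ, ∫⁻ x, (∏ i, ENNReal.ofReal (v (l i) x)) * F (l, x) ∂μ := by
  rw [repl, lintegral_withDensity_eq_lintegral_mul _ (measurable_prod_ofReal hv) hF,
    lintegral_prod _ ((measurable_prod_ofReal hv).mul hF).aemeasurable, lintegral_count]
  rfl

theorem lintegral_repl' [SFinite μ] (hv : ∀ l, Measurable (v l)) {F : (ι → ℕ) × X → ℝ≥0∞}
    (hF : Measurable F) :
    ∫⁻ z, F z ∂repl μ v ι = ∫⁻ x, ∑' l : ι → ℕ, (∏ i, ENNReal.ofReal (v (l i) x)) * F (l, x) ∂μ := by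
  rw [lintegral_repl hv hF, lintegral_tsum]
  intro l
  exact ((Finset.measurable_fun_prod _ fun i _ => (hv (l i)).ennreal_ofReal).mul
    (hF.comp measurable_prodMk_left)).aemeasurable

theorem toReal_prod_ofReal {n : ℕ → ℝ} (hn : ∀ l, 0 ≤ n l) (l : ι → ℕ) :
    (∏ i, ENNReal.ofReal (n (l i))).toReal = ∏ i, n (l i) := by
  rw [ENNReal.toReal_prod]
  exact Finset.prod_congr rfl fun i _ => ENNReal.toReal_ofReal (hn _)

theorem prod_ofReal_ne_top (u : ℕ → ℝ) (l : ι → ℕ) : ∏ i, ENNReal.ofReal (u (l i)) ≠ ∞ :=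
  ENNReal.prod_ne_top fun _ _ => ENNReal.ofReal_ne_top

theorem integrable_repl_iff (hv : ∀ l, Measurable (v l)) (h0 : ∀ l x, 0 ≤ v l x)
    {F : (ι → ℕ) × X → ℝ} :
    Integrable F (repl μ v ι) ↔
      Integrable (fun z : (ι → ℕ) × X => (∏ i, v (z.1 i) z.2) * F z) (Measure.count.prod μ) := by
  rw [repl, integrable_withDensity_iff_integrable_smul' (measurable_prod_ofReal hv)
    (ae_of_all _ fun z => (prod_ofReal_ne_top (fun l => v l z.2) z.1).lt_top)]
  simp only [smul_eq_mul]
  exact iff_of_eq (congrArg (Integrable · _)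
    (funext fun z => by rw [toReal_prod_ofReal (fun l => h0 l z.2)]))

theorem integral_repl_prod (hv : ∀ l, Measurable (v l)) (h0 : ∀ l x, 0 ≤ v l x)
    (F : (ι → ℕ) × X → ℝ) :
    ∫ z, F z ∂repl μ v ι = ∫ z : (ι → ℕ) × X, (∏ i, v (z.1 i) z.2) * F z ∂Measure.count.prod μ := by
  rw [repl, integral_withDensity_eq_integral_toReal_smul (measurable_prod_ofReal hv)
    (ae_of_all _ fun z => (prod_ofReal_ne_top (fun l => v l z.2) z.1).lt_top)]
  simp only [smul_eq_mul]
  exact congrArg (integral _)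
    (funext fun z => by rw [toReal_prod_ofReal (fun l => h0 l z.2)])

theorem integral_repl [SFinite μ] (hv : ∀ l, Measurable (v l)) (h0 : ∀ l x, 0 ≤ v l x)
    {F : (ι → ℕ) × X → ℝ} (hF : Integrable F (repl μ v ι)) :
    ∫ z, F z ∂repl μ v ι = ∫ x, ∑' l : ι → ℕ, (∏ i, v (l i) x) * F (l, x) ∂μ := by
  have h := (integrable_repl_iff hv h0).1 hF
  rw [integral_repl_prod hv h0, integral_prod_symm _ h]
  refine integral_congr_ae ?_
  filter_upwards [h.prod_left_ae] with x hx
  rw [integral_countable hx]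
  simp

theorem integral_repl_tsum [SFinite μ] (hv : ∀ l, Measurable (v l)) (h0 : ∀ l x, 0 ≤ v l x)
    {F : (ι → ℕ) × X → ℝ} (hF : Integrable F (repl μ v ι)) :
    ∫ z, F z ∂repl μ v ι = ∑' l : ι → ℕ, ∫ x, (∏ i, v (l i) x) * F (l, x) ∂μ := by
  have h := (integrable_repl_iff hv h0).1 hF
  rw [integral_repl_prod hv h0, integral_prod _ h, integral_countable h.integral_prod_left]
  simp

/-- Forgetting some of the replicas. -/
theorem tsum_prod_comp {u : ℕ → ℝ≥0∞} (hu : ∑' l, u l = 1) {e : ι → κ}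
    (he : Function.Injective e) (F : (ι → ℕ) → ℝ≥0∞) :
    ∑' l : κ → ℕ, (∏ k, u (l k)) * F (l ∘ e) = ∑' l : ι → ℕ, (∏ i, u (l i)) * F l := by
  classical
  -- Both sums are integrals against powers of one probability measure on ℕ, and an injective
  -- relabelling of coordinates maps a product measure to a product measure.
  set ν : Measure ℕ := Measure.count.withDensity u with hν
  have hνs : ∀ l, ν {l} = u l := fun l => by
    simp [hν]
  have : IsProbabilityMeasure ν := ⟨by
    rw [hν, withDensity_apply _ MeasurableSet.univ, Measure.restrict_univ, lintegral_count, hu]⟩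
  have key : ∀ {τ : Type} [Fintype τ] (G : (τ → ℕ) → ℝ≥0∞),
      ∑' l : τ → ℕ, (∏ k, u (l k)) * G l = ∫⁻ l, G l ∂Measure.pi fun _ : τ => ν := by
    intro τ _ G
    rw [lintegral_countable']
    refine tsum_congr fun l => ?_
    rw [Measure.pi_singleton, mul_comm]
    simp [hνs]
  have hmap : (Measure.pi fun _ : κ => ν).map (fun l => l ∘ e) = Measure.pi fun _ : ι => ν := by
    refine (Measure.pi_eq fun s hs => ?_).symm
    rw [Measure.map_apply (measurable_of_countable _) (MeasurableSet.univ_pi hs)]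
    have hpre : (fun l : κ → ℕ => l ∘ e) ⁻¹' Set.univ.pi s =
        Set.univ.pi fun k => {m : ℕ | ∀ i, e i = k → m ∈ s i} := by
      ext l
      simp only [Set.mem_preimage, Set.mem_pi, Set.mem_univ, forall_true_left, Function.comp_apply,
        Set.mem_ofPred_eq]
      exact ⟨fun h k i hi => hi ▸ h i, fun h i => h _ i rfl⟩
    rw [hpre, Measure.pi_pi]
    have hz : ∀ k ∈ (Finset.univ : Finset κ), k ∉ Finset.univ.image e →
        -- Coordinates outside the range of `e` are unconstrained, so they contribute a factor one.
        ν {m : ℕ | ∀ i, e i = k → m ∈ s i} = 1 := by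
      intro k _ hk
      have : {m : ℕ | ∀ i, e i = k → m ∈ s i} = Set.univ := by
        refine Set.eq_univ_of_forall fun m i hi => (hk ?_).elim
        exact Finset.mem_image.2 ⟨i, Finset.mem_univ _, hi⟩
      rw [this, measure_univ]
    rw [← Finset.prod_subset (Finset.subset_univ _) hz, Finset.prod_image (fun a _ b _ h => he h)]
    refine Finset.prod_congr rfl fun i _ => congrArg ν ?_
    ext m
    exact ⟨fun h => h i rfl, fun h j hj => he hj ▸ h⟩
  rw [key, key, ← hmap, lintegral_map (measurable_of_countable _) (measurable_of_countable _)]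


theorem tsum_ofReal_eq_one {u : ℕ → ℝ} (h0 : ∀ l, 0 ≤ u l) (h : HasSum u 1) :
    ∑' l, ENNReal.ofReal (u l) = 1 := by
  rw [← ENNReal.ofReal_tsum_of_nonneg h0 h.summable, h.tsum_eq, ENNReal.ofReal_one]

omit [Fintype ι] in
theorem measurable_comp_fst {γ : Type*} [MeasurableSpace γ] {g : (ι → ℕ) × X → γ}
    (hg : Measurable g) (e : ι → κ) : Measurable fun z : (κ → ℕ) × X => g (z.1 ∘ e, z.2) :=
  measurable_of_countable_fst fun l =>
    hg.comp (measurable_prodMk_left (x := l ∘ e))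

/-- One statement covers both the consistency of replica laws (`e` an inclusion) and their
exchangeability (`e` a bijection). -/
theorem repl_map_comp [SFinite μ] (hv : IsWeights μ v) {e : ι → κ} (he : Function.Injective e) :
    (repl μ v κ).map (fun z => (z.1 ∘ e, z.2)) = repl μ v ι := by
  have hm : Measurable fun z : (κ → ℕ) × X => (z.1 ∘ e, z.2) :=
    measurable_comp_fst measurable_id e
  refine Measure.ext_of_lintegral _ fun F hF => ?_
  have hFm : Measurable fun z : (κ → ℕ) × X => F (z.1 ∘ e, z.2) := hF.comp hm
  rw [lintegral_map hF hm, lintegral_repl' hv.measurable hFm,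
    lintegral_repl' hv.measurable hF]
  refine lintegral_congr_ae ?_
  filter_upwards [hv.hasSum] with x hx
  exact tsum_prod_comp (tsum_ofReal_eq_one (fun l => hv.nonneg l x) hx) he fun l => F (l, x)

instance [SFinite μ] : SFinite (repl μ v ι) := by unfold repl; infer_instance

theorem isProbabilityMeasure_repl [IsProbabilityMeasure μ] (hv : IsWeights μ v) :
    IsProbabilityMeasure (repl μ v ι) := by
  -- Forgetting every replica leaves the law `μ` of the disorder, which has mass one.
  have h := repl_map_comp (κ := ι) hv (e := (Empty.elim : Empty → ι)) (fun a => a.elim)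
  refine ⟨?_⟩
  have hm : Measurable fun z : (ι → ℕ) × X => (z.1 ∘ (Empty.elim : Empty → ι), z.2) :=
    measurable_comp_fst measurable_id _
  rw [← Set.preimage_univ (f := fun z : (ι → ℕ) × X => (z.1 ∘ (Empty.elim : Empty → ι), z.2)),
    ← Measure.map_apply hm MeasurableSet.univ, h, ← lintegral_one,
    lintegral_repl hv.measurable measurable_const]
  simp

theorem measurePreserving_snd_repl [SFinite μ] (hv : IsWeights μ v) :
    MeasurePreserving Prod.snd (repl μ v ι) μ := by
  refine ⟨measurable_snd, Measure.ext_of_lintegral _ fun F hF => ?_⟩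
  have hFm : Measurable fun z : (ι → ℕ) × X => F z.2 := hF.comp measurable_snd
  rw [lintegral_map hF measurable_snd, lintegral_repl' hv.measurable hFm]
  refine lintegral_congr_ae ?_
  filter_upwards [hv.hasSum] with x hx
  have := tsum_prod_comp (κ := ι) (tsum_ofReal_eq_one (fun l => hv.nonneg l x) hx)
    (e := (Empty.elim : Empty → ι)) (fun a => a.elim) fun _ => F x
  simpa using this

theorem measurable_sumElim :
    Measurable fun z : (κ → ℕ) × ((ι → ℕ) × X) =>
      ((Sum.elim z.2.1 z.1 : ι ⊕ κ → ℕ), z.2.2) :=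
  measurable_of_countable_fst fun l' => measurable_of_countable_fst fun l =>
    measurable_prodMk_left (x := (Sum.elim l l' : ι ⊕ κ → ℕ))

/-- Replicas may be sampled in two steps. -/
theorem measurePreserving_sumElim [SFinite μ] (hv : IsWeights μ v) :
    MeasurePreserving (fun z : (κ → ℕ) × ((ι → ℕ) × X) =>
        ((Sum.elim z.2.1 z.1 : ι ⊕ κ → ℕ), z.2.2))
      (repl (repl μ v ι) (fun l z => v l z.2) κ) (repl μ v (ι ⊕ κ)) := by
  refine ⟨measurable_sumElim, Measure.ext_of_lintegral _ fun F hF => ?_⟩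
  have hv' : ∀ l, Measurable fun z : (ι → ℕ) × X => v l z.2 := fun l =>
    (hv.measurable l).comp measurable_snd
  have hFm : Measurable fun z : (κ → ℕ) × ((ι → ℕ) × X) =>
      F ((Sum.elim z.2.1 z.1 : ι ⊕ κ → ℕ), z.2.2) := hF.comp measurable_sumElim
  rw [lintegral_map hF measurable_sumElim, lintegral_repl hv' hFm,
    lintegral_repl hv.measurable hF, ← (Equiv.sumArrowEquivProdArrow ι κ ℕ).symm.tsum_eq,
    ENNReal.tsum_prod', ENNReal.tsum_comm]
  refine tsum_congr fun l' => ?_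
  rw [lintegral_repl hv.measurable]
  · refine tsum_congr fun l => lintegral_congr fun x => ?_
    simp only [Fintype.prod_sum_type, Equiv.sumArrowEquivProdArrow, Equiv.coe_fn_symm_mk,
      Sum.elim_inl, Sum.elim_inr]
    ring
  · exact (Finset.measurable_fun_prod _ fun i _ => (hv' (l' i)).ennreal_ofReal).mul
      (hFm.comp measurable_prodMk_left)

/-- Averaging over the second batch of replicas, given the first, becomes an explicit weighted sum.
Read from right to left, a weighted sum inside an average is one more batch of replicas. -/
theorem integral_repl_sum [SFinite μ] (hv : IsWeights μ v) {F : (ι ⊕ κ → ℕ) × X → ℝ}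
    (hF : Integrable F (repl μ v (ι ⊕ κ))) :
    ∫ z, F z ∂repl μ v (ι ⊕ κ) =
      ∫ z, ∑' l' : κ → ℕ, (∏ k, v (l' k) z.2) * F (Sum.elim z.1 l', z.2) ∂repl μ v ι := by
  have h := measurePreserving_sumElim (ι := ι) (κ := κ) hv
  have h1 : AEStronglyMeasurable F (Measure.map (fun z : (κ → ℕ) × ((ι → ℕ) × X) =>
        ((Sum.elim z.2.1 z.1 : ι ⊕ κ → ℕ), z.2.2))
      (repl (repl μ v ι) (fun l z => v l z.2) κ)) := h.map_eq ▸ hF.aestronglyMeasurable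
  have h2 : Integrable (fun z : (κ → ℕ) × ((ι → ℕ) × X) =>
      F ((Sum.elim z.2.1 z.1 : ι ⊕ κ → ℕ), z.2.2))
      (repl (repl μ v ι) (fun l z => v l z.2) κ) := h.integrable_comp_of_integrable hF
  have hv' : ∀ l, Measurable fun z : (ι → ℕ) × X => v l z.2 := fun l =>
    (hv.measurable l).comp measurable_snd
  rw [← h.map_eq, integral_map h.measurable.aemeasurable h1,
    integral_repl hv' (fun l z => hv.nonneg l z.2) h2]

end Replicas

end SpinGlass

namespace SpinGlass

/-! ### Measures on the line determined by their moments -/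

theorem integrable_exp_mul_abs {ρ : Measure ℝ} (h : ∀ u : ℝ, Integrable (fun x => Real.exp (u * x)) ρ)
    (u : ℝ) : Integrable (fun x => Real.exp (u * |x|)) ρ := by
  refine ((h u).add (h (-u))).mono' (by fun_prop) (ae_of_all _ fun x => ?_)
  rw [Real.norm_of_nonneg (Real.exp_nonneg _)]
  simp only [Pi.add_apply]
  rcases abs_cases x with ⟨hx, _⟩ | ⟨hx, _⟩ <;> rw [hx]
  · linarith [Real.exp_nonneg (-u * x)]
  · rw [mul_neg, ← neg_mul]
    linarith [Real.exp_nonneg (u * x)]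

/-- Exponential moments of all orders dominate the exponential series, so the characteristic
function is everywhere the sum of a power series whose coefficients are the moments. -/
theorem ext_of_moments {ρ τ : Measure ℝ} [IsFiniteMeasure ρ] [IsFiniteMeasure τ]
    (hρ : ∀ u : ℝ, Integrable (fun x => Real.exp (u * x)) ρ)
    (hτ : ∀ u : ℝ, Integrable (fun x => Real.exp (u * x)) τ)
    (h : ∀ m : ℕ, ∫ x, x ^ m ∂ρ = ∫ x, x ^ m ∂τ) : ρ = τ := by
  have key : ∀ (σ : Measure ℝ) [IsFiniteMeasure σ],
      (∀ u : ℝ, Integrable (fun x => Real.exp (u * x)) σ) → ∀ t : ℝ,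
      HasSum (fun m : ℕ => ((t * Complex.I) ^ m / (m.factorial : ℂ)) * ((∫ x, x ^ m ∂σ : ℝ) : ℂ))
        (charFun σ t) := by
    intro σ _ hσ t
    have hb : ∀ x : ℝ, HasSum (fun m : ℕ => |t * x| ^ m / (m.factorial : ℝ))
        (Real.exp (|t| * |x|)) := fun x => by
      rw [← abs_mul, Real.exp_eq_exp_ℝ]
      exact NormedSpace.expSeries_div_hasSum_exp |t * x|
    have := hasSum_integral_of_dominated_convergence (μ := σ)
      (F := fun (m : ℕ) (x : ℝ) => ((t * x * Complex.I : ℂ)) ^ m / (m.factorial : ℂ))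
      (f := fun x : ℝ => Complex.exp (t * x * Complex.I))
      (fun m x => |t * x| ^ m / (m.factorial : ℝ))
      (fun m => by fun_prop)
      (fun m => ae_of_all _ fun x => by simp [abs_mul])
      (ae_of_all _ fun x => (hb x).summable)
      (by
        simp only [(hb _).tsum_eq]
        exact integrable_exp_mul_abs hσ |t|)
      (ae_of_all _ fun x => by
        rw [Complex.exp_eq_exp_ℂ]
        exact NormedSpace.expSeries_div_hasSum_exp _)
    rw [charFun_apply_real]
    have e : ∀ m : ℕ, ((t * Complex.I) ^ m / (m.factorial : ℂ)) * ((∫ x, x ^ m ∂σ : ℝ) : ℂ) =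
        ∫ x : ℝ, ((t * x * Complex.I : ℂ)) ^ m / (m.factorial : ℂ) ∂σ := fun m => by
      rw [← integral_complex_ofReal, ← integral_const_mul]
      refine integral_congr_ae (ae_of_all _ fun x => ?_)
      push_cast
      ring
    simp only [e]
    exact this
  refine Measure.ext_of_charFun (funext fun t => ?_)
  have h1 := key ρ hρ t
  simp only [h] at h1
  exact h1.unique (key τ hτ t)

/-! ### Gaussian integration by parts -/

/-- Stein's identity: the standard Gaussian density φ satisfies φ' = -xφ, so this is integration by
parts on the line. -/
theorem integral_id_mul_gaussianReal {f f' : ℝ → ℝ} (hf : ∀ x, HasDerivAt f (f' x) x)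
    (h1 : Integrable f (gaussianReal 0 1)) (h2 : Integrable f' (gaussianReal 0 1))
    (h3 : Integrable (fun x => x * f x) (gaussianReal 0 1)) :
    ∫ x, x * f x ∂gaussianReal 0 1 = ∫ x, f' x ∂gaussianReal 0 1 := by
  have hint : ∀ g : ℝ → ℝ, Integrable g (gaussianReal 0 1) →
      Integrable fun x => gaussianPDFReal 0 1 x * g x := by
    intro g hg
    rw [gaussianReal_of_var_ne_zero _ one_ne_zero, integrable_withDensity_iff_integrable_smul'
      (measurable_gaussianPDF _ _) (ae_of_all _ fun _ => gaussianPDF_lt_top)] at hg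
    simpa [toReal_gaussianPDF] using hg
  have hder : ∀ x, HasDerivAt (gaussianPDFReal 0 1) (-(x * gaussianPDFReal 0 1 x)) x := by
    intro x
    rw [gaussianPDFReal_def]
    have : HasDerivAt (fun x : ℝ => -(x - 0) ^ 2 / (2 * ((1 : NNReal) : ℝ))) (-x) x := by
      have h : HasDerivAt (fun x : ℝ => -x ^ 2 / 2) (-(2 * x) / 2) x := by
        simpa using (hasDerivAt_pow 2 x).neg.div_const 2
      simpa [neg_div] using h
    refine ((this.exp).const_mul _).congr_deriv ?_
    ring
  rw [integral_gaussianReal_eq_integral_smul one_ne_zero,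
    integral_gaussianReal_eq_integral_smul one_ne_zero]
  have := integral_mul_deriv_eq_deriv_mul_of_integrable (u := f) (v := gaussianPDFReal 0 1)
    (u' := f') (v' := fun x => -(x * gaussianPDFReal 0 1 x)) (fun x _ => hf x) (fun x _ => hder x)
    ((hint _ h3).neg.congr (ae_of_all _ fun x => by simp; ring))
    ((hint _ h2).congr (ae_of_all _ fun x => by simp; ring))
    ((hint _ h1).congr (ae_of_all _ fun x => by simp; ring))
  have h4 : ∫ x, f x * -(x * gaussianPDFReal 0 1 x) = - ∫ x, gaussianPDFReal 0 1 x * (x * f x) := by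
    rw [← integral_neg]
    exact integral_congr_ae (ae_of_all _ fun x => by simp; ring)
  rw [h4, neg_inj] at this
  simp only [smul_eq_mul]
  rw [this]
  exact integral_congr_ae (ae_of_all _ fun x => by simp; ring)

theorem measurable_update_pair (m : ℕ) :
    Measurable fun z : ℝ × (ℕ → ℝ) => Function.update z.2 m z.1 := by
  refine measurable_pi_iff.2 fun i => ?_
  by_cases h : i = m
  · subst h
    simpa using measurable_fst
  · simp only [Function.update_of_ne h]
    exact (measurable_pi_apply i).comp measurable_snd

/-- Resampling one of the variables. -/
theorem measurePreserving_update (m : ℕ) :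
    MeasurePreserving (fun z : ℝ × (ℕ → ℝ) => Function.update z.2 m z.1)
      ((gaussianReal 0 1).prod stdGaussianSeq) stdGaussianSeq := by
  refine ⟨measurable_update_pair m, ?_⟩
  refine Measure.eq_infinitePi _ fun s t ht => ?_
  rw [Measure.map_apply (measurable_update_pair m)
    (MeasurableSet.pi s.countable_toSet fun i _ => ht i)]
  -- The preimage of a box is a box: the side at `m`, if any, moves to the resampled variable and
  -- the old coordinate `m` becomes free.
  have hpre : (fun z : ℝ × (ℕ → ℝ) => Function.update z.2 m z.1) ⁻¹' Set.pi s t =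
      (if m ∈ s then t m else Set.univ) ×ˢ Set.pi (s.erase m : Finset ℕ) t := by
    ext z
    simp only [Set.mem_preimage, Set.mem_pi, Set.mem_prod, Finset.coe_erase, Set.mem_sdiff,
      Finset.mem_coe, Set.mem_singleton_iff]
    constructor
    · refine fun h => ⟨?_, fun i hi => ?_⟩
      · split_ifs with hm
        · simpa using h m hm
        · trivial
      · simpa [hi.2] using h i hi.1
    · rintro ⟨h1, h2⟩ i hi
      by_cases him : i = m
      · subst him
        simpa [hi] using h1
      · simpa [him] using h2 i ⟨hi, him⟩
  rw [hpre, Measure.prod_prod, stdGaussianSeq, Measure.infinitePi_pi _ fun i _ => ht i]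
  split_ifs with hm
  · rw [Finset.mul_prod_erase s (fun i => gaussianReal 0 1 (t i)) hm]
  · rw [measure_univ, one_mul, Finset.erase_eq_of_notMem hm]

/-- Resampling coordinate `m` does not change the law, so Stein's identity applies to this
coordinate with all the others frozen. -/
theorem integral_eval_mul_stdGaussianSeq {Φ Φ' : (ℕ → ℝ) → ℝ} (m : ℕ)
    (hΦ : ∀ γ, HasDerivAt (fun y => Φ (Function.update γ m y)) (Φ' γ) (γ m))
    (h1 : Integrable Φ stdGaussianSeq) (h2 : Integrable Φ' stdGaussianSeq)
    (h3 : Integrable (fun γ => γ m * Φ γ) stdGaussianSeq) :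
    ∫ γ, γ m * Φ γ ∂stdGaussianSeq = ∫ γ, Φ' γ ∂stdGaussianSeq := by
  have hmp := measurePreserving_update m
  have hint : ∀ F : (ℕ → ℝ) → ℝ, Integrable F stdGaussianSeq →
      Integrable (fun z : ℝ × (ℕ → ℝ) => F (Function.update z.2 m z.1))
        ((gaussianReal 0 1).prod stdGaussianSeq) := fun F hF =>
    hmp.integrable_comp_of_integrable hF
  have hfub : ∀ F : (ℕ → ℝ) → ℝ, Integrable F stdGaussianSeq → ∫ γ, F γ ∂stdGaussianSeq =
      ∫ γ, ∫ y, F (Function.update γ m y) ∂gaussianReal 0 1 ∂stdGaussianSeq := by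
    intro F hF
    rw [← integral_prod_symm _ (hint F hF)]
    conv_lhs => rw [← hmp.map_eq]
    rw [integral_map hmp.measurable.aemeasurable]
    rw [hmp.map_eq]
    exact hF.aestronglyMeasurable
  rw [hfub _ h3, hfub _ h2]
  refine integral_congr_ae ?_
  filter_upwards [(hint _ h1).prod_left_ae, (hint _ h2).prod_left_ae, (hint _ h3).prod_left_ae]
    with γ k1 k2 k3
  simp only [Function.update_self] at k3 ⊢
  refine integral_id_mul_gaussianReal (fun y => ?_) k1 k2 k3
  simpa using hΦ (Function.update γ m y)

/-- The entries of the Cholesky root of a covariance matrix. -/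
def chol (C : Matrix ℕ ℕ ℝ) (l m : ℕ) : ℝ := residual C m l m / √(residual C m m m)

theorem gaussianSeq_eq_sum {C : Matrix ℕ ℕ ℝ} (hC : C.PosSemidef) {l N : ℕ} (h : l < N)
    (γ : ℕ → ℝ) : gaussianSeq C γ l = ∑ m ∈ Finset.range N, chol C l m * γ m :=
  Finset.sum_subset (Finset.range_subset_range.mpr h) fun m _ hm => by
    rw [residual_eq_zero hC (by simpa using hm), zero_div, zero_mul]

/-- The product of the Cholesky root with its transpose is `C`: the summands are the successive
differences of the residuals, the sum telescopes, and row `l` is eliminated after step `l`. -/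
theorem sum_chol_mul_chol {C : Matrix ℕ ℕ ℝ} (hC : C.PosSemidef) {l N : ℕ} (h : l < N) (l' : ℕ) :
    ∑ m ∈ Finset.range N, chol C l m * chol C l' m = C l l' := by
  have hterm : ∀ m ∈ Finset.range N, chol C l m * chol C l' m =
      residual C m l l' - residual C (m + 1) l l' := by
    intro m _
    have hs : residual C m l' m = residual C m m l' := by
      simpa using (residual_posSemidef hC m).1.apply m l'
    rw [chol, chol, div_mul_div_comm, Real.mul_self_sqrt (residual_posSemidef hC m).diag_nonneg, hs]
    simp [residual_succ_apply]
  rw [Finset.sum_congr rfl hterm, Finset.sum_range_sub', residual_eq_zero hC h, sub_zero]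
  rfl

theorem hasDerivAt_gaussianSeq {C : Matrix ℕ ℕ ℝ} (hC : C.PosSemidef) (l m : ℕ) (γ : ℕ → ℝ)
    (y : ℝ) : HasDerivAt (fun y => gaussianSeq C (Function.update γ m y) l) (chol C l m) y := by
  set N := max l m + 1
  have hm : m ∈ Finset.range N := by simp [N]
  have h : ∀ y, gaussianSeq C (Function.update γ m y) l =
      chol C l m * y + ∑ k ∈ (Finset.range N).erase m, chol C l k * γ k := by
    intro y
    rw [gaussianSeq_eq_sum hC (show l < N by omega), ← Finset.add_sum_erase _ _ hm,
      Function.update_self]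
    congr 1
    refine Finset.sum_congr rfl fun k hk => ?_
    rw [Function.update_of_ne (Finset.ne_of_mem_erase hk)]
  simp only [h]
  simpa using (((hasDerivAt_id' y).const_mul (chol C l m)).add_const
    (∑ k ∈ (Finset.range N).erase m, chol C l k * γ k))

end SpinGlass

namespace SpinGlass

/-! ### Integration by parts for the tilted weights -/

/-- The weights proportional to `w · exp (t g)`, restricted to the first `N` atoms. -/
def truncWeight (N : ℕ) (w : ℕ → ℝ) (t : ℝ) (g : ℕ → ℝ) (l : ℕ) : ℝ :=
  w l * Real.exp (t * g l) / ∑ j ∈ Finset.range N, w j * Real.exp (t * g j)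

/-- The weights proportional to `w · exp (t g)`. -/
def gibbsWeight (w : ℕ → ℝ) (t : ℝ) (g : ℕ → ℝ) (l : ℕ) : ℝ :=
  w l * Real.exp (t * g l) / ∑' j, w j * Real.exp (t * g j)

section

variable {ι : Type} [Fintype ι] {w : ℕ → ℝ} {N : ℕ} {t : ℝ} {g : ℕ → ℝ}

theorem trunc_sum_pos (hw : ∀ l, 0 ≤ w l) (hw0 : 0 < w 0) (hN : 0 < N) :
    0 < ∑ j ∈ Finset.range N, w j * Real.exp (t * g j) :=
  Finset.sum_pos' (fun j _ => mul_nonneg (hw j) (Real.exp_nonneg _))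
    ⟨0, Finset.mem_range.2 hN, mul_pos hw0 (Real.exp_pos _)⟩

theorem truncWeight_nonneg (hw : ∀ l, 0 ≤ w l) (l : ℕ) : 0 ≤ truncWeight N w t g l :=
  div_nonneg (mul_nonneg (hw l) (Real.exp_nonneg _))
    (Finset.sum_nonneg fun j _ => mul_nonneg (hw j) (Real.exp_nonneg _))

theorem truncWeight_le_one (hw : ∀ l, 0 ≤ w l) {l : ℕ} (hl : l < N) :
    truncWeight N w t g l ≤ 1 :=
  div_le_one_of_le₀ (Finset.single_le_sum (f := fun j => w j * Real.exp (t * g j))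
    (fun j _ => mul_nonneg (hw j) (Real.exp_nonneg _)) (Finset.mem_range.2 hl))
    (Finset.sum_nonneg fun j _ => mul_nonneg (hw j) (Real.exp_nonneg _))

theorem sum_truncWeight (hw : ∀ l, 0 ≤ w l) (hw0 : 0 < w 0) (hN : 0 < N) :
    ∑ j ∈ Finset.range N, truncWeight N w t g j = 1 := by
  simp only [truncWeight]
  rw [← Finset.sum_div, div_self (trunc_sum_pos hw hw0 hN).ne']

theorem abs_prod_le_one {u : ι → ℝ} (h0 : ∀ i, 0 ≤ u i) (h1 : ∀ i, u i ≤ 1) : |∏ i, u i| ≤ 1 := by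
  rw [abs_of_nonneg (Finset.prod_nonneg fun i _ => h0 i)]
  exact Finset.prod_le_one (fun i _ => h0 i) fun i _ => h1 i

/-- The logarithmic derivative of a Gibbs weight is t(a_l - ⟨a⟩), the average coming from the
normalization. -/
theorem hasDerivAt_truncWeight (hw : ∀ l, 0 ≤ w l) (hw0 : 0 < w 0) (hN : 0 < N)
    {h : ℝ → ℕ → ℝ} {a : ℕ → ℝ} {y : ℝ} (hh : ∀ l, HasDerivAt (fun y => h y l) (a l) y) (l : ℕ) :
    HasDerivAt (fun y => truncWeight N w t (h y) l)
      (truncWeight N w t (h y) l *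
        (t * (a l - ∑ j ∈ Finset.range N, truncWeight N w t (h y) j * a j))) y := by
  have he : ∀ j, HasDerivAt (fun y => w j * Real.exp (t * h y j))
      (w j * (Real.exp (t * h y j) * (t * a j))) y := fun j =>
    (((hh j).const_mul t).exp).const_mul _
  have hZ := HasDerivAt.fun_sum fun j (_ : j ∈ Finset.range N) => he j
  have hZ0 := (trunc_sum_pos (t := t) (g := h y) hw hw0 hN).ne'
  refine ((he l).div hZ hZ0).congr_deriv ?_
  have h1 : ∑ j ∈ Finset.range N, truncWeight N w t (h y) j * a j =
      (∑ j ∈ Finset.range N, w j * Real.exp (t * h y j) * a j) /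
        ∑ j ∈ Finset.range N, w j * Real.exp (t * h y j) := by
    simp only [truncWeight]
    rw [Finset.sum_div]
    exact Finset.sum_congr rfl fun j _ => by ring
  have h2 : ∑ j ∈ Finset.range N, w j * (Real.exp (t * h y j) * (t * a j)) =
      t * ∑ j ∈ Finset.range N, w j * Real.exp (t * h y j) * a j := by
    rw [Finset.mul_sum]
    exact Finset.sum_congr rfl fun j _ => by ring
  rw [h1, h2, truncWeight]
  field_simp

/-- Each factor of the product of weights contributes one -t⟨a⟩. This is the source of the factor
`Fintype.card ι`, and eventually of the additional replica. -/
theorem hasDerivAt_trunc_prod_mul_pow (hw : ∀ l, 0 ≤ w l) (hw0 : 0 < w 0) (hN : 0 < N)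
    {h : ℝ → ℕ → ℝ} {a : ℕ → ℝ} {y : ℝ} (hh : ∀ l, HasDerivAt (fun y => h y l) (a l) y)
    (l : ι → ℕ) (lam : ι → ℝ) (c : ℝ) (r : ℕ) :
    HasDerivAt
      (fun y => (∏ i, truncWeight N w t (h y) (l i)) * (∑ i, lam i * (h y (l i) - c)) ^ r)
      ((∏ i, truncWeight N w t (h y) (l i)) *
        (r * (∑ i, lam i * (h y (l i) - c)) ^ (r - 1) * (∑ i, lam i * a (l i)) +
          t * (∑ i, lam i * (h y (l i) - c)) ^ r *
            (∑ i, a (l i) - Fintype.card ι *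
              ∑ j ∈ Finset.range N, truncWeight N w t (h y) j * a j))) y := by
  classical
  have h1 := HasDerivAt.fun_finsetProd (u := Finset.univ) fun i (_ : i ∈ Finset.univ) =>
    hasDerivAt_truncWeight (t := t) hw hw0 hN hh (l i)
  have h2 := (HasDerivAt.fun_sum (u := Finset.univ) fun i (_ : i ∈ Finset.univ) =>
    ((hh (l i)).sub_const c).const_mul (lam i)).fun_pow r
  refine (h1.mul h2).congr_deriv ?_
  have h3 : ∀ i ∈ Finset.univ, (∏ j ∈ Finset.univ.erase i, truncWeight N w t (h y) (l j)) •
      (truncWeight N w t (h y) (l i) *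
        (t * (a (l i) - ∑ j ∈ Finset.range N, truncWeight N w t (h y) j * a j))) =
      (∏ i, truncWeight N w t (h y) (l i)) * (t *
        (a (l i) - ∑ j ∈ Finset.range N, truncWeight N w t (h y) j * a j)) := by
    intro i hi
    rw [← Finset.mul_prod_erase _ _ hi, smul_eq_mul]
    ring
  rw [Finset.sum_congr rfl h3, ← Finset.mul_sum, ← Finset.mul_sum, Finset.sum_sub_distrib,
    Finset.sum_const, Finset.card_univ, nsmul_eq_mul]
  ring

theorem measurable_gaussianSeq (C : Matrix ℕ ℕ ℝ) (l : ℕ) :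
    Measurable fun γ => gaussianSeq C γ l :=
  Finset.measurable_fun_sum _ fun m _ => (measurable_pi_apply m).const_mul _

theorem memLp_gaussianSeq (C : Matrix ℕ ℕ ℝ) (l q : ℕ) :
    MemLp (fun γ => gaussianSeq C γ l) q stdGaussianSeq :=
  ((isGaussianProcess_gaussianSeq C).hasGaussianLaw_eval l).memLp (by simp)

/-- Linear combinations of a centered Gaussian sequence, shifted by `c`. -/
def gaussianComb (C : Matrix ℕ ℕ ℝ) (l : ι → ℕ) (lam : ι → ℝ) (c : ℝ) (γ : ℕ → ℝ) : ℝ :=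
  ∑ i, lam i * (gaussianSeq C γ (l i) - c)

theorem measurable_gaussianComb (C : Matrix ℕ ℕ ℝ) (l : ι → ℕ) (lam : ι → ℝ) (c : ℝ) :
    Measurable (gaussianComb C l lam c) :=
  Finset.measurable_fun_sum _ fun i _ => ((measurable_gaussianSeq C (l i)).sub_const c).const_mul _

theorem memLp_gaussianComb (C : Matrix ℕ ℕ ℝ) (l : ι → ℕ) (lam : ι → ℝ) (c : ℝ) (q : ℕ) :
    MemLp (gaussianComb C l lam c) q stdGaussianSeq :=
  memLp_finsetSum _ fun i _ => ((memLp_gaussianSeq C (l i) q).sub (memLp_const c)).const_mul _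

theorem integrable_gaussianComb_pow (C : Matrix ℕ ℕ ℝ) (l : ι → ℕ) (lam : ι → ℝ) (c : ℝ) (r : ℕ) :
    Integrable (fun γ => gaussianComb C l lam c γ ^ r) stdGaussianSeq :=
  (memLp_gaussianComb C l lam c r).integrable_norm_pow'.mono
    ((measurable_gaussianComb C l lam c).pow_const r).aestronglyMeasurable
    (ae_of_all _ fun γ => by simp)

theorem integrable_gaussianComb_pow_mul (C : Matrix ℕ ℕ ℝ) (l : ι → ℕ) (lam : ι → ℝ) (c : ℝ)
    (r : ℕ) {f : (ℕ → ℝ) → ℝ} (hf : MemLp f 2 stdGaussianSeq) :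
    Integrable (fun γ => gaussianComb C l lam c γ ^ r * f γ) stdGaussianSeq := by
  refine MemLp.integrable_mul (p := 2) (q := 2) ?_ hf
  rw [memLp_two_iff_integrable_sq
    ((measurable_gaussianComb C l lam c).pow_const r).aestronglyMeasurable]
  simp only [← pow_mul]
  exact integrable_gaussianComb_pow C l lam c (r * 2)

theorem measurable_truncWeight (C : Matrix ℕ ℕ ℝ) (l : ℕ) :
    Measurable fun γ => truncWeight N w t (gaussianSeq C γ) l := by
  have h : ∀ j, Measurable fun γ => w j * Real.exp (t * gaussianSeq C γ j) := fun j =>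
    (((measurable_gaussianSeq C j).const_mul t).exp).const_mul _
  exact (h l).div (Finset.measurable_fun_sum _ fun j _ => h j)

/-- The interaction term of the integration by parts. -/
theorem abs_sum_truncWeight_mul_le (hw : ∀ l, 0 ≤ w l) (hw0 : 0 < w 0) (hN : 0 < N) {a : ℕ → ℝ}
    {B : ℝ} (ha : ∀ j, |a j| ≤ B) :
    |∑ j ∈ Finset.range N, truncWeight N w t g j * a j| ≤ B := by
  calc _ ≤ ∑ j ∈ Finset.range N, |truncWeight N w t g j * a j| := Finset.abs_sum_le_sum_abs _ _
    _ ≤ ∑ j ∈ Finset.range N, truncWeight N w t g j * B := by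
        refine Finset.sum_le_sum fun j _ => ?_
        rw [abs_mul, abs_of_nonneg (truncWeight_nonneg hw j)]
        exact mul_le_mul_of_nonneg_left (ha j) (truncWeight_nonneg hw j)
    _ = B := by rw [← Finset.sum_mul, sum_truncWeight hw hw0 hN, one_mul]

/-- With only `N` atoms the partition function is a finite sum, differentiable at every point. The
integrability claims are part of the conclusion because the identity is summed over `m` afterwards.
-/
theorem integral_trunc_mul_eval {C : Matrix ℕ ℕ ℝ} (hC : C.PosSemidef) (hw : ∀ l, 0 ≤ w l)
    (hw0 : 0 < w 0) (l : ι → ℕ) (hl : ∀ i, l i < N) (hN : 0 < N)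
    (lam : ι → ℝ) (c : ℝ) (r m : ℕ) :
    Integrable (fun γ => γ m * ((∏ i, truncWeight N w t (gaussianSeq C γ) (l i)) *
        gaussianComb C l lam c γ ^ r)) stdGaussianSeq ∧
    Integrable (fun γ => (∏ i, truncWeight N w t (gaussianSeq C γ) (l i)) *
        (r * gaussianComb C l lam c γ ^ (r - 1) * (∑ i, lam i * chol C (l i) m) +
          t * gaussianComb C l lam c γ ^ r * (∑ i, chol C (l i) m - Fintype.card ι *
            ∑ j ∈ Finset.range N, truncWeight N w t (gaussianSeq C γ) j * chol C j m)))
        stdGaussianSeq ∧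
    ∫ γ, γ m * ((∏ i, truncWeight N w t (gaussianSeq C γ) (l i)) *
        gaussianComb C l lam c γ ^ r) ∂stdGaussianSeq =
      ∫ γ, (∏ i, truncWeight N w t (gaussianSeq C γ) (l i)) *
        (r * gaussianComb C l lam c γ ^ (r - 1) * (∑ i, lam i * chol C (l i) m) +
          t * gaussianComb C l lam c γ ^ r * (∑ i, chol C (l i) m - Fintype.card ι *
            ∑ j ∈ Finset.range N, truncWeight N w t (gaussianSeq C γ) j * chol C j m))
        ∂stdGaussianSeq := by
  have hU : Measurable fun γ => ∏ i, truncWeight N w t (gaussianSeq C γ) (l i) :=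
    Finset.measurable_fun_prod _ fun i _ => measurable_truncWeight C (l i)
  have hU1 : ∀ γ, ‖∏ i, truncWeight N w t (gaussianSeq C γ) (l i)‖ ≤ 1 := fun γ =>
    abs_prod_le_one (fun i => truncWeight_nonneg hw _) fun i => truncWeight_le_one hw (hl i)
  have h1 : Integrable (fun γ => (∏ i, truncWeight N w t (gaussianSeq C γ) (l i)) *
        gaussianComb C l lam c γ ^ r) stdGaussianSeq :=
    (integrable_gaussianComb_pow C l lam c r).bdd_mul hU.aestronglyMeasurable (ae_of_all _ hU1)
  have h3 : Integrable (fun γ => γ m * ((∏ i, truncWeight N w t (gaussianSeq C γ) (l i)) *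
        gaussianComb C l lam c γ ^ r)) stdGaussianSeq := by
    refine ((integrable_gaussianComb_pow_mul C l lam c r (memLp_eval m)).bdd_mul
      hU.aestronglyMeasurable (ae_of_all _ hU1)).congr (ae_of_all _ fun γ => ?_)
    simp only
    ring
  have hA : Measurable fun γ => ∑ i, chol C (l i) m - Fintype.card ι *
      ∑ j ∈ Finset.range N, truncWeight N w t (gaussianSeq C γ) j * chol C j m :=
    measurable_const.sub ((Finset.measurable_fun_sum _ fun j _ =>
      (measurable_truncWeight C j).mul_const _).const_mul _)
  obtain ⟨B, hB⟩ : ∃ B, ∀ γ, ‖∑ i, chol C (l i) m - Fintype.card ι *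
      ∑ j ∈ Finset.range N, truncWeight N w t (gaussianSeq C γ) j * chol C j m‖ ≤ B := by
    refine ⟨|∑ i, chol C (l i) m| + Fintype.card ι * ∑ j ∈ Finset.range N, |chol C j m|,
      fun γ => (norm_sub_le _ _).trans (add_le_add le_rfl ?_)⟩
    rw [norm_mul, Real.norm_of_nonneg (Nat.cast_nonneg _)]
    refine mul_le_mul_of_nonneg_left ((norm_sum_le _ _).trans (Finset.sum_le_sum fun j hj => ?_))
      (Nat.cast_nonneg _)
    rw [norm_mul, Real.norm_of_nonneg (truncWeight_nonneg hw _)]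
    exact mul_le_of_le_one_left (abs_nonneg _) (truncWeight_le_one hw (Finset.mem_range.1 hj))
  have h2 := (((integrable_gaussianComb_pow C l lam c (r - 1)).const_mul
    (r * (∑ i, lam i * chol C (l i) m))).add
    (((integrable_gaussianComb_pow C l lam c r).const_mul t).mul_bdd hA.aestronglyMeasurable
      (ae_of_all _ hB))).bdd_mul hU.aestronglyMeasurable (ae_of_all _ hU1)
  have h2' : Integrable (fun γ => (∏ i, truncWeight N w t (gaussianSeq C γ) (l i)) *
        (r * gaussianComb C l lam c γ ^ (r - 1) * (∑ i, lam i * chol C (l i) m) +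
          t * gaussianComb C l lam c γ ^ r * (∑ i, chol C (l i) m - Fintype.card ι *
            ∑ j ∈ Finset.range N, truncWeight N w t (gaussianSeq C γ) j * chol C j m)))
        stdGaussianSeq := by
    refine h2.congr (ae_of_all _ fun γ => ?_)
    simp only [Pi.add_apply]
    ring
  refine ⟨h3, h2', integral_eval_mul_stdGaussianSeq m (fun γ => ?_) h1 h2' h3⟩
  have := hasDerivAt_trunc_prod_mul_pow (t := t) hw hw0 hN
    (h := fun y l => gaussianSeq C (Function.update γ m y) l) (y := γ m)
    (fun l => hasDerivAt_gaussianSeq hC l m γ (γ m)) l lam c r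
  simp only [Function.update_eq_self] at this
  exact this

/-- The field at `k` is a combination of the coordinates with coefficients `chol C k m`. Summing the
one-coordinate identities with these coefficients collapses the products of Cholesky entries to
entries of `C`. -/
theorem integral_trunc_mul_gaussianSeq {C : Matrix ℕ ℕ ℝ} (hC : C.PosSemidef) (hw : ∀ l, 0 ≤ w l)
    (hw0 : 0 < w 0) (l : ι → ℕ) (hl : ∀ i, l i < N) {k : ℕ} (hk : k < N)
    (lam : ι → ℝ) (c : ℝ) (r : ℕ) :
    ∫ γ, (∏ i, truncWeight N w t (gaussianSeq C γ) (l i)) *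
        (gaussianComb C l lam c γ ^ r * gaussianSeq C γ k) ∂stdGaussianSeq =
      ∫ γ, (∏ i, truncWeight N w t (gaussianSeq C γ) (l i)) *
        (r * gaussianComb C l lam c γ ^ (r - 1) * (∑ i, lam i * C k (l i)) +
          t * gaussianComb C l lam c γ ^ r * (∑ i, C k (l i) - Fintype.card ι *
            ∑ j ∈ Finset.range N, truncWeight N w t (gaussianSeq C γ) j * C k j))
        ∂stdGaussianSeq := by
  have h := fun m => integral_trunc_mul_eval (t := t) hC hw hw0 l hl (by omega) lam c r m
  calc _ = ∫ γ, ∑ m ∈ Finset.range N, chol C k m *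
        (γ m * ((∏ i, truncWeight N w t (gaussianSeq C γ) (l i)) *
        gaussianComb C l lam c γ ^ r)) ∂stdGaussianSeq := by
        refine integral_congr_ae (ae_of_all _ fun γ => ?_)
        simp only [gaussianSeq_eq_sum hC hk, Finset.mul_sum]
        exact Finset.sum_congr rfl fun m _ => by ring
    _ = ∑ m ∈ Finset.range N, chol C k m * ∫ γ,
        (∏ i, truncWeight N w t (gaussianSeq C γ) (l i)) *
        (r * gaussianComb C l lam c γ ^ (r - 1) * (∑ i, lam i * chol C (l i) m) +
          t * gaussianComb C l lam c γ ^ r * (∑ i, chol C (l i) m - Fintype.card ι *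
            ∑ j ∈ Finset.range N, truncWeight N w t (gaussianSeq C γ) j * chol C j m))
        ∂stdGaussianSeq := by
        rw [integral_finsetSum _ fun m _ => (h m).1.const_mul _]
        exact Finset.sum_congr rfl fun m _ => by rw [integral_const_mul, (h m).2.2]
    _ = _ := by
        simp only [← integral_const_mul]
        rw [← integral_finsetSum _ fun m _ => (h m).2.1.const_mul _]
        refine integral_congr_ae (ae_of_all _ fun γ => ?_)
        have e1 : ∑ i, lam i * C k (l i) =
            ∑ m ∈ Finset.range N, chol C k m * ∑ i, lam i * chol C (l i) m := by
          simp only [Finset.mul_sum]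
          rw [Finset.sum_comm]
          refine Finset.sum_congr rfl fun i _ => ?_
          rw [← sum_chol_mul_chol hC hk, Finset.mul_sum]
          exact Finset.sum_congr rfl fun m _ => by ring
        have e2 : ∑ i, C k (l i) = ∑ m ∈ Finset.range N, chol C k m * ∑ i, chol C (l i) m := by
          simp only [Finset.mul_sum]
          rw [Finset.sum_comm]
          exact Finset.sum_congr rfl fun i _ => (sum_chol_mul_chol hC hk _).symm
        have e3 : ∑ j ∈ Finset.range N, truncWeight N w t (gaussianSeq C γ) j * C k j =
            ∑ m ∈ Finset.range N, chol C k m *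
              ∑ j ∈ Finset.range N, truncWeight N w t (gaussianSeq C γ) j * chol C j m := by
          simp only [Finset.mul_sum]
          rw [Finset.sum_comm]
          refine Finset.sum_congr rfl fun j _ => ?_
          rw [← sum_chol_mul_chol hC hk, Finset.mul_sum]
          exact Finset.sum_congr rfl fun m _ => by ring
        simp only
        rw [e1, e2, e3, Finset.mul_sum, Finset.mul_sum, ← Finset.sum_sub_distrib, Finset.mul_sum,
          ← Finset.sum_add_distrib, Finset.mul_sum]
        exact Finset.sum_congr rfl fun m _ => by ring

end

end SpinGlass

/-! ### Removal of the truncation, and exponential moments under the tilted weights -/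

namespace SpinGlass

section

open Filter Topology

variable {ι : Type} [Fintype ι] {w : ℕ → ℝ} {t : ℝ}

theorem hasGaussianLaw_gaussianSeq {C : Matrix ℕ ℕ ℝ} (hC : C.PosSemidef) (l : ℕ) :
    stdGaussianSeq.map (fun γ => gaussianSeq C γ l) = gaussianReal 0 (C l l).toNNReal := by
  have h := ((isGaussianProcess_gaussianSeq C).hasGaussianLaw_eval l).map_eq_gaussianReal
  rw [h, integral_gaussianSeq, ← covariance_self (measurable_gaussianSeq C l).aemeasurable,
    covariance_gaussianSeq hC]

/-- An exponential moment bound that is uniform in the covariance matrix. -/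
theorem lintegral_exp_gaussianSeq_le {C : Matrix ℕ ℕ ℝ} (hC : C.PosSemidef)
    (hC1 : ∀ i j, |C i j| ≤ 1) (l : ℕ) (a : ℝ) :
    ∫⁻ γ, ENNReal.ofReal (Real.exp (a * gaussianSeq C γ l)) ∂stdGaussianSeq ≤
      ENNReal.ofReal (Real.exp (a ^ 2 / 2)) := by
  have hm : Measurable fun x : ℝ => ENNReal.ofReal (Real.exp (a * x)) := by fun_prop
  rw [← lintegral_map (f := fun x : ℝ => ENNReal.ofReal (Real.exp (a * x))) hm
    (measurable_gaussianSeq C l), hasGaussianLaw_gaussianSeq hC,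
    ← ofReal_integral_eq_lintegral_ofReal (integrable_exp_mul_gaussianReal a)
      (ae_of_all _ fun _ => Real.exp_nonneg _)]
  have := congrFun (mgf_id_gaussianReal (μ := 0) (v := (C l l).toNNReal)) a
  simp only [mgf, id] at this
  rw [this]
  refine ENNReal.ofReal_le_ofReal (Real.exp_le_exp.2 ?_)
  rw [Real.coe_toNNReal _ hC.diag_nonneg]
  nlinarith [sq_nonneg a, (abs_le.1 (hC1 l l)).2]

/-- The expected partition function is at most exp(t²/2) ∑ w, hence finite, so the partition
function is finite almost surely. -/
theorem ae_summable_gibbs {C : Matrix ℕ ℕ ℝ} (hC : C.PosSemidef)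
    (hC1 : ∀ i j, |C i j| ≤ 1) (hw : ∀ l, 0 ≤ w l) (hs : Summable w) (t : ℝ) :
    ∀ᵐ γ ∂stdGaussianSeq, Summable fun l => w l * Real.exp (t * gaussianSeq C γ l) := by
  have hm : ∀ l, Measurable fun γ => ENNReal.ofReal (w l * Real.exp (t * gaussianSeq C γ l)) :=
    fun l => ((((measurable_gaussianSeq C l).const_mul t).exp).const_mul _).ennreal_ofReal
  have hfin : ∫⁻ γ, ∑' l, ENNReal.ofReal (w l * Real.exp (t * gaussianSeq C γ l))
      ∂stdGaussianSeq ≠ ∞ := by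
    rw [lintegral_tsum fun l => (hm l).aemeasurable]
    refine ne_top_of_le_ne_top ?_ (ENNReal.tsum_le_tsum fun l =>
      (show _ ≤ ENNReal.ofReal (w l) * ENNReal.ofReal (Real.exp (t ^ 2 / 2)) from ?_))
    · rw [ENNReal.tsum_mul_right, ← ENNReal.ofReal_tsum_of_nonneg hw hs]
      exact ENNReal.mul_ne_top ENNReal.ofReal_ne_top ENNReal.ofReal_ne_top
    · simp only [ENNReal.ofReal_mul (hw l)]
      rw [lintegral_const_mul']
      · gcongr
        exact lintegral_exp_gaussianSeq_le hC hC1 l t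
      · exact ENNReal.ofReal_ne_top
  filter_upwards [ae_lt_top (Measurable.tsum hm) hfin] with γ hγ
  have := ENNReal.summable_toReal hγ.ne
  simpa [ENNReal.toReal_ofReal, mul_nonneg, hw, Real.exp_nonneg] using this

theorem tsum_gibbs_pos {g : ℕ → ℝ} (hw : ∀ l, 0 ≤ w l) (hw0 : 0 < w 0)
    (hs : Summable fun l => w l * Real.exp (t * g l)) : 0 < ∑' j, w j * Real.exp (t * g j) :=
  hs.tsum_pos (fun j => mul_nonneg (hw j) (Real.exp_nonneg _)) 0 (mul_pos hw0 (Real.exp_pos _))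

theorem gibbsWeight_nonneg {g : ℕ → ℝ} (hw : ∀ l, 0 ≤ w l) (l : ℕ) : 0 ≤ gibbsWeight w t g l :=
  div_nonneg (mul_nonneg (hw l) (Real.exp_nonneg _))
    (tsum_nonneg fun j => mul_nonneg (hw j) (Real.exp_nonneg _))

theorem hasSum_gibbsWeight {g : ℕ → ℝ} (hw : ∀ l, 0 ≤ w l) (hw0 : 0 < w 0)
    (hs : Summable fun l => w l * Real.exp (t * g l)) : HasSum (gibbsWeight w t g) 1 := by
  have := hs.hasSum.div_const (∑' j, w j * Real.exp (t * g j))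
  rwa [div_self (tsum_gibbs_pos hw hw0 hs).ne'] at this

theorem tendsto_truncWeight {g : ℕ → ℝ} (hw : ∀ l, 0 ≤ w l) (hw0 : 0 < w 0)
    (hs : Summable fun l => w l * Real.exp (t * g l)) (l : ℕ) :
    Tendsto (fun N => truncWeight N w t g l) atTop (𝓝 (gibbsWeight w t g l)) :=
  tendsto_const_nhds.div hs.hasSum.tendsto_sum_nat (tsum_gibbs_pos hw hw0 hs).ne'

theorem tendsto_sum_truncWeight_mul {g a : ℕ → ℝ} (hw : ∀ l, 0 ≤ w l) (hw0 : 0 < w 0)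
    (hs : Summable fun l => w l * Real.exp (t * g l)) {B : ℝ} (ha : ∀ j, |a j| ≤ B) :
    Tendsto (fun N => ∑ j ∈ Finset.range N, truncWeight N w t g j * a j) atTop
      (𝓝 (∑' j, gibbsWeight w t g j * a j)) := by
  have h1 : Summable fun j => w j * Real.exp (t * g j) * a j := by
    refine Summable.of_norm_bounded (hs.mul_right B) fun j => ?_
    rw [norm_mul, Real.norm_of_nonneg (mul_nonneg (hw j) (Real.exp_nonneg _))]
    exact mul_le_mul_of_nonneg_left (ha j) (mul_nonneg (hw j) (Real.exp_nonneg _))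
  have h2 := h1.hasSum.tendsto_sum_nat.div hs.hasSum.tendsto_sum_nat
    (tsum_gibbs_pos hw hw0 hs).ne'
  have e1 : ∀ N, ∑ j ∈ Finset.range N, truncWeight N w t g j * a j =
      (∑ j ∈ Finset.range N, w j * Real.exp (t * g j) * a j) /
        ∑ j ∈ Finset.range N, w j * Real.exp (t * g j) := fun N => by
    rw [Finset.sum_div]
    exact Finset.sum_congr rfl fun j _ => by rw [truncWeight]; ring
  have e2 : ∑' j, gibbsWeight w t g j * a j =
      (∑' j, w j * Real.exp (t * g j) * a j) / ∑' j, w j * Real.exp (t * g j) := by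
    rw [← tsum_div_const]
    exact tsum_congr fun j => by rw [gibbsWeight]; ring
  simp only [e1, e2]
  exact h2

/-- Gaussian integration by parts for the tilted weights. -/
theorem integral_gibbs_mul_gaussianSeq {C : Matrix ℕ ℕ ℝ} (hC : C.PosSemidef)
    (hC1 : ∀ i j, |C i j| ≤ 1) (hw : ∀ l, 0 ≤ w l) (hw0 : 0 < w 0) (hs : Summable w)
    (l : ι → ℕ) (k : ℕ) (lam : ι → ℝ) (c : ℝ) (r : ℕ) :
    ∫ γ, (∏ i, gibbsWeight w t (gaussianSeq C γ) (l i)) *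
        (gaussianComb C l lam c γ ^ r * gaussianSeq C γ k) ∂stdGaussianSeq =
      ∫ γ, (∏ i, gibbsWeight w t (gaussianSeq C γ) (l i)) *
        (r * gaussianComb C l lam c γ ^ (r - 1) * (∑ i, lam i * C k (l i)) +
          t * gaussianComb C l lam c γ ^ r * (∑ i, C k (l i) - Fintype.card ι *
            ∑' j, gibbsWeight w t (gaussianSeq C γ) j * C k j)) ∂stdGaussianSeq := by
  -- For N ≥ M all the indices in play are below the cut-off, so the truncated weights at them are
  -- at most one; this is the domination for both limits.
  set M := max (Finset.univ.sup l) k + 1 with hM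
  have hl : ∀ i, l i < M := fun i =>
    Nat.lt_succ_of_le ((Finset.le_sup (Finset.mem_univ i)).trans (le_max_left _ _))
  have hk : k < M := Nat.lt_succ_of_le (le_max_right _ _)
  have hU : ∀ N, Measurable fun γ => ∏ i, truncWeight N w t (gaussianSeq C γ) (l i) := fun N =>
    Finset.measurable_fun_prod _ fun i _ => measurable_truncWeight C (l i)
  have hS := measurable_gaussianComb C l lam c
  have hU1 : ∀ N, M ≤ N → ∀ γ, |∏ i, truncWeight N w t (gaussianSeq C γ) (l i)| ≤ 1 :=
    fun N hN γ => abs_prod_le_one (fun i => truncWeight_nonneg hw _)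
      fun i => truncWeight_le_one hw ((hl i).trans_le hN)
  have hlimU : ∀ᵐ γ ∂stdGaussianSeq, Tendsto
      (fun N => ∏ i, truncWeight N w t (gaussianSeq C γ) (l i)) atTop
      (𝓝 (∏ i, gibbsWeight w t (gaussianSeq C γ) (l i))) := by
    filter_upwards [ae_summable_gibbs hC hC1 hw hs t] with γ hγ
    exact tendsto_finsetProd _ fun i _ => tendsto_truncWeight hw hw0 hγ (l i)
  have hL : Tendsto (fun N => ∫ γ, (∏ i, truncWeight N w t (gaussianSeq C γ) (l i)) *
        (gaussianComb C l lam c γ ^ r * gaussianSeq C γ k) ∂stdGaussianSeq) atTop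
      (𝓝 (∫ γ, (∏ i, gibbsWeight w t (gaussianSeq C γ) (l i)) *
        (gaussianComb C l lam c γ ^ r * gaussianSeq C γ k) ∂stdGaussianSeq)) := by
    refine tendsto_integral_filter_of_dominated_convergence
      (fun γ => ‖gaussianComb C l lam c γ ^ r * gaussianSeq C γ k‖)
      (Eventually.of_forall fun N => ((hU N).mul ((hS.pow_const r).mul
        (measurable_gaussianSeq C k))).aestronglyMeasurable) ?_
      (integrable_gaussianComb_pow_mul C l lam c r (memLp_gaussianSeq C k 2)).norm ?_
    · filter_upwards [eventually_ge_atTop M] with N hN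
      refine ae_of_all _ fun γ => ?_
      rw [norm_mul]
      exact mul_le_of_le_one_left (norm_nonneg _) (hU1 N hN γ)
    · filter_upwards [hlimU] with γ hγ
      exact hγ.mul_const _
  have hR : Tendsto (fun N => ∫ γ, (∏ i, truncWeight N w t (gaussianSeq C γ) (l i)) *
        (r * gaussianComb C l lam c γ ^ (r - 1) * (∑ i, lam i * C k (l i)) +
          t * gaussianComb C l lam c γ ^ r * (∑ i, C k (l i) - Fintype.card ι *
            ∑ j ∈ Finset.range N, truncWeight N w t (gaussianSeq C γ) j * C k j))
              ∂stdGaussianSeq) atTop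
      (𝓝 (∫ γ, (∏ i, gibbsWeight w t (gaussianSeq C γ) (l i)) *
        (r * gaussianComb C l lam c γ ^ (r - 1) * (∑ i, lam i * C k (l i)) +
          t * gaussianComb C l lam c γ ^ r * (∑ i, C k (l i) - Fintype.card ι *
            ∑' j, gibbsWeight w t (gaussianSeq C γ) j * C k j)) ∂stdGaussianSeq)) := by
    refine tendsto_integral_filter_of_dominated_convergence
      (fun γ => ‖r * gaussianComb C l lam c γ ^ (r - 1) * (∑ i, lam i * C k (l i))‖ +
        ‖t * gaussianComb C l lam c γ ^ r‖ * (‖∑ i, C k (l i)‖ + Fintype.card ι))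
      (Eventually.of_forall fun N => ((hU N).mul ((((hS.pow_const (r - 1)).const_mul _).mul_const
        _).add (((hS.pow_const r).const_mul t).mul (measurable_const.sub
        ((Finset.measurable_fun_sum _ fun j _ =>
          (measurable_truncWeight C j).mul_const _).const_mul _))))).aestronglyMeasurable) ?_ ?_ ?_
    · filter_upwards [eventually_ge_atTop M] with N hN
      refine ae_of_all _ fun γ => ?_
      rw [norm_mul]
      refine (mul_le_of_le_one_left (norm_nonneg _) (hU1 N hN γ)).trans
        ((norm_add_le _ _).trans (add_le_add le_rfl ?_))
      rw [norm_mul]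
      refine mul_le_mul_of_nonneg_left ((norm_sub_le _ _).trans (add_le_add le_rfl ?_))
        (norm_nonneg _)
      rw [norm_mul, Real.norm_of_nonneg (Nat.cast_nonneg _)]
      exact mul_le_of_le_one_right (Nat.cast_nonneg _)
        (abs_sum_truncWeight_mul_le hw hw0 (by omega) (hC1 k))
    · exact (((integrable_gaussianComb_pow C l lam c (r - 1)).const_mul _).mul_const _).norm.add
        (((integrable_gaussianComb_pow C l lam c r).const_mul t).norm.mul_const _)
    · filter_upwards [hlimU, ae_summable_gibbs hC hC1 hw hs t] with γ hγ hγs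
      exact hγ.mul (tendsto_const_nhds.add (tendsto_const_nhds.mul (tendsto_const_nhds.sub
        ((tendsto_sum_truncWeight_mul hw hw0 hγs (hC1 k)).const_mul _))))
  refine tendsto_nhds_unique hL (hR.congr' ?_)
  filter_upwards [eventually_ge_atTop M] with N hN
  exact (integral_trunc_mul_gaussianSeq hC hw hw0 l (fun i => (hl i).trans_le hN)
    (hk.trans_le hN) lam c r).symm

/-- Exponential moments of the field under the tilted weights. -/
theorem inv_tsum_le {g : ℕ → ℝ} (hw : ∀ l, 0 ≤ w l) (hw0 : 0 < w 0) (h1 : HasSum w 1)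
    (hs : Summable fun l => w l * Real.exp (t * g l))
    (hs' : Summable fun l => w l * Real.exp (-t * g l)) :
    (∑' j, w j * Real.exp (t * g j))⁻¹ ≤ ∑' j, w j * Real.exp (-t * g j) := by
  set Z := ∑' j, w j * Real.exp (t * g j) with hZ
  have hZ0 : 0 < Z := tsum_gibbs_pos hw hw0 hs
  -- Jensen's inequality for 1/x by hand: 2/Z - e/Z² is the tangent of 1/x at Z, hence at most 1/e,
  -- and its average under `w` is 1/Z.
  have h2 : HasSum (fun j => w j * (2 / Z) - w j * Real.exp (t * g j) / Z ^ 2)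
      (1 * (2 / Z) - Z / Z ^ 2) := (h1.mul_right _).sub (hs.hasSum.div_const _)
  have h3 : 1 * (2 / Z) - Z / Z ^ 2 = Z⁻¹ := by
    field_simp
    norm_num
  rw [← h3, ← h2.tsum_eq]
  refine h2.summable.tsum_le_tsum (fun j => ?_) hs'
  rw [mul_div_assoc, ← mul_sub]
  refine mul_le_mul_of_nonneg_left ?_ (hw j)
  rw [neg_mul, Real.exp_neg]
  set e := Real.exp (t * g j)
  have he : 0 < e := Real.exp_pos _
  rw [div_sub_div _ _ hZ0.ne' (by positivity), ← one_div, div_le_div_iff₀ (by positivity) he]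
  nlinarith [mul_nonneg hZ0.le (sq_nonneg (Z - e))]

/-- `inv_tsum_le` removes the denominator at the price of a second sum over atoms, and ab ≤ a² + b²
separates the two exponentials. The bound depends on neither `C` nor `w`, so it survives integration
over the disorder. -/
theorem lintegral_gibbs_exp_le {C : Matrix ℕ ℕ ℝ} (hC : C.PosSemidef)
    (hC1 : ∀ i j, |C i j| ≤ 1) (hw : ∀ l, 0 ≤ w l) (hw0 : 0 < w 0) (h1 : HasSum w 1) (t a : ℝ) :
    ∫⁻ γ, ∑' l, ENNReal.ofReal (gibbsWeight w t (gaussianSeq C γ) l) *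
        ENNReal.ofReal (Real.exp (a * gaussianSeq C γ l)) ∂stdGaussianSeq ≤
      ENNReal.ofReal (Real.exp ((2 * (t + a)) ^ 2 / 2)) +
        ENNReal.ofReal (Real.exp ((2 * (-t)) ^ 2 / 2)) := by
  have hE : ∀ l (b : ℝ), Measurable fun γ => ENNReal.ofReal (Real.exp (b * gaussianSeq C γ l)) :=
    fun l b => ((measurable_gaussianSeq C l).const_mul b).exp.ennreal_ofReal
  calc _ ≤ ∫⁻ γ, ∑' l, ∑' l', ENNReal.ofReal (w l) * ENNReal.ofReal (w l') *
        (ENNReal.ofReal (Real.exp (2 * (t + a) * gaussianSeq C γ l)) +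
          ENNReal.ofReal (Real.exp (2 * (-t) * gaussianSeq C γ l'))) ∂stdGaussianSeq := by
        refine lintegral_mono_ae ?_
        filter_upwards [ae_summable_gibbs hC hC1 hw h1.summable t,
          ae_summable_gibbs hC hC1 hw h1.summable (-t)] with γ hs hs'
        refine ENNReal.tsum_le_tsum fun l => ?_
        set g := gaussianSeq C γ
        have hb : ∀ l', (0 : ℝ) ≤ w l' * Real.exp (-t * g l') := fun l' =>
          mul_nonneg (hw l') (Real.exp_nonneg _)
        have h3 : gibbsWeight w t g l * Real.exp (a * g l) ≤
            w l * Real.exp ((t + a) * g l) * ∑' l', w l' * Real.exp (-t * g l') := by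
          rw [gibbsWeight, div_eq_mul_inv, mul_right_comm, mul_assoc (w l), ← Real.exp_add,
            ← add_mul]
          exact mul_le_mul_of_nonneg_left (inv_tsum_le hw hw0 h1 hs hs')
            (mul_nonneg (hw l) (Real.exp_nonneg _))
        rw [← ENNReal.ofReal_mul (gibbsWeight_nonneg hw l)]
        refine (ENNReal.ofReal_le_ofReal h3).trans ?_
        rw [ENNReal.ofReal_mul (mul_nonneg (hw l) (Real.exp_nonneg _)),
          ENNReal.ofReal_tsum_of_nonneg hb hs', ← ENNReal.tsum_mul_left]
        refine ENNReal.tsum_le_tsum fun l' => ?_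
        rw [← ENNReal.ofReal_mul (mul_nonneg (hw l) (Real.exp_nonneg _)),
          ← ENNReal.ofReal_add (Real.exp_nonneg _) (Real.exp_nonneg _),
          ← ENNReal.ofReal_mul (hw l), ← ENNReal.ofReal_mul (mul_nonneg (hw l) (hw l'))]
        refine ENNReal.ofReal_le_ofReal ?_
        have e1 : Real.exp (2 * (t + a) * g l) = Real.exp ((t + a) * g l) ^ 2 := by
          rw [← Real.exp_nat_mul]; congr 1; push_cast; ring
        have e2 : Real.exp (2 * (-t) * g l') = Real.exp (-t * g l') ^ 2 := by
          rw [← Real.exp_nat_mul]; congr 1; push_cast; ring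
        rw [e1, e2, mul_mul_mul_comm]
        refine mul_le_mul_of_nonneg_left ?_ (mul_nonneg (hw l) (hw l'))
        nlinarith [sq_nonneg (Real.exp ((t + a) * g l) - Real.exp (-t * g l')),
          sq_nonneg (Real.exp ((t + a) * g l)), sq_nonneg (Real.exp (-t * g l'))]
    _ = ∑' l, ∑' l', ENNReal.ofReal (w l) * ENNReal.ofReal (w l') *
        ((∫⁻ γ, ENNReal.ofReal (Real.exp (2 * (t + a) * gaussianSeq C γ l)) ∂stdGaussianSeq) +
        ∫⁻ γ, ENNReal.ofReal (Real.exp (2 * (-t) * gaussianSeq C γ l')) ∂stdGaussianSeq) := by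
        have hE2 : ∀ l l', Measurable fun γ =>
            ENNReal.ofReal (Real.exp (2 * (t + a) * gaussianSeq C γ l)) +
              ENNReal.ofReal (Real.exp (2 * (-t) * gaussianSeq C γ l')) :=
          fun l l' => (hE l _).add (hE l' _)
        rw [lintegral_tsum fun l => (Measurable.tsum fun l' =>
          (hE2 l l').const_mul _).aemeasurable]
        refine tsum_congr fun l => ?_
        rw [lintegral_tsum fun l' => ((hE2 l l').const_mul _).aemeasurable]
        refine tsum_congr fun l' => ?_
        rw [lintegral_const_mul _ (hE2 l l'), lintegral_add_left (hE l _)]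
    _ ≤ ∑' l, ∑' l', ENNReal.ofReal (w l) * ENNReal.ofReal (w l') *
        (ENNReal.ofReal (Real.exp ((2 * (t + a)) ^ 2 / 2)) +
        ENNReal.ofReal (Real.exp ((2 * (-t)) ^ 2 / 2))) := by
        gcongr with l l'
        · exact lintegral_exp_gaussianSeq_le hC hC1 l _
        · exact lintegral_exp_gaussianSeq_le hC hC1 l' _
    _ = _ := by
        simp only [ENNReal.tsum_mul_right, ENNReal.tsum_mul_left, tsum_ofReal_eq_one hw h1, one_mul,
          mul_one]

end

end SpinGlass

namespace SpinGlass

/-! ### Existence and measurability of the sorting permutation -/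

section Sorting

open Filter Topology

/-- `j` comes before `k` when `v` is sorted. -/
def Precedes (v : ℕ → ℝ) (j k : ℕ) : Prop := v k < v j ∨ (v k = v j ∧ j < k)

variable {v : ℕ → ℝ}

theorem Precedes.trans {i j k : ℕ} (h1 : Precedes v i j) (h2 : Precedes v j k) :
    Precedes v i k := by
  unfold Precedes at *
  grind

theorem not_precedes_self (k : ℕ) : ¬ Precedes v k k := by
  unfold Precedes
  grind

theorem precedes_total {j k : ℕ} (h : j ≠ k) : Precedes v j k ∨ Precedes v k j := by
  unfold Precedes
  grind

/-- Positive terms tending to zero leave only finitely many predecessors of each term. The number of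
predecessors is then a bijection of ℕ, and its inverse sorts. -/
theorem exists_isSorting (hpos : ∀ l, 0 < v l) (h0 : Tendsto v cofinite (𝓝 0)) :
    ∃ π, IsSorting v π := by
  have hfin : ∀ k, {j | Precedes v j k}.Finite := fun k => by
    have := h0.eventually (gt_mem_nhds (hpos k))
    rw [eventually_cofinite] at this
    refine this.subset fun j hj => ?_
    rcases hj with hj | hj
    · exact not_lt.2 hj.le
    · exact not_lt.2 hj.1.le
  set s : ℕ → Finset ℕ := fun k => (hfin k).toFinset with hs
  have hmem : ∀ j k, j ∈ s k ↔ Precedes v j k := fun j k => by simp [hs]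
  set r : ℕ → ℕ := fun k => (s k).card with hr
  have hmono : ∀ {j k}, Precedes v j k → r j < r k := by
    intro j k hjk
    refine Finset.card_lt_card (Finset.ssubset_iff_of_subset ?_ |>.2
      ⟨j, (hmem _ _).2 hjk, fun h => not_precedes_self j ((hmem _ _).1 h)⟩)
    exact fun i hi => (hmem _ _).2 (((hmem _ _).1 hi).trans hjk)
  have hinj : Function.Injective r := by
    intro j k hjk
    by_contra hne
    rcases precedes_total (v := v) hne with h | h
    · exact (hmono h).ne hjk
    · exact (hmono h).ne' hjk
  have hsurj : Function.Surjective r := by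
    intro i
    obtain ⟨m, ⟨k, rfl⟩, hk⟩ := (Set.infinite_range_of_injective hinj).exists_gt i
    -- The `r k` predecessors of `k` have distinct ranks below `r k`, so they exhaust these ranks;
    -- since ranks are unbounded, every rank is attained.
    have himg : (s k).image r = Finset.range (r k) := by
      refine Finset.eq_of_subset_of_card_le (fun m hm => ?_) ?_
      · obtain ⟨j, hj, rfl⟩ := Finset.mem_image.1 hm
        exact Finset.mem_range.2 (hmono ((hmem _ _).1 hj))
      · rw [Finset.card_image_of_injective _ hinj, Finset.card_range]
    have : i ∈ (s k).image r := himg ▸ Finset.mem_range.2 hk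
    obtain ⟨j, _, rfl⟩ := Finset.mem_image.1 this
    exact ⟨j, rfl⟩
  set e := Equiv.ofBijective r ⟨hinj, hsurj⟩
  have he : ∀ i, r (e.symm i) = i := fun i => e.apply_symm_apply i
  refine ⟨e.symm, fun i j hij => ?_⟩
  rcases precedes_total (v := v) (e.symm.injective.ne hij.ne) with h | h
  · exact h
  · have := hmono h
    rw [he, he] at this
    omega

theorem IsSorting.precedes_iff {π : Equiv.Perm ℕ} (h : IsSorting v π) {i j : ℕ} :
    Precedes v (π i) (π j) ↔ i < j := by
  refine ⟨fun hp => ?_, fun hij => h i j hij⟩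
  by_contra hcon
  rcases (not_lt.1 hcon).lt_or_eq with hlt | rfl
  · exact not_precedes_self _ (hp.trans (h j i hlt))
  · exact not_precedes_self _ hp

open Classical in
/-- The number of terms that precede the term `k`. -/
def sortRank (v : ℕ → ℝ) (k : ℕ) : ℝ≥0∞ := ∑' j, if Precedes v j k then 1 else 0

theorem IsSorting.sortRank_eq {π : Equiv.Perm ℕ} (h : IsSorting v π) (i : ℕ) :
    sortRank v (π i) = i := by
  classical
  rw [sortRank, ← π.tsum_eq]
  simp only [h.precedes_iff]
  rw [tsum_eq_sum (s := Finset.range i) fun j hj => if_neg (by simpa using hj)]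
  rw [Finset.sum_congr rfl fun j hj => if_pos (Finset.mem_range.1 hj)]
  simp

variable {X : Type*} [MeasurableSpace X]

theorem measurable_sortRank {v : X → ℕ → ℝ} (hv : ∀ l, Measurable fun x => v x l) (k : ℕ) :
    Measurable fun x => sortRank (v x) k := by
  classical
  refine Measurable.tsum fun j => Measurable.ite ?_ measurable_const measurable_const
  exact (measurableSet_lt (hv k) (hv j)).union
    ((measurableSet_eq_fun (hv k) (hv j)).inter (MeasurableSet.const _))

/-- `sortPerm` is defined by choice. Whenever a sorting exists, its value at `i` is the only index
of rank `i`, which a measurable search finds. -/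
theorem aemeasurable_sortPerm {μ : Measure X} {v : X → ℕ → ℝ}
    (hv : ∀ l, Measurable fun x => v x l) (hs : ∀ᵐ x ∂μ, ∃ π, IsSorting (v x) π) (i : ℕ) :
    AEMeasurable (fun x => sortPerm (v x) i) μ := by
  classical
  -- The second alternative only makes the search terminate where no index has rank `i`.
  let p : X → ℕ → Prop := fun x k => sortRank (v x) k = i ∨ ∀ k', sortRank (v x) k' ≠ i
  have hp : ∀ x, ∃ k, p x k := fun x => by
    by_cases h : ∃ k, sortRank (v x) k = i
    · exact h.imp fun k hk => Or.inl hk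
    · exact ⟨0, Or.inr fun k' hk' => h ⟨k', hk'⟩⟩
  have hm : ∀ k, MeasurableSet {x | sortRank (v x) k = i} := fun k =>
    measurableSet_eq_fun (measurable_sortRank hv k) measurable_const
  have hm' : ∀ k, MeasurableSet {x | p x k} := fun k => by
    have hne : MeasurableSet {x | ∀ k', sortRank (v x) k' ≠ i} := by
      rw [show {x | ∀ k', sortRank (v x) k' ≠ i} = ⋂ k', {x | sortRank (v x) k' = i}ᶜ by
        ext; simp]
      exact MeasurableSet.iInter fun k' => (hm k').compl
    exact (hm k).union hne
  refine ⟨fun x => Nat.find (hp x), measurable_find hp hm', ?_⟩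
  filter_upwards [hs] with x hx
  obtain ⟨π, hπ⟩ := hx
  rw [sortPerm_eq hπ]
  have hi : sortRank (v x) (π i) = i := hπ.sortRank_eq i
  rcases Nat.find_spec (hp x) with h | h
  · obtain ⟨m, hm⟩ := π.surjective (Nat.find (hp x))
    rw [← hm] at h ⊢
    rw [hπ.sortRank_eq m] at h
    exact congrArg π (Nat.cast_injective h).symm
  · exact (h _ hi).elim

end Sorting

end SpinGlass

namespace SpinGlass

/-! ### Statistics of weights that are expressed through replicas -/

section Statistics

open Filter Topology BoundedContinuousFunction

/-- The marks and overlaps of replicas. -/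
abbrev ReplData (ι : Type) : Type := (ι → ℝ) × (ι → ι → ℝ)

/-- Restriction to some of the replicas. -/
def ReplData.comp {ι κ : Type} (D : ReplData κ) (e : ι → κ) : ReplData ι :=
  (D.1 ∘ e, fun i j => D.2 (e i) (e j))

theorem ReplData.measurable_comp {ι κ : Type} (e : ι → κ) :
    Measurable fun D : ReplData κ => D.comp e := by
  unfold ReplData.comp
  fun_prop

/-- The marks and overlaps of the replicas `l`. -/
def replData {ι : Type} (d : ℕ → ℝ) (Q : ℕ → ℕ → ℝ) (l : ι → ℕ) : ReplData ι :=
  (fun i => d (l i), fun i j => Q (l i) (l j))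

variable {ι κ κ' : Type} [Fintype ι] [Fintype κ] [Fintype κ']

theorem hasSum_prod_weights {v : ℕ → ℝ} (h0 : ∀ l, 0 ≤ v l) (h1 : HasSum v 1) :
    HasSum (fun l : κ → ℕ => ∏ k, v (l k)) 1 := by
  have h := tsum_prod_comp (κ := κ) (tsum_ofReal_eq_one h0 h1)
    (e := (Empty.elim : Empty → κ)) (fun a => a.elim) fun _ => 1
  have hs : ∑' l : κ → ℕ, ∏ k, ENNReal.ofReal (v (l k)) = 1 := by simpa using h
  have h2 : Summable fun l : κ → ℕ => ∏ k, v (l k) := by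
    have := ENNReal.summable_toReal (hs.trans_ne ENNReal.one_ne_top)
    simpa only [toReal_prod_ofReal h0] using this
  have h3 : ∑' l : κ → ℕ, ∏ k, v (l k) = 1 := by
    have := ENNReal.tsum_toReal_eq (f := fun l : κ → ℕ => ∏ k, ENNReal.ofReal (v (l k)))
      fun l => prod_ofReal_ne_top v l
    simpa only [toReal_prod_ofReal h0, hs, ENNReal.toReal_one] using this.symm
  exact h3 ▸ h2.hasSum

theorem summable_weights_mul {v : ℕ → ℝ} (h0 : ∀ l, 0 ≤ v l) (h1 : HasSum v 1)
    {f : (κ → ℕ) → ℝ} {B : ℝ} (hf : ∀ l, |f l| ≤ B) :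
    Summable fun l : κ → ℕ => ‖(∏ k, v (l k)) * f l‖ := by
  refine Summable.of_nonneg_of_le (fun _ => norm_nonneg _) (fun l => ?_)
    ((hasSum_prod_weights (κ := κ) h0 h1).summable.mul_right B)
  rw [norm_mul, Real.norm_of_nonneg (Finset.prod_nonneg fun k _ => h0 _)]
  exact mul_le_mul_of_nonneg_left (hf l) (Finset.prod_nonneg fun k _ => h0 _)

/-- Disjoint batches of replicas are independent given the weights. This makes representable
functions closed under products, although each is only an average. -/
theorem tsum_weights_sum_mul {v : ℕ → ℝ} (h0 : ∀ l, 0 ≤ v l) (h1 : HasSum v 1)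
    {f : (κ → ℕ) → ℝ} {f' : (κ' → ℕ) → ℝ} {B B' : ℝ} (hf : ∀ l, |f l| ≤ B)
    (hf' : ∀ l, |f' l| ≤ B') :
    ∑' l : κ ⊕ κ' → ℕ, (∏ k, v (l k)) * (f (l ∘ Sum.inl) * f' (l ∘ Sum.inr)) =
      (∑' l : κ → ℕ, (∏ k, v (l k)) * f l) * ∑' l : κ' → ℕ, (∏ k, v (l k)) * f' l := by
  rw [tsum_mul_tsum_of_summable_norm (summable_weights_mul h0 h1 hf)
    (summable_weights_mul h0 h1 hf'), ← (Equiv.sumArrowEquivProdArrow κ κ' ℕ).tsum_eq]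
  refine tsum_congr fun l => ?_
  simp only [Fintype.prod_sum_type, Equiv.sumArrowEquivProdArrow, Equiv.coe_fn_mk,
    Function.comp_apply]
  exact mul_mul_mul_comm _ _ _ _

/-- The weights of the replicas `l`, followed by the power sums of the weights. -/
def weightStat (v : ℕ → ℝ) (l : ι → ℕ) : ι ⊕ ℕ → unitInterval :=
  Sum.elim (fun i => Set.projIcc 0 1 zero_le_one (v (l i)))
    fun k => Set.projIcc 0 1 zero_le_one (∑' j, v j ^ (k + 1))

/-- A function of the weight statistics that is the average over further replicas of a function of
the overlaps; equality of replicas is detected by the overlap being equal to `q`. -/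
def Representable (q : ℝ) (ι : Type) [Fintype ι] (ψ : (ι ⊕ ℕ → unitInterval) → ℝ) : Prop :=
  ∃ (κ : Type) (_ : Fintype κ) (φ : ReplData (ι ⊕ κ) → ℝ), Measurable φ ∧ (∃ B, ∀ D, |φ D| ≤ B) ∧
    ∀ (v d : ℕ → ℝ) (Q : ℕ → ℕ → ℝ), (∀ l, 0 ≤ v l) → HasSum v 1 →
      (∀ l l', Q l l' = q ↔ l = l') → ∀ l : ι → ℕ,
      ψ (weightStat v l) = ∑' l' : κ → ℕ, (∏ k, v (l' k)) * φ (replData d Q (Sum.elim l l'))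

variable {q : ℝ}

theorem Representable.const (c : ℝ) : Representable q ι fun _ => c := by
  refine ⟨Empty, inferInstance, fun _ => c, measurable_const, ⟨|c|, fun _ => le_rfl⟩,
    fun v d Q h0 h1 hQ l => ?_⟩
  rw [tsum_mul_right, (hasSum_prod_weights h0 h1).tsum_eq, one_mul]

theorem weight_le_one {v : ℕ → ℝ} (h0 : ∀ l, 0 ≤ v l) (h1 : HasSum v 1) (l : ℕ) : v l ≤ 1 :=
  le_hasSum h1 l fun j _ => h0 j

theorem pow_weight_le {v : ℕ → ℝ} (h0 : ∀ l, 0 ≤ v l) (h1 : HasSum v 1) (k l : ℕ) :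
    v l ^ (k + 1) ≤ v l :=
  pow_le_of_le_one (h0 l) (weight_le_one h0 h1 l) k.succ_ne_zero

theorem summable_pow_weight {v : ℕ → ℝ} (h0 : ∀ l, 0 ≤ v l) (h1 : HasSum v 1) (k : ℕ) :
    Summable fun j => v j ^ (k + 1) :=
  Summable.of_nonneg_of_le (fun j => pow_nonneg (h0 j) _) (pow_weight_le h0 h1 k) h1.summable

omit [Fintype ι] in
theorem weightStat_inl {v : ℕ → ℝ} (h0 : ∀ l, 0 ≤ v l) (h1 : HasSum v 1) (l : ι → ℕ) (i : ι) :
    (weightStat v l (Sum.inl i) : ℝ) = v (l i) := by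
  simp only [weightStat, Sum.elim_inl]
  rw [Set.projIcc_of_mem _ ⟨h0 _, weight_le_one h0 h1 _⟩]

omit [Fintype ι] in
theorem weightStat_inr {v : ℕ → ℝ} (h0 : ∀ l, 0 ≤ v l) (h1 : HasSum v 1) (l : ι → ℕ) (k : ℕ) :
    (weightStat v l (Sum.inr k) : ℝ) = ∑' j, v j ^ (k + 1) := by
  simp only [weightStat, Sum.elim_inr]
  rw [Set.projIcc_of_mem _ ⟨tsum_nonneg fun j => pow_nonneg (h0 j) _, ?_⟩]
  exact h1.tsum_eq ▸ (summable_pow_weight h0 h1 k).tsum_le_tsum (pow_weight_le h0 h1 k) h1.summable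

omit [Fintype κ] in
theorem measurableSet_overlap_eq (i j : κ) : MeasurableSet {D : ReplData κ | D.2 i j = q} :=
  measurableSet_eq_fun (by fun_prop) measurable_const

/-- The weight of a sampled atom is the conditional probability that one more replica falls on it.
-/
theorem Representable.weight (i : ι) : Representable q ι fun s => (s (Sum.inl i) : ℝ) := by
  classical
  refine ⟨Unit, inferInstance, fun D => if D.2 (Sum.inl i) (Sum.inr ()) = q then 1 else 0,
    Measurable.ite (measurableSet_overlap_eq _ _) measurable_const measurable_const,
    ⟨1, fun D => by dsimp only; split_ifs <;> simp⟩, fun v d Q h0 h1 hQ l => ?_⟩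
  beta_reduce
  rw [weightStat_inl h0 h1, ← (Equiv.funUnique Unit ℕ).symm.tsum_eq]
  simp [replData, hQ]

/-- The sum of the (k+1)-st powers is the conditional probability that k+1 further replicas all
coincide. -/
theorem Representable.powerSum (k : ℕ) :
    Representable q ι fun s => (s (Sum.inr k) : ℝ) := by
  classical
  refine ⟨Fin (k + 1), inferInstance,
    fun D => if ∀ a, D.2 (Sum.inr a) (Sum.inr 0) = q then 1 else 0, ?_,
    ⟨1, fun D => by dsimp only; split_ifs <;> simp⟩, fun v d Q h0 h1 hQ l => ?_⟩
  · refine Measurable.ite ?_ measurable_const measurable_const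
    simp only [Set.ofPred_forall]
    exact MeasurableSet.iInter fun a => measurableSet_overlap_eq _ _
  · beta_reduce
    rw [weightStat_inr h0 h1]
    have hinj : Function.Injective fun (j : ℕ) (_ : Fin (k + 1)) => j :=
      fun a b h => congrFun h 0
    -- Only constant tuples contribute to the sum.
    rw [← hinj.tsum_eq (f := fun l' : Fin (k + 1) → ℕ => (∏ a, v (l' a)) *
      if ∀ a, (replData d Q (Sum.elim l l')).2 (Sum.inr a) (Sum.inr 0) = q then 1 else 0)]
    · simp [replData, hQ]
    · intro l' hl'
      simp only [Function.mem_support, ne_eq, mul_eq_zero, not_or, ite_eq_right_iff, not_forall]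
        at hl'
      obtain ⟨_, h, _⟩ := hl'
      refine ⟨l' 0, funext fun a => ?_⟩
      have := h a
      simp only [replData, Sum.elim_inr, hQ] at this
      exact this.symm

omit [Fintype ι] [Fintype κ] [Fintype κ'] in
theorem replData_comp_left (d : ℕ → ℝ) (Q : ℕ → ℕ → ℝ) (l : ι → ℕ) (l' : κ ⊕ κ' → ℕ) :
    (replData d Q (Sum.elim l l')).comp (Sum.map id Sum.inl) =
      replData d Q (Sum.elim l (l' ∘ Sum.inl)) := by
  have : Sum.elim l l' ∘ Sum.map id Sum.inl = Sum.elim l (l' ∘ Sum.inl) := by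
    ext (i | k) <;> rfl
  rw [← this]
  rfl

omit [Fintype ι] [Fintype κ] [Fintype κ'] in
theorem replData_comp_right (d : ℕ → ℝ) (Q : ℕ → ℕ → ℝ) (l : ι → ℕ) (l' : κ ⊕ κ' → ℕ) :
    (replData d Q (Sum.elim l l')).comp (Sum.map id Sum.inr) =
      replData d Q (Sum.elim l (l' ∘ Sum.inr)) := by
  have : Sum.elim l l' ∘ Sum.map id Sum.inr = Sum.elim l (l' ∘ Sum.inr) := by
    ext (i | k) <;> rfl
  rw [← this]
  rfl

theorem Representable.mul {ψ ψ' : (ι ⊕ ℕ → unitInterval) → ℝ} (h : Representable q ι ψ)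
    (h' : Representable q ι ψ') : Representable q ι (ψ * ψ') := by
  obtain ⟨κ, _, φ, hφ, ⟨B, hB⟩, hr⟩ := h
  obtain ⟨κ', _, φ', hφ', ⟨B', hB'⟩, hr'⟩ := h'
  refine ⟨κ ⊕ κ', inferInstance,
    fun D => φ (D.comp (Sum.map id Sum.inl)) * φ' (D.comp (Sum.map id Sum.inr)),
    (hφ.comp (ReplData.measurable_comp _)).mul (hφ'.comp (ReplData.measurable_comp _)),
    ⟨B * B', fun D => ?_⟩, fun v d Q h0 h1 hQ l => ?_⟩
  · rw [abs_mul]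
    exact mul_le_mul (hB _) (hB' _) (abs_nonneg _) ((abs_nonneg _).trans
      (hB (D.comp (Sum.map id Sum.inl))))
  · simp only [Pi.mul_apply, hr v d Q h0 h1 hQ l, hr' v d Q h0 h1 hQ l, replData_comp_left,
      replData_comp_right]
    exact (tsum_weights_sum_mul h0 h1 (f := fun l' => φ (replData d Q (Sum.elim l l')))
      (f' := fun l' => φ' (replData d Q (Sum.elim l l'))) (fun _ => hB _) fun _ => hB' _).symm

theorem Representable.add {ψ ψ' : (ι ⊕ ℕ → unitInterval) → ℝ} (h : Representable q ι ψ)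
    (h' : Representable q ι ψ') : Representable q ι (ψ + ψ') := by
  obtain ⟨κ, _, φ, hφ, ⟨B, hB⟩, hr⟩ := h
  obtain ⟨κ', _, φ', hφ', ⟨B', hB'⟩, hr'⟩ := h'
  refine ⟨κ ⊕ κ', inferInstance,
    fun D => φ (D.comp (Sum.map id Sum.inl)) + φ' (D.comp (Sum.map id Sum.inr)),
    (hφ.comp (ReplData.measurable_comp _)).add (hφ'.comp (ReplData.measurable_comp _)),
    ⟨B + B', fun D => (abs_add_le _ _).trans (add_le_add (hB _) (hB' _))⟩,
    fun v d Q h0 h1 hQ l => ?_⟩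
  simp only [Pi.add_apply, hr v d Q h0 h1 hQ l, hr' v d Q h0 h1 hQ l, replData_comp_left,
      replData_comp_right, mul_add]
  have hone : ∀ {τ : Type} [Fintype τ] (l : τ → ℕ), |(fun _ : τ → ℕ => (1 : ℝ)) l| ≤ 1 := by simp
  have e1 := tsum_weights_sum_mul h0 h1 (f := fun l' => φ (replData d Q (Sum.elim l l')))
    (f' := fun _ : κ' → ℕ => 1) (fun _ => hB _) hone
  have e2 := tsum_weights_sum_mul h0 h1 (f := fun _ : κ → ℕ => 1)
    (f' := fun l' => φ' (replData d Q (Sum.elim l l'))) hone (fun _ => hB' _)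
  simp only [mul_one, one_mul, (hasSum_prod_weights h0 h1).tsum_eq] at e1 e2
  rw [← e1, ← e2, ← Summable.tsum_add]
  · exact (summable_weights_mul h0 h1 (f := fun l' : κ ⊕ κ' → ℕ =>
      φ (replData d Q (Sum.elim l (l' ∘ Sum.inl)))) fun _ => hB _).of_norm
  · exact (summable_weights_mul h0 h1 (f := fun l' : κ ⊕ κ' → ℕ =>
      φ' (replData d Q (Sum.elim l (l' ∘ Sum.inr)))) fun _ => hB' _).of_norm

/-- The algebra of polynomials in the weight statistics. -/
def statAlgebra (ι : Type) : StarSubalgebra ℝ ((ι ⊕ ℕ → unitInterval) →ᵇ ℝ) where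
  __ := Algebra.adjoin ℝ (Set.range fun a : ι ⊕ ℕ =>
    BoundedContinuousFunction.mkOfCompact
      (⟨fun s => (s a : ℝ), by fun_prop⟩ : C(ι ⊕ ℕ → unitInterval, ℝ)))
  star_mem' := fun {a} ha => by
    have : star a = a := by ext; simp
    rwa [this]

theorem Representable.of_mem {ψ : (ι ⊕ ℕ → unitInterval) →ᵇ ℝ} (h : ψ ∈ statAlgebra ι) :
    Representable q ι ψ := by
  replace h : ψ ∈ Algebra.adjoin ℝ (Set.range fun a : ι ⊕ ℕ =>
    BoundedContinuousFunction.mkOfCompact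
      (⟨fun s => (s a : ℝ), by fun_prop⟩ : C(ι ⊕ ℕ → unitInterval, ℝ))) := h
  induction h using Algebra.adjoin_induction with
  | mem ψ hψ =>
    obtain ⟨a, rfl⟩ := hψ
    rcases a with i | k
    · exact Representable.weight i
    · exact Representable.powerSum k
  | algebraMap c => exact Representable.const c
  | add ψ ψ' _ _ h h' => exact h.add h'
  | mul ψ ψ' _ _ h h' => exact h.mul h'

omit [Fintype ι] in
theorem statAlgebra_separatesPoints :
    ((statAlgebra ι).map (toContinuousMapStarₐ ℝ)).SeparatesPoints := by
  intro s s' hs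
  obtain ⟨a, ha⟩ := Function.ne_iff.1 hs
  refine ⟨fun s => (s a : ℝ), ⟨⟨fun s => (s a : ℝ), by fun_prop⟩, ⟨_,
    Algebra.subset_adjoin ⟨a, rfl⟩, rfl⟩, rfl⟩, fun h => ha (Subtype.ext h)⟩

end Statistics

end SpinGlass

namespace SpinGlass

/-! ### Recovering the sorted arrays from the replicas -/

section Recovery

open Filter Topology BoundedContinuousFunction

/-- Random weights together with random marks `d` and a random array `Q`. -/
structure MarkedWeights {X : Type*} [MeasurableSpace X] (μ : Measure X) (v d : ℕ → X → ℝ)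
    (Q : ℕ → ℕ → X → ℝ) : Prop extends IsWeights μ v where
  measurable_d : ∀ l, Measurable (d l)
  measurable_Q : ∀ l l', Measurable (Q l l')

/-- The law of the marks and overlaps of replicas. -/
def replLaw {X : Type*} [MeasurableSpace X] (μ : Measure X) (v d : ℕ → X → ℝ)
    (Q : ℕ → ℕ → X → ℝ) (ι : Type) [Fintype ι] : Measure (ReplData ι) :=
  (repl μ v ι).map fun z => replData (fun l => d l z.2) (fun l l' => Q l l' z.2) z.1

variable {X X' : Type*} [MeasurableSpace X] [MeasurableSpace X'] {μ : Measure X} {μ' : Measure X'}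
  {v d : ℕ → X → ℝ} {Q : ℕ → ℕ → X → ℝ} {v' d' : ℕ → X' → ℝ} {Q' : ℕ → ℕ → X' → ℝ}
  {ι κ : Type} [Fintype ι] [Fintype κ] {q : ℝ}

theorem MarkedWeights.measurable_replData (hS : MarkedWeights μ v d Q) :
    Measurable fun z : (ι → ℕ) × X =>
      replData (fun l => d l z.2) (fun l l' => Q l l' z.2) z.1 :=
  measurable_of_countable_fst fun l =>
    (measurable_pi_iff.2 fun i => hS.measurable_d (l i)).prodMk
      (measurable_pi_iff.2 fun i => measurable_pi_iff.2 fun j => hS.measurable_Q (l i) (l j))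

theorem IsWeights.measurable_weightStat (hv : IsWeights μ v) :
    Measurable fun z : (ι → ℕ) × X => weightStat (fun l => v l z.2) z.1 := by
  refine measurable_of_countable_fst fun l => measurable_pi_iff.2 fun a => ?_
  rcases a with i | k
  · exact (continuous_projIcc (h := zero_le_one)).measurable.comp (hv.measurable (l i))
  · exact (continuous_projIcc (h := zero_le_one)).measurable.comp
      (Measurable.tsum fun j => (hv.measurable j).pow_const (k + 1))

/-- The weights disappear: the right-hand side involves only the replica law of the larger family `ι
⊕ κ`. -/
theorem Representable.integral_eq [IsProbabilityMeasure μ] {ψ : (ι ⊕ ℕ → unitInterval) → ℝ}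
    {κ : Type} [Fintype κ] {φ : ReplData (ι ⊕ κ) → ℝ} (hφ : Measurable φ)
    {B : ℝ} (hB : ∀ D, |φ D| ≤ B)
    (hr : ∀ (v d : ℕ → ℝ) (Q : ℕ → ℕ → ℝ), (∀ l, 0 ≤ v l) → HasSum v 1 →
      (∀ l l', Q l l' = q ↔ l = l') → ∀ l : ι → ℕ,
      ψ (weightStat v l) = ∑' l' : κ → ℕ, (∏ k, v (l' k)) * φ (replData d Q (Sum.elim l l')))
    (hS : MarkedWeights μ v d Q) (hq : ∀ᵐ x ∂μ, ∀ l l', Q l l' x = q ↔ l = l')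
    {s : Set (ReplData ι)} (hs : MeasurableSet s) :
    ∫ z in (fun z : (ι → ℕ) × X => replData (fun l => d l z.2) (fun l l' => Q l l' z.2) z.1) ⁻¹' s,
        ψ (weightStat (fun l => v l z.2) z.1) ∂repl μ v ι =
      ∫ D in (fun D : ReplData (ι ⊕ κ) => D.comp Sum.inl) ⁻¹' s, φ D
        ∂replLaw μ v d Q (ι ⊕ κ) := by
  have := isProbabilityMeasure_repl (ι := ι ⊕ κ) hS.toIsWeights
  have hD : Measurable fun z : (ι ⊕ κ → ℕ) × X =>
      replData (fun l => d l z.2) (fun l l' => Q l l' z.2) z.1 := hS.measurable_replData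
  have hs' := (ReplData.measurable_comp (Sum.inl : ι → ι ⊕ κ)) hs
  rw [replLaw, setIntegral_map hs' hφ.aestronglyMeasurable hD.aemeasurable,
    ← integral_indicator (hD hs'), ← integral_indicator (hS.measurable_replData hs),
    integral_repl_sum hS.toIsWeights]
  · refine integral_congr_ae ?_
    filter_upwards [(measurePreserving_snd_repl hS.toIsWeights).quasiMeasurePreserving.ae
      (hS.hasSum.and hq)] with z hz
    by_cases h : replData (fun l => d l z.2) (fun l l' => Q l l' z.2) z.1 ∈ s
    · have hc : ∀ l' : κ → ℕ, ((fun z : (ι ⊕ κ → ℕ) × X =>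
          replData (fun l => d l z.2) (fun l l' => Q l l' z.2) z.1) ⁻¹'
          ((fun D : ReplData (ι ⊕ κ) => D.comp Sum.inl) ⁻¹' s)).indicator
          (fun z => φ (replData (fun l => d l z.2) (fun l l' => Q l l' z.2) z.1))
          (Sum.elim z.1 l', z.2) = φ (replData (fun l => d l z.2) (fun l l' => Q l l' z.2)
          (Sum.elim z.1 l')) := fun l' => Set.indicator_of_mem (by exact h) _
      rw [Set.indicator_of_mem (show z ∈ _ from h)]
      simp only [hc]
      exact hr _ _ _ (fun l => hS.nonneg l z.2) hz.1 hz.2 z.1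
    · have hc : ∀ l' : κ → ℕ, ((fun z : (ι ⊕ κ → ℕ) × X =>
          replData (fun l => d l z.2) (fun l l' => Q l l' z.2) z.1) ⁻¹'
          ((fun D : ReplData (ι ⊕ κ) => D.comp Sum.inl) ⁻¹' s)).indicator
          (fun z => φ (replData (fun l => d l z.2) (fun l l' => Q l l' z.2) z.1))
          (Sum.elim z.1 l', z.2) = 0 := fun l' => Set.indicator_of_notMem (by exact h) _
      rw [Set.indicator_of_notMem (show z ∉ _ from h)]
      simp only [hc, mul_zero, tsum_zero]
  · exact (Integrable.of_bound (hφ.comp hD).aestronglyMeasurable B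
      (ae_of_all _ fun z => hB _)).indicator (hD hs')

/-- For a fixed event in the replica data, the law of the weight statistics is a finite measure on a
compact cube. It is determined by the integrals of polynomials in the coordinates, and these are
known from the replica laws of larger families. -/
theorem map_weightStat_eq [IsProbabilityMeasure μ] [IsProbabilityMeasure μ']
    (hS : MarkedWeights μ v d Q) (hS' : MarkedWeights μ' v' d' Q')
    (hq : ∀ᵐ x ∂μ, ∀ l l', Q l l' x = q ↔ l = l') (hq' : ∀ᵐ x ∂μ', ∀ l l', Q' l l' x = q ↔ l = l')
    (h : ∀ (κ : Type) [Fintype κ], replLaw μ v d Q κ = replLaw μ' v' d' Q' κ) :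
    (repl μ v ι).map (fun z => (replData (fun l => d l z.2) (fun l l' => Q l l' z.2) z.1,
        weightStat (fun l => v l z.2) z.1)) =
      (repl μ' v' ι).map fun z => (replData (fun l => d' l z.2) (fun l l' => Q' l l' z.2) z.1,
        weightStat (fun l => v' l z.2) z.1) := by
  have := isProbabilityMeasure_repl (ι := ι) hS.toIsWeights
  have := isProbabilityMeasure_repl (ι := ι) hS'.toIsWeights
  have hD : Measurable fun z : (ι → ℕ) × X =>
      replData (fun l => d l z.2) (fun l l' => Q l l' z.2) z.1 := hS.measurable_replData
  have hD' : Measurable fun z : (ι → ℕ) × X' =>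
      replData (fun l => d' l z.2) (fun l l' => Q' l l' z.2) z.1 := hS'.measurable_replData
  have hW : Measurable fun z : (ι → ℕ) × X => weightStat (fun l => v l z.2) z.1 :=
    hS.toIsWeights.measurable_weightStat
  have hW' : Measurable fun z : (ι → ℕ) × X' => weightStat (fun l => v' l z.2) z.1 :=
    hS'.toIsWeights.measurable_weightStat
  refine Measure.ext_prod fun {s t} hs ht => ?_
  rw [Measure.map_apply (hD.prodMk hW) (hs.prod ht), Measure.map_apply (hD'.prodMk hW') (hs.prod ht)]
  have key : ((repl μ v ι).restrict ((fun z : (ι → ℕ) × X =>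
        replData (fun l => d l z.2) (fun l l' => Q l l' z.2) z.1) ⁻¹' s)).map
        (fun z => weightStat (fun l => v l z.2) z.1) =
      ((repl μ' v' ι).restrict ((fun z : (ι → ℕ) × X' =>
        replData (fun l => d' l z.2) (fun l l' => Q' l l' z.2) z.1) ⁻¹' s)).map
        (fun z => weightStat (fun l => v' l z.2) z.1) := by
    refine ext_of_forall_mem_subalgebra_integral_eq_of_polish (𝕜 := ℝ)
      (statAlgebra_separatesPoints (ι := ι)) fun ψ hψ => ?_
    obtain ⟨κ, _, φ, hφ, ⟨B, hB⟩, hr⟩ := Representable.of_mem (q := q) hψ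
    rw [integral_map hW.aemeasurable ψ.continuous.measurable.aestronglyMeasurable,
      integral_map hW'.aemeasurable ψ.continuous.measurable.aestronglyMeasurable,
      Representable.integral_eq hφ hB hr hS hq hs, Representable.integral_eq hφ hB hr hS' hq' hs, h]
  have := congrArg (fun m => m t) key
  simp only [Measure.map_apply hW ht, Measure.map_apply hW' ht,
    Measure.restrict_apply (hW ht), Measure.restrict_apply (hW' ht)] at this
  rw [Set.mk_preimage_prod, Set.mk_preimage_prod, Set.inter_comm, this, Set.inter_comm]

/-- The event that the replicas are the atoms with the largest weights, in their order. -/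
def leadingSet (n : ℕ) : Set (Fin n ⊕ ℕ → unitInterval) :=
  {s | (∀ i j : Fin n, i < j → (s (Sum.inl j) : ℝ) < s (Sum.inl i)) ∧
    ∀ i : Fin n, Tendsto (fun k : ℕ => ((s (Sum.inr k) : ℝ) -
      ∑ j ∈ Finset.univ.filter (fun j => j ≤ i), (s (Sum.inl j) : ℝ) ^ (k + 1)) /
        (s (Sum.inl i) : ℝ) ^ (k + 1)) atTop (𝓝 0)}

theorem measurableSet_leadingSet (n : ℕ) : MeasurableSet (leadingSet n) := by
  have hm : ∀ a, Measurable fun s : Fin n ⊕ ℕ → unitInterval => (s a : ℝ) := fun a =>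
    measurable_subtype_coe.comp (measurable_pi_apply a)
  have h1 : MeasurableSet {s : Fin n ⊕ ℕ → unitInterval |
      ∀ i j : Fin n, i < j → (s (Sum.inl j) : ℝ) < s (Sum.inl i)} := by
    simp only [Set.ofPred_forall]
    exact MeasurableSet.iInter fun i => MeasurableSet.iInter fun j => MeasurableSet.iInter fun _ =>
      measurableSet_lt (hm _) (hm _)
  have h2 : MeasurableSet {s : Fin n ⊕ ℕ → unitInterval |
      ∀ i : Fin n, Tendsto (fun k : ℕ => ((s (Sum.inr k) : ℝ) -
      ∑ j ∈ Finset.univ.filter (fun j => j ≤ i), (s (Sum.inl j) : ℝ) ^ (k + 1)) /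
        (s (Sum.inl i) : ℝ) ^ (k + 1)) atTop (𝓝 0)} := by
    simp only [Set.ofPred_forall]
    refine MeasurableSet.iInter fun i => measurableSet_tendsto _ fun k => ?_
    exact ((hm _).sub (Finset.measurable_fun_sum _ fun j _ => (hm _).pow_const _)).div
      ((hm _).pow_const _)
  exact h1.inter h2

/-- The tail is at most u_{i+1}^k since the weights sum to one, and strict decrease makes the ratio
u_{i+1}/u_i smaller than one. -/
theorem tendsto_tail_powers {u : ℕ → ℝ} (hpos : ∀ l, 0 < u l) (h1 : HasSum u 1)
    (hanti : StrictAnti u) (i : ℕ) :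
    Tendsto (fun k : ℕ => (∑' j, u j ^ (k + 1) - ∑ j ∈ Finset.range (i + 1), u j ^ (k + 1)) /
      u i ^ (k + 1)) atTop (𝓝 0) := by
  have h0 : ∀ l, 0 ≤ u l := fun l => (hpos l).le
  set ρ := u (i + 1) / u i with hρ
  have hρ0 : 0 ≤ ρ := div_nonneg (h0 _) (h0 _)
  have hρ1 : ρ < 1 := (div_lt_one (hpos _)).2 (hanti (Nat.lt_succ_self i))
  have hlim : Tendsto (fun k : ℕ => ρ ^ k * (1 / u i)) atTop (𝓝 0) := by
    simpa using (tendsto_pow_atTop_nhds_zero_of_lt_one hρ0 hρ1).mul_const (1 / u i)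
  have hs := fun k => summable_pow_weight h0 h1 k
  have htail : ∀ k, ∑' j, u j ^ (k + 1) - ∑ j ∈ Finset.range (i + 1), u j ^ (k + 1) =
      ∑' j, u (j + (i + 1)) ^ (k + 1) := fun k => by
    rw [← (hs k).sum_add_tsum_nat_add (i + 1)]
    ring
  refine squeeze_zero (fun k => ?_) (fun k => ?_) hlim
  · rw [htail]
    exact div_nonneg (tsum_nonneg fun j => pow_nonneg (h0 _) _) (pow_nonneg (h0 _) _)
  · rw [htail, div_le_iff₀ (pow_pos (hpos i) _)]
    have hb : ∀ j, u (j + (i + 1)) ^ (k + 1) ≤ u (i + 1) ^ k * u (j + (i + 1)) := fun j => by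
      rw [pow_succ]
      exact mul_le_mul_of_nonneg_right (pow_le_pow_left₀ (h0 _) (hanti.antitone (by omega)) _)
        (h0 _)
    have hsum1 : Summable fun j => u (j + (i + 1)) := (summable_nat_add_iff (i + 1)).2 h1.summable
    calc _ ≤ ∑' j, u (i + 1) ^ k * u (j + (i + 1)) :=
          ((summable_nat_add_iff (i + 1)).2 (hs k)).tsum_le_tsum hb (hsum1.mul_left _)
      _ = u (i + 1) ^ k * ∑' j, u (j + (i + 1)) := tsum_mul_left
      _ ≤ u (i + 1) ^ k * 1 := by
          refine mul_le_mul_of_nonneg_left ?_ (pow_nonneg (h0 _) _)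
          rw [← h1.tsum_eq, ← h1.summable.sum_add_tsum_nat_add (i + 1)]
          exact le_add_of_nonneg_left (Finset.sum_nonneg fun j _ => h0 j)
      _ = ρ ^ k * (1 / u i) * u i ^ (k + 1) := by
          rw [hρ, div_pow, pow_succ]
          have := (hpos i).ne'
          field_simp

/-- An index a ≤ m i missed by the replicas j ≤ i would leave a term u_a^{k+1} ≥ u_{m i}^{k+1} in
the difference of power sums, so the quotient could not tend to zero. Hence the replicas j ≤ i fill
the initial segment up to `m i`, and counting gives m i = i. -/
theorem weightStat_mem_leadingSet_iff {u : ℕ → ℝ} (hpos : ∀ l, 0 < u l) (h1 : HasSum u 1)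
    (hanti : StrictAnti u) {n : ℕ} (m : Fin n → ℕ) :
    weightStat u m ∈ leadingSet n ↔ ∀ i, m i = i := by
  have h0 : ∀ l, 0 ≤ u l := fun l => (hpos l).le
  simp only [leadingSet, Set.mem_ofPred_eq, weightStat_inl h0 h1, weightStat_inr h0 h1]
  constructor
  · rintro ⟨hlt, htend⟩ i
    have hmono : ∀ i j : Fin n, i < j → m i < m j := fun i j hij => hanti.lt_iff_gt.1 (hlt i j hij)
    have hinj : Function.Injective m := StrictMono.injective fun i j h => hmono i j h
    have himg : (Finset.univ.filter fun j => j ≤ i).image m = Finset.range (m i + 1) := by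
      ext a
      simp only [Finset.mem_image, Finset.mem_filter, Finset.mem_univ, true_and, Finset.mem_range]
      constructor
      · rintro ⟨j, hj, rfl⟩
        rcases hj.lt_or_eq with h | rfl
        · have := hmono j i h
          omega
        · omega
      · intro ha
        by_contra hcon
        refine absurd (htend i) fun ht => ?_
        have hge : ∀ k : ℕ, (1 : ℝ) ≤ (∑' j, u j ^ (k + 1) -
            ∑ j ∈ Finset.univ.filter (fun j => j ≤ i), u (m j) ^ (k + 1)) / u (m i) ^ (k + 1) := by
          intro k
          rw [le_div_iff₀ (pow_pos (hpos _) _), one_mul, le_sub_iff_add_le,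
            ← Finset.sum_image (f := fun a => u a ^ (k + 1)) (fun a _ b _ h => hinj h)]
          have hnot : a ∉ (Finset.univ.filter fun j => j ≤ i).image m := by
            simp only [Finset.mem_image, Finset.mem_filter, Finset.mem_univ, true_and]
            exact hcon
          refine le_trans ?_ ((summable_pow_weight h0 h1 k).sum_le_tsum
            (insert a ((Finset.univ.filter fun j => j ≤ i).image m)) fun j _ => pow_nonneg (h0 j) _)
          rw [Finset.sum_insert hnot]
          exact add_le_add (pow_le_pow_left₀ (h0 _) (hanti.antitone (by omega)) _) le_rfl
        exact absurd (ge_of_tendsto' ht hge) (by norm_num)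
    have hcard := congrArg Finset.card himg
    rw [Finset.card_image_of_injective _ hinj, Finset.card_range] at hcard
    have : (Finset.univ.filter fun j => j ≤ i).card = (i : ℕ) + 1 := by
      have h := Fin.card_Iic i
      rwa [show Finset.Iic i = Finset.univ.filter fun j => j ≤ i by ext; simp] at h
    omega
  · intro hm
    simp only [hm]
    refine ⟨fun i j hij => hanti hij, fun i => ?_⟩
    have := tendsto_tail_powers hpos h1 hanti i
    refine this.congr fun k => ?_
    have himg : ∑ j ∈ Finset.univ.filter (fun j : Fin n => j ≤ i), u j ^ (k + 1) =
        ∑ j ∈ Finset.range (i + 1), u j ^ (k + 1) := by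
      refine Finset.sum_bij (fun j _ => (j : ℕ)) ?_ ?_ ?_ ?_
      · intro j hj
        have : j ≤ i := by simpa using hj
        simp only [Finset.mem_range]
        omega
      · exact fun a _ b _ h => Fin.ext h
      · intro b hb
        have hb' : b < i + 1 := Finset.mem_range.1 hb
        exact ⟨⟨b, by omega⟩, Finset.mem_filter.2 ⟨Finset.mem_univ _,
          Fin.le_def.2 (Nat.lt_succ_iff.1 hb')⟩, rfl⟩
      · exact fun _ _ => rfl
    rw [himg]

theorem weightStat_comp_perm {ι : Type} (v : ℕ → ℝ) (π : Equiv.Perm ℕ) (l : ι → ℕ) :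
    weightStat (v ∘ π) (π.symm ∘ l) = weightStat v l := by
  ext a
  rcases a with i | k
  · simp [weightStat]
  · simp only [weightStat, Sum.elim_inr, Function.comp_apply]
    rw [π.tsum_eq fun j => v j ^ (k + 1)]

theorem weightStat_mem_leadingSet_iff_perm {v : ℕ → ℝ} (hpos : ∀ l, 0 < v l) (h1 : HasSum v 1)
    {π : Equiv.Perm ℕ} (hanti : StrictAnti (v ∘ π)) {n : ℕ} (l : Fin n → ℕ) :
    weightStat v l ∈ leadingSet n ↔ l = fun i : Fin n => π i := by
  rw [← weightStat_comp_perm v π, weightStat_mem_leadingSet_iff (u := v ∘ π) (fun l => hpos _)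
    (π.hasSum_iff.2 h1) hanti]
  constructor
  · intro h
    funext i
    rw [← h i]
    simp
  · rintro rfl i
    simp

/-- For almost every `x` exactly one tuple of atoms lies in the leading set, the sorted one. Its
conditional probability is the product of its weights, which the inverse product cancels. -/
theorem lintegral_leading_eq [IsProbabilityMeasure μ] (hS : MarkedWeights μ v d Q)
    (hpos : ∀ᵐ x ∂μ, ∀ l, 0 < v l x) {π : X → Equiv.Perm ℕ}
    (hπ : ∀ᵐ x ∂μ, StrictAnti fun i => v (π x i) x) {n : ℕ}
    {F : (Fin n → ℝ) × (Fin n → ℝ) × (Fin n → Fin n → ℝ) → ℝ≥0∞} (hF : Measurable F) :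
    ∫⁻ x, F (fun i => v (π x i) x, fun i => d (π x i) x, fun i j => Q (π x i) (π x j) x) ∂μ =
      ∫⁻ y : ReplData (Fin n) × (Fin n ⊕ ℕ → unitInterval),
        (leadingSet n).indicator (fun s => (∏ i, ENNReal.ofReal (s (Sum.inl i)))⁻¹ *
          F (fun i => (s (Sum.inl i) : ℝ), y.1.1, y.1.2)) y.2
      ∂(repl μ v (Fin n)).map fun z =>
        (replData (fun l => d l z.2) (fun l l' => Q l l' z.2) z.1,
          weightStat (fun l => v l z.2) z.1) := by
  have hm : ∀ a, Measurable fun s : Fin n ⊕ ℕ → unitInterval => (s a : ℝ) := fun a =>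
    measurable_subtype_coe.comp (measurable_pi_apply a)
  have hmeas : Measurable fun y : ReplData (Fin n) × (Fin n ⊕ ℕ → unitInterval) =>
      (leadingSet n).indicator (fun s => (∏ i, ENNReal.ofReal (s (Sum.inl i)))⁻¹ *
          F (fun i => (s (Sum.inl i) : ℝ), y.1.1, y.1.2)) y.2 := by
    have h1 : Measurable fun y : ReplData (Fin n) × (Fin n ⊕ ℕ → unitInterval) =>
        (∏ i, ENNReal.ofReal (y.2 (Sum.inl i)))⁻¹ *
          F (fun i => (y.2 (Sum.inl i) : ℝ), y.1.1, y.1.2) := by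
      refine Measurable.mul (Finset.measurable_fun_prod _ fun i _ =>
        ((hm _).comp measurable_snd).ennreal_ofReal).inv (hF.comp ?_)
      exact (measurable_pi_iff.2 fun i => (hm _).comp measurable_snd).prodMk
        (measurable_fst.fst.prodMk measurable_fst.snd)
    exact h1.indicator (measurable_snd (measurableSet_leadingSet n))
  have hDW : Measurable fun z : (Fin n → ℕ) × X =>
      (replData (fun l => d l z.2) (fun l l' => Q l l' z.2) z.1,
          weightStat (fun l => v l z.2) z.1) :=
    hS.measurable_replData.prodMk hS.toIsWeights.measurable_weightStat
  rw [lintegral_map hmeas hDW]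
  refine Eq.trans ?_ (lintegral_repl' hS.measurable (hmeas.comp hDW)).symm
  refine lintegral_congr_ae ?_
  filter_upwards [hS.hasSum, hpos, hπ] with x h1 hx hanti
  have h0 : ∀ l, 0 ≤ v l x := fun l => hS.nonneg l x
  have hiff := fun l : Fin n → ℕ => weightStat_mem_leadingSet_iff_perm hx h1
    (π := π x) hanti l
  rw [tsum_eq_single (fun i : Fin n => π x i)]
  · have hmem := (hiff fun i : Fin n => π x i).2 rfl
    simp only [Function.comp_apply, Set.indicator_of_mem hmem, weightStat_inl h0 h1]
    rw [← mul_assoc, ENNReal.mul_inv_cancel, one_mul]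
    · rfl
    · exact Finset.prod_ne_zero_iff.2 fun i _ => (ENNReal.ofReal_pos.2 (hx _)).ne'
    · exact prod_ofReal_ne_top (fun l => v l x) fun i : Fin n => π x i
  · intro l hl
    simp only [Function.comp_apply, Set.indicator_of_notMem fun h => hl ((hiff l).1 h), mul_zero]

end Recovery

end SpinGlass

/-! ### Replicas of the tilted random measure and their integrability -/

namespace SpinGlass

section Sorted

variable {X X' : Type*} [MeasurableSpace X] [MeasurableSpace X'] {μ : Measure X} {μ' : Measure X'}
  {v d : ℕ → X → ℝ} {Q : ℕ → ℕ → X → ℝ} {v' d' : ℕ → X' → ℝ} {Q' : ℕ → ℕ → X' → ℝ}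
  {ι : Type} [Fintype ι]

/-- The replicas do not depend on the order of the atoms. -/
theorem replLaw_eq_of_identDistrib [IsProbabilityMeasure μ] [IsProbabilityMeasure μ']
    (hS : MarkedWeights μ v d Q) (hS' : MarkedWeights μ' v' d' Q') (π : X → Equiv.Perm ℕ)
    (h : ∀ n : ℕ, IdentDistrib
      (fun x => ((fun l : Fin n => v (π x l) x), (fun l : Fin n => d (π x l) x),
        (fun l l' : Fin n => Q (π x l) (π x l') x)))
      (fun x => ((fun l : Fin n => v' l x), (fun l : Fin n => d' l x),
        (fun l l' : Fin n => Q' l l' x))) μ μ') (ι : Type) [Fintype ι] :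
    replLaw μ v d Q ι = replLaw μ' v' d' Q' ι := by
  refine Measure.ext_of_lintegral _ fun F hF => ?_
  have hterm : ∀ l : ι → ℕ, IdentDistrib
      (fun x => (∏ i, ENNReal.ofReal (v (π x (l i)) x)) *
        F (replData (fun l => d l x) (fun l l' => Q l l' x) fun i => π x (l i)))
      (fun x => (∏ i, ENNReal.ofReal (v' (l i) x)) *
        F (replData (fun l => d' l x) (fun l l' => Q' l l' x) l)) μ μ' := by
    intro l
    -- The first `n` entries of the arrays contain everything that the tuple `l` sees.
    set n := Finset.univ.sup l + 1 with hn
    have hl : ∀ i, l i < n := fun i => Nat.lt_succ_of_le (Finset.le_sup (Finset.mem_univ i))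
    have hH : Measurable fun y : (Fin n → ℝ) × (Fin n → ℝ) × (Fin n → Fin n → ℝ) =>
        (∏ i, ENNReal.ofReal (y.1 ⟨l i, hl i⟩)) *
          F (fun i => y.2.1 ⟨l i, hl i⟩, fun i j => y.2.2 ⟨l i, hl i⟩ ⟨l j, hl j⟩) := by
      refine Measurable.mul (Finset.measurable_fun_prod _ fun i _ => ?_) (hF.comp ?_) <;> fun_prop
    exact (h n).comp hH
  rw [replLaw, replLaw, lintegral_map hF hS.measurable_replData,
    lintegral_map hF hS'.measurable_replData]
  refine (lintegral_repl' hS.measurable (hF.comp hS.measurable_replData)).trans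
    (Eq.trans ?_ (lintegral_repl hS'.measurable (hF.comp hS'.measurable_replData)).symm)
  calc _ = ∫⁻ x, ∑' l : ι → ℕ, (∏ i, ENNReal.ofReal (v (π x (l i)) x)) *
        F (replData (fun l => d l x) (fun l l' => Q l l' x) fun i => π x (l i)) ∂μ := by
        refine lintegral_congr fun x => ?_
        -- Renaming the atoms by `π x` permutes the tuples over which the sum is taken.
        rw [← (Equiv.arrowCongr (Equiv.refl ι) (π x)).tsum_eq]
        rfl
    _ = ∑' l : ι → ℕ, ∫⁻ x, (∏ i, ENNReal.ofReal (v (π x (l i)) x)) *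
        F (replData (fun l => d l x) (fun l l' => Q l l' x) fun i => π x (l i)) ∂μ :=
        lintegral_tsum fun l => (hterm l).aemeasurable_fst
    _ = _ := tsum_congr fun l => (hterm l).lintegral_eq

end Sorted

theorem measurable_residual {X : Type*} [MeasurableSpace X] {C : X → Matrix ℕ ℕ ℝ}
    (hC : ∀ i j, Measurable fun x => C x i j) (m i j : ℕ) :
    Measurable fun x => residual (C x) m i j := by
  induction m generalizing i j with
  | zero => exact hC i j
  | succ m ih =>
    simp only [residual_succ_apply]
    exact (ih i j).sub (((ih i m).mul (ih m j)).div (ih m m))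

namespace RandomAtomicMeasure

variable {Ω : Type*} [MeasurableSpace Ω] (G : RandomAtomicMeasure Ω) (P : Measure Ω)
  [IsProbabilityMeasure P]

theorem measurable_Q (l l' : ℕ) : Measurable fun ω => G.Q ω l l' := by
  have hc : ∀ l i, Measurable fun ω => (G.ξ l ω : ℕ → ℝ) i := fun l i => by
    have : Continuous fun x : ℓ²(ℕ, ℝ) => (x : ℕ → ℝ) i := (lp.evalCLM ℝ (fun _ : ℕ => ℝ) 2 i).continuous
    exact this.measurable.comp (G.measurable_ξ l)
  simp only [Q, Matrix.of_apply, lp.inner_eq_tsum]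
  exact Measurable.tsum fun i => (hc l i).inner (hc l' i)

theorem abs_Q_le (ω : Ω) (l l' : ℕ) : |G.Q ω l l'| ≤ 1 :=
  (abs_real_inner_le_norm _ _).trans
    (mul_le_one₀ (G.norm_ξ_le l ω) (norm_nonneg _) (G.norm_ξ_le l' ω))

/-- The covariance matrix of the field `g_p`. -/
def cov (p : ℕ) (ω : Ω) : Matrix ℕ ℕ ℝ := Matrix.of fun i j => G.Q ω i j ^ p

theorem cov_posSemidef (p : ℕ) (ω : Ω) : (G.cov p ω).PosSemidef :=
  posSemidef_gram_pow (fun l => G.ξ l ω) p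

theorem abs_cov_le (p : ℕ) (ω : Ω) (l l' : ℕ) : |G.cov p ω l l'| ≤ 1 := by
  rw [cov, Matrix.of_apply, abs_pow]
  exact pow_le_one₀ (abs_nonneg _) (G.abs_Q_le ω l l')

theorem field_eq (p : ℕ) (x : Ω × (ℕ → ℝ)) : G.field p x = gaussianSeq (G.cov p x.1) x.2 := rfl

theorem measurable_field (p l : ℕ) : Measurable fun x : Ω × (ℕ → ℝ) => G.field p x l := by
  have hr : ∀ m i j, Measurable fun x : Ω × (ℕ → ℝ) => residual (G.cov p x.1) m i j :=
    measurable_residual fun i j => ((G.measurable_Q i j).pow_const p).comp measurable_fst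
  show Measurable fun x : Ω × (ℕ → ℝ) => ∑ m ∈ Finset.range (l + 1),
    residual (G.cov p x.1) m l m / √(residual (G.cov p x.1) m m m) * x.2 m
  refine Finset.measurable_fun_sum _ fun m _ => ((hr m l m).div (hr m m m).sqrt).mul ?_
  exact (measurable_pi_apply m).comp measurable_snd

theorem w_zero_pos (ω : Ω) : 0 < G.w 0 ω := by
  refine (G.w_nonneg 0 ω).lt_of_ne fun h => ?_
  have h0 : ∀ l, G.w l ω = 0 := fun l =>
    le_antisymm ((G.w_antitone ω (Nat.zero_le l)).trans h.symm.le) (G.w_nonneg l ω)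
  have := G.hasSum_w ω
  simp only [h0] at this
  exact zero_ne_one (hasSum_zero.unique this)

theorem tiltedWeight_eq (p : ℕ) (t : ℝ) (x : Ω × (ℕ → ℝ)) :
    G.tiltedWeight p t x = gibbsWeight (fun l => G.w l x.1) t (G.field p x) := rfl

theorem tiltedWeight_zero (p : ℕ) (x : Ω × (ℕ → ℝ)) (l : ℕ) :
    G.tiltedWeight p 0 x l = G.w l x.1 := by
  simp [tiltedWeight, (G.hasSum_w x.1).tsum_eq]

theorem measurable_tiltedWeight (p : ℕ) (t : ℝ) (l : ℕ) :
    Measurable fun x => G.tiltedWeight p t x l := by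
  have h : ∀ j, Measurable fun x : Ω × (ℕ → ℝ) => G.w j x.1 * Real.exp (t * G.field p x j) :=
    fun j => ((G.measurable_w j).comp measurable_fst).mul
      ((G.measurable_field p j).const_mul t).exp
  exact (h l).div (Measurable.tsum h)

omit [IsProbabilityMeasure P] in
theorem isWeights_tiltedWeight (p : ℕ) (t : ℝ) :
    IsWeights (P.prod stdGaussianSeq) fun l x => G.tiltedWeight p t x l where
  measurable l := G.measurable_tiltedWeight p t l
  nonneg l x := gibbsWeight_nonneg (fun l => G.w_nonneg l x.1) l
  hasSum := by
    have hm : MeasurableSet {x | ∑' l, ENNReal.ofReal (G.tiltedWeight p t x l) = 1} :=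
      measurableSet_eq_fun (Measurable.tsum fun l => (G.measurable_tiltedWeight p t l).ennreal_ofReal)
        measurable_const
    have h0 : ∀ x l, 0 ≤ G.tiltedWeight p t x l := fun x l =>
      gibbsWeight_nonneg (fun l => G.w_nonneg l x.1) l
    have : ∀ᵐ x ∂P.prod stdGaussianSeq, ∑' l, ENNReal.ofReal (G.tiltedWeight p t x l) = 1 := by
      rw [Measure.ae_prod_iff_ae_ae hm]
      refine ae_of_all _ fun ω => ?_
      filter_upwards [ae_summable_gibbs (G.cov_posSemidef p ω) (G.abs_cov_le p ω)
        (fun l => G.w_nonneg l ω) (G.hasSum_w ω).summable t] with γ hγ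
      exact tsum_ofReal_eq_one (h0 _)
        (hasSum_gibbsWeight (fun l => G.w_nonneg l ω) (G.w_zero_pos ω) hγ)
    filter_upwards [this] with x hx
    have h1 := ENNReal.summable_toReal (hx.trans_ne ENNReal.one_ne_top)
    have h2 := ENNReal.tsum_toReal_eq (f := fun l => ENNReal.ofReal (G.tiltedWeight p t x l))
      fun l => ENNReal.ofReal_ne_top
    simp only [hx, ENNReal.toReal_one, ENNReal.toReal_ofReal (h0 x _)] at h1 h2
    exact h2 ▸ h1.hasSum

omit [IsProbabilityMeasure P] in
theorem markedWeights_tilted (p : ℕ) (t c : ℝ) :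
    MarkedWeights (P.prod stdGaussianSeq) (fun l x => G.tiltedWeight p t x l)
      (fun l x => G.field p x l - c) fun l l' x => G.Q x.1 l l' where
  toIsWeights := G.isWeights_tiltedWeight P p t
  measurable_d l := (G.measurable_field p l).sub_const c
  measurable_Q l l' := (G.measurable_Q l l').comp measurable_fst

omit [IsProbabilityMeasure P] in
theorem markedWeights_zero (p : ℕ) (t : ℝ) :
    MarkedWeights (P.prod stdGaussianSeq) (fun l x => G.tiltedWeight p t x l)
      (fun _ _ => 0) fun l l' x => G.Q x.1 l l' where
  toIsWeights := G.isWeights_tiltedWeight P p t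
  measurable_d _ := measurable_const
  measurable_Q l l' := (G.measurable_Q l l').comp measurable_fst

/-- The replicas of the tilted measure. -/
def tiltedRepl (p : ℕ) (t : ℝ) (ι : Type) [Fintype ι] : Measure ((ι → ℕ) × (Ω × (ℕ → ℝ))) :=
  repl (P.prod stdGaussianSeq) (fun l x => G.tiltedWeight p t x l) ι

instance (p : ℕ) (t : ℝ) (ι : Type) [Fintype ι] : IsProbabilityMeasure (G.tiltedRepl P p t ι) :=
  isProbabilityMeasure_repl (G.isWeights_tiltedWeight P p t)

/-- The overlaps of the replicas. -/
def overlaps {ι : Type} (z : (ι → ℕ) × (Ω × (ℕ → ℝ))) (i j : ι) : ℝ := G.Q z.2.1 (z.1 i) (z.1 j)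

theorem measurable_overlaps {ι : Type} [Finite ι] :
    Measurable fun z : (ι → ℕ) × (Ω × (ℕ → ℝ)) => G.overlaps z :=
  measurable_of_countable_fst fun l => measurable_pi_iff.2 fun i => measurable_pi_iff.2 fun j =>
    (G.measurable_Q (l i) (l j)).comp measurable_fst

/-- Linear combinations of the shifted field at the replicas. -/
def comb {ι : Type} [Fintype ι] (p : ℕ) (lam : ι → ℝ) (c : ℝ) (z : (ι → ℕ) × (Ω × (ℕ → ℝ))) : ℝ :=
  ∑ i, lam i * (G.field p z.2 (z.1 i) - c)

variable {ι : Type} [Fintype ι]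

theorem measurable_comb (p : ℕ) (lam : ι → ℝ) (c : ℝ) : Measurable (G.comb p lam c) :=
  measurable_of_countable_fst fun l => Finset.measurable_fun_sum _ fun i _ =>
    ((G.measurable_field p (l i)).sub_const c).const_mul _

/-- Only replica `i` matters, so the claim reduces to a single replica, for which
`lintegral_gibbs_exp_le` is uniform in the disorder. -/
theorem lintegral_exp_field_ne_top (p : ℕ) (t a : ℝ) (i : ι) :
    ∫⁻ z, ENNReal.ofReal (Real.exp (a * G.field p z.2 (z.1 i))) ∂G.tiltedRepl P p t ι ≠ ∞ := by
  have hv := G.isWeights_tiltedWeight P p t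
  have hm : Measurable fun z : (Unit → ℕ) × (Ω × (ℕ → ℝ)) =>
      ENNReal.ofReal (Real.exp (a * G.field p z.2 (z.1 ()))) :=
    measurable_of_countable_fst fun l => ((G.measurable_field p (l ())).const_mul a).exp.ennreal_ofReal
  have he : Function.Injective fun _ : Unit => i := fun _ _ _ => rfl
  have h1 := lintegral_map (μ := G.tiltedRepl P p t ι) hm
    (measurable_comp_fst (X := Ω × (ℕ → ℝ)) measurable_id fun _ : Unit => i)
  have h2 : (G.tiltedRepl P p t ι).map (fun z => id (z.1 ∘ fun _ : Unit => i, z.2)) =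
    G.tiltedRepl P p t Unit := repl_map_comp hv he
  rw [h2] at h1
  refine ne_of_eq_of_ne h1.symm ?_
  rw [tiltedRepl, lintegral_repl' hv.measurable hm]
  have hle : ∫⁻ x, ∑' l : Unit → ℕ, (∏ i, ENNReal.ofReal (G.tiltedWeight p t x (l i))) *
      ENNReal.ofReal (Real.exp (a * G.field p x (l ()))) ∂P.prod stdGaussianSeq ≤
      ENNReal.ofReal (Real.exp ((2 * (t + a)) ^ 2 / 2)) +
        ENNReal.ofReal (Real.exp ((2 * (-t)) ^ 2 / 2)) := by
    have hm2 : Measurable fun x => ∑' l : Unit → ℕ,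
        (∏ i, ENNReal.ofReal (G.tiltedWeight p t x (l i))) *
        ENNReal.ofReal (Real.exp (a * G.field p x (l ()))) :=
      Measurable.tsum fun l => (Finset.measurable_fun_prod _ fun i _ =>
        (hv.measurable (l i)).ennreal_ofReal).mul
        ((G.measurable_field p (l ())).const_mul a).exp.ennreal_ofReal
    rw [lintegral_prod _ hm2.aemeasurable]
    calc _ ≤ ∫⁻ _, (ENNReal.ofReal (Real.exp ((2 * (t + a)) ^ 2 / 2)) +
        ENNReal.ofReal (Real.exp ((2 * (-t)) ^ 2 / 2))) ∂P := by
          refine lintegral_mono fun ω => ?_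
          refine le_trans (le_of_eq ?_) (lintegral_gibbs_exp_le (G.cov_posSemidef p ω)
            (G.abs_cov_le p ω) (fun l => G.w_nonneg l ω) (G.w_zero_pos ω) (G.hasSum_w ω) t a)
          refine lintegral_congr fun γ => ?_
          rw [← (Equiv.funUnique Unit ℕ).symm.tsum_eq]
          simp [tiltedWeight_eq, field_eq]
      _ = _ := by simp
  exact ne_top_of_le_ne_top (by simp) hle

theorem integrable_exp_comb (p : ℕ) (t u : ℝ) (lam : ι → ℝ) (c : ℝ) :
    Integrable (fun z => Real.exp (u * G.comb p lam c z)) (G.tiltedRepl P p t ι) := by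
  have hm := ((G.measurable_comb p lam c).const_mul u).exp
  have hE : ∀ (i : ι) (a : ℝ), Integrable (fun z : (ι → ℕ) × (Ω × (ℕ → ℝ)) =>
      Real.exp (a * G.field p z.2 (z.1 i))) (G.tiltedRepl P p t ι) := by
    intro i a
    have hm : Measurable fun z : (ι → ℕ) × (Ω × (ℕ → ℝ)) =>
        Real.exp (a * G.field p z.2 (z.1 i)) :=
      measurable_of_countable_fst fun l => ((G.measurable_field p (l i)).const_mul a).exp
    refine ⟨hm.aestronglyMeasurable, ?_⟩
    rw [hasFiniteIntegral_iff_ofReal (ae_of_all _ fun z => Real.exp_nonneg _)]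
    exact (G.lintegral_exp_field_ne_top P p t a i).lt_top
  set n : ℝ := ((Fintype.card ι : ℕ) : ℝ)
  -- One of the `n` terms of the combination is at least its average, so the exponential of the sum
  -- is at most the sum of the exponentials of `n` times each term. The summand 1 covers the empty
  -- family.
  have hint : Integrable (fun z => 1 + ∑ i, Real.exp (-(n * (u * lam i)) * c) *
      Real.exp (n * (u * lam i) * G.field p z.2 (z.1 i))) (G.tiltedRepl P p t ι) :=
    (integrable_const _).add (integrable_finsetSum _ fun i _ => (hE i _).const_mul _)
  refine hint.mono' hm.aestronglyMeasurable (ae_of_all _ fun z => ?_)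
  rw [Real.norm_of_nonneg (Real.exp_nonneg _)]
  rcases isEmpty_or_nonempty ι with hι | hι
  · simp [comb]
  · have hsum : ∀ i, Real.exp (-(n * (u * lam i)) * c) *
        Real.exp (n * (u * lam i) * G.field p z.2 (z.1 i)) =
        Real.exp (n * (u * (lam i * (G.field p z.2 (z.1 i) - c)))) := fun i => by
      rw [← Real.exp_add]
      congr 1
      ring
    simp only [hsum]
    have hn : 0 < n := by simpa [n] using Fintype.card_pos
    obtain ⟨i, -, hi⟩ := Finset.exists_le_of_sum_le (s := Finset.univ)
      (f := fun _ : ι => u * G.comb p lam c z)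
      (g := fun i => n * (u * (lam i * (G.field p z.2 (z.1 i) - c)))) Finset.univ_nonempty (by
        rw [Finset.sum_const, nsmul_eq_mul, comb, ← Finset.mul_sum, ← Finset.mul_sum,
          Finset.card_univ])
    have h1 := Real.exp_le_exp.2 hi
    have h2 := Finset.single_le_sum (s := Finset.univ)
      (f := fun i => Real.exp (n * (u * (lam i * (G.field p z.2 (z.1 i) - c)))))
      (fun i _ => Real.exp_nonneg _) (Finset.mem_univ i)
    linarith

theorem integrable_comb_pow (p : ℕ) (t : ℝ) (lam : ι → ℝ) (c : ℝ) (r : ℕ) :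
    Integrable (fun z => G.comb p lam c z ^ r) (G.tiltedRepl P p t ι) :=
  integrable_pow_of_integrable_exp_mul one_ne_zero (G.integrable_exp_comb P p t 1 lam c)
    (G.integrable_exp_comb P p t (-1) lam c) r

theorem integrable_comb_pow_mul_field (p : ℕ) (t : ℝ) (lam : ι → ℝ) (c : ℝ) (r : ℕ) (k : ι) :
    Integrable (fun z => G.comb p lam c z ^ r * G.field p z.2 (z.1 k)) (G.tiltedRepl P p t ι) := by
  classical
  have hc : ∀ z, G.comb p (Pi.single k 1) 0 z = G.field p z.2 (z.1 k) := fun z => by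
    simp [comb, Pi.single_apply]
  simp only [← hc]
  refine MemLp.integrable_mul (p := 2) (q := 2) ?_ ?_
  · rw [memLp_two_iff_integrable_sq ((G.measurable_comb p lam c).pow_const r).aestronglyMeasurable]
    simp only [← pow_mul]
    exact G.integrable_comb_pow P p t lam c (r * 2)
  · rw [memLp_two_iff_integrable_sq (G.measurable_comb p _ 0).aestronglyMeasurable]
    exact G.integrable_comb_pow P p t _ 0 2

end RandomAtomicMeasure

end SpinGlass

/-! ### Gaussian integration by parts for averages over replicas -/

namespace SpinGlass

namespace RandomAtomicMeasure

variable {Ω : Type*} [MeasurableSpace Ω] (G : RandomAtomicMeasure Ω) (P : Measure Ω)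
  [IsProbabilityMeasure P] {ι : Type} [Fintype ι]

/-- Averages over replicas may be compared conditionally on the disorder. -/
theorem integral_tiltedRepl_eq_of_fiber {p : ℕ} {t : ℝ} {F F' : (ι → ℕ) × (Ω × (ℕ → ℝ)) → ℝ}
    (hF : Integrable F (G.tiltedRepl P p t ι)) (hF' : Integrable F' (G.tiltedRepl P p t ι))
    (h : ∀ (l : ι → ℕ) (ω : Ω),
      ∫ γ, (∏ i, G.tiltedWeight p t (ω, γ) (l i)) * F (l, (ω, γ)) ∂stdGaussianSeq =
        ∫ γ, (∏ i, G.tiltedWeight p t (ω, γ) (l i)) * F' (l, (ω, γ)) ∂stdGaussianSeq) :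
    ∫ z, F z ∂G.tiltedRepl P p t ι = ∫ z, F' z ∂G.tiltedRepl P p t ι := by
  have hv := G.isWeights_tiltedWeight P p t
  have hi : ∀ {F : (ι → ℕ) × (Ω × (ℕ → ℝ)) → ℝ}, Integrable F (G.tiltedRepl P p t ι) →
      ∀ l : ι → ℕ, Integrable (fun x => (∏ i, G.tiltedWeight p t x (l i)) * F (l, x))
        (P.prod stdGaussianSeq) := fun hF l =>
    (Measure.ae_count_iff.1 ((integrable_repl_iff hv.measurable hv.nonneg).1 hF).prod_right_ae) l
  rw [tiltedRepl, integral_repl_tsum hv.measurable hv.nonneg hF,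
    integral_repl_tsum hv.measurable hv.nonneg hF']
  refine tsum_congr fun l => ?_
  rw [integral_prod _ (hi hF l), integral_prod _ (hi hF' l)]
  exact integral_congr_ae (ae_of_all _ fun ω => h l ω)

theorem integrable_bdd_mul_comb_pow {p : ℕ} {t : ℝ} {g : (ι → ℕ) × (Ω × (ℕ → ℝ)) → ℝ} {B : ℝ}
    (hg : AEStronglyMeasurable g (G.tiltedRepl P p t ι)) (hB : ∀ᵐ z ∂G.tiltedRepl P p t ι, |g z| ≤ B)
    (lam : ι → ℝ) (c : ℝ) (r : ℕ) :
    Integrable (fun z => g z * G.comb p lam c z ^ r) (G.tiltedRepl P p t ι) :=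
  (G.integrable_comb_pow P p t lam c r).bdd_mul hg hB

omit [Fintype ι] in
theorem abs_overlaps_le (z : (ι → ℕ) × (Ω × (ℕ → ℝ))) (i j : ι) : |G.overlaps z i j| ≤ 1 :=
  G.abs_Q_le _ _ _

omit [Fintype ι] in
theorem abs_overlaps_pow_le (z : (ι → ℕ) × (Ω × (ℕ → ℝ))) (i j : ι) (p : ℕ) :
    |G.overlaps z i j ^ p| ≤ 1 := by
  rw [abs_pow]
  exact pow_le_one₀ (abs_nonneg _) (G.abs_overlaps_le z i j)

omit [Fintype ι] in
theorem measurable_overlap [Finite ι] (i j : ι) :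
    Measurable fun z : (ι → ℕ) × (Ω × (ℕ → ℝ)) => G.overlaps z i j :=
  (measurable_pi_apply j).comp ((measurable_pi_apply i).comp G.measurable_overlaps)

/-- The average of the covariance with an additional replica. -/
def meanCov (p : ℕ) (t : ℝ) (k : ι) (z : (ι → ℕ) × (Ω × (ℕ → ℝ))) : ℝ :=
  ∑' j, G.tiltedWeight p t z.2 j * G.cov p z.2.1 (z.1 k) j

omit [Fintype ι] in
theorem measurable_meanCov [Finite ι] (p : ℕ) (t : ℝ) (k : ι) : Measurable (G.meanCov p t k) :=
  measurable_of_countable_fst fun l => Measurable.tsum fun j =>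
    (G.measurable_tiltedWeight p t j).mul
      (((G.measurable_Q (l k) j).pow_const p).comp measurable_fst)

theorem ae_abs_meanCov_le (p : ℕ) (t : ℝ) (k : ι) :
    ∀ᵐ z ∂G.tiltedRepl P p t ι, |G.meanCov p t k z| ≤ 1 := by
  have hv := G.isWeights_tiltedWeight P p t
  filter_upwards [(measurePreserving_snd_repl (ι := ι) hv).quasiMeasurePreserving.ae hv.hasSum]
    with z hz
  rw [← Real.norm_eq_abs]
  refine tsum_of_norm_bounded hz fun j => ?_
  rw [norm_mul, Real.norm_of_nonneg (hv.nonneg j z.2)]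
  exact mul_le_of_le_one_right (hv.nonneg j z.2) (G.abs_cov_le p _ _ _)

/-- Gaussian integration by parts for the tilted replicas. -/
theorem integral_comb_pow_mul_field {p : ℕ} {t : ℝ} {f : (ι → ι → ℝ) → ℝ} (hf : Measurable f) {B : ℝ}
    (hB : ∀ R : ι → ι → ℝ, (∀ i j, |R i j| ≤ 1) → |f R| ≤ B) (k : ι) (lam : ι → ℝ) (c : ℝ) (r : ℕ) :
    ∫ z, f (G.overlaps z) * (G.comb p lam c z ^ r * G.field p z.2 (z.1 k)) ∂G.tiltedRepl P p t ι =
      r * ∑ i, lam i * ∫ z, f (G.overlaps z) * G.overlaps z k i ^ p * G.comb p lam c z ^ (r - 1)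
          ∂G.tiltedRepl P p t ι +
      t * (∑ i, ∫ z, f (G.overlaps z) * G.overlaps z k i ^ p * G.comb p lam c z ^ r
          ∂G.tiltedRepl P p t ι -
        Fintype.card ι * ∫ z, f (G.overlaps z) * G.meanCov p t k z * G.comb p lam c z ^ r
          ∂G.tiltedRepl P p t ι) := by
  have hfm : Measurable fun z : (ι → ℕ) × (Ω × (ℕ → ℝ)) => f (G.overlaps z) :=
    hf.comp G.measurable_overlaps
  have hB0 : 0 ≤ B := (abs_nonneg _).trans (hB 0 (by simp))
  have hQ : ∀ (i : ι) (r : ℕ), Integrable (fun z => f (G.overlaps z) * G.overlaps z k i ^ p *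
      G.comb p lam c z ^ r) (G.tiltedRepl P p t ι) := fun i r =>
    G.integrable_bdd_mul_comb_pow P
      (hfm.mul ((G.measurable_overlap k i).pow_const p)).aestronglyMeasurable (B := B * 1)
      (ae_of_all _ fun z => by
        rw [Pi.mul_apply, abs_mul]
        exact mul_le_mul (hB _ (G.abs_overlaps_le z)) (G.abs_overlaps_pow_le z k i p) (abs_nonneg _) hB0) _ _ _
  have hT : Integrable (fun z => f (G.overlaps z) * G.meanCov p t k z *
      G.comb p lam c z ^ r) (G.tiltedRepl P p t ι) := by
    refine G.integrable_bdd_mul_comb_pow P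
      (hfm.mul (G.measurable_meanCov p t k)).aestronglyMeasurable (B := B * 1) ?_ _ _ _
    filter_upwards [G.ae_abs_meanCov_le P p t k] with z hz
    rw [Pi.mul_apply, abs_mul]
    exact mul_le_mul (hB _ (G.abs_overlaps_le z)) hz (abs_nonneg _) hB0
  have h1 := integrable_finsetSum Finset.univ fun i _ => (hQ i (r - 1)).const_mul (lam i)
  have h2 := integrable_finsetSum Finset.univ fun i _ => hQ i r
  have h3 : Integrable (fun z => ∑ i, f (G.overlaps z) * G.overlaps z k i ^ p * G.comb p lam c z ^ r -
      Fintype.card ι * (f (G.overlaps z) * G.meanCov p t k z * G.comb p lam c z ^ r))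
      (G.tiltedRepl P p t ι) := h2.sub (hT.const_mul _)
  have hR := (h1.const_mul (r : ℝ)).add (h3.const_mul t)
  have hL : Integrable (fun z => f (G.overlaps z) *
      (G.comb p lam c z ^ r * G.field p z.2 (z.1 k))) (G.tiltedRepl P p t ι) :=
    (G.integrable_comb_pow_mul_field P p t lam c r k).bdd_mul hfm.aestronglyMeasurable
      (ae_of_all _ fun z => hB _ (G.abs_overlaps_le z))
  rw [G.integral_tiltedRepl_eq_of_fiber P hL hR]
  · simp only [Pi.add_apply]
    rw [integral_add (h1.const_mul _) (h3.const_mul t), integral_const_mul,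
      integral_const_mul, integral_sub h2 (hT.const_mul _), integral_const_mul,
      integral_finsetSum _ fun i _ => hQ i r,
      integral_finsetSum _ fun i _ => (hQ i (r - 1)).const_mul (lam i)]
    simp only [integral_const_mul]
  · intro l ω
    have h := integral_gibbs_mul_gaussianSeq (w := fun l => G.w l ω) (t := t)
      (G.cov_posSemidef p ω) (G.abs_cov_le p ω) (fun l => G.w_nonneg l ω) (G.w_zero_pos ω)
      (G.hasSum_w ω).summable l (l k) lam c r
    -- For fixed atoms and disorder the overlaps do not involve the Gaussian variables, so `f` is a
    -- constant factor in the inner integral.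
    set q := f fun i j => G.Q ω (l i) (l j) with hq
    have e1 : ∀ γ, (∏ i, G.tiltedWeight p t (ω, γ) (l i)) * (f (G.overlaps (l, (ω, γ))) *
        (G.comb p lam c (l, (ω, γ)) ^ r * G.field p (ω, γ) (l k))) =
        q * ((∏ i, gibbsWeight (fun l => G.w l ω) t (gaussianSeq (G.cov p ω) γ) (l i)) *
        (gaussianComb (G.cov p ω) l lam c γ ^ r * gaussianSeq (G.cov p ω) γ (l k))) := fun γ =>
      mul_left_comm _ _ _
    simp only [e1]
    rw [integral_const_mul, h, ← integral_const_mul]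
    refine integral_congr_ae (ae_of_all _ fun γ => ?_)
    have e2 : ∀ i, G.overlaps (l, (ω, γ)) k i ^ p = G.cov p ω (l k) (l i) := fun i => rfl
    have e3 : f (G.overlaps (l, (ω, γ))) = q := rfl
    have e4 : G.comb p lam c (l, (ω, γ)) = gaussianComb (G.cov p ω) l lam c γ := rfl
    have e5 : G.meanCov p t k (l, (ω, γ)) = ∑' j, gibbsWeight (fun l => G.w l ω) t
      (gaussianSeq (G.cov p ω) γ) j * G.cov p ω (l k) j := rfl
    have e6 : ∀ j, G.tiltedWeight p t (ω, γ) j =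
      gibbsWeight (fun l => G.w l ω) t (gaussianSeq (G.cov p ω) γ) j := fun _ => rfl
    simp only [Pi.add_apply, e2, e3, e4, e5, e6]
    have s1 : ∑ i, lam i * (q * G.cov p ω (l k) (l i) * gaussianComb (G.cov p ω) l lam c γ ^ (r - 1)) =
        q * gaussianComb (G.cov p ω) l lam c γ ^ (r - 1) * ∑ i, lam i * G.cov p ω (l k) (l i) := by
      rw [Finset.mul_sum]
      exact Finset.sum_congr rfl fun i _ => by ring
    have s2 : ∑ i, q * G.cov p ω (l k) (l i) * gaussianComb (G.cov p ω) l lam c γ ^ r =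
        q * gaussianComb (G.cov p ω) l lam c γ ^ r * ∑ i, G.cov p ω (l k) (l i) := by
      rw [Finset.mul_sum]
      exact Finset.sum_congr rfl fun i _ => by ring
    rw [s1, s2]
    ring

/-- Restriction to the first replicas. -/
def restr {κ : Type} (z : (ι ⊕ κ → ℕ) × (Ω × (ℕ → ℝ))) : (ι → ℕ) × (Ω × (ℕ → ℝ)) :=
  (z.1 ∘ Sum.inl, z.2)

theorem measurePreserving_restr (p : ℕ) (t : ℝ) (κ : Type) [Fintype κ] :
    MeasurePreserving (restr (ι := ι) (κ := κ) (Ω := Ω))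
      (G.tiltedRepl P p t (ι ⊕ κ)) (G.tiltedRepl P p t ι) :=
  ⟨measurable_comp_fst measurable_id _,
    repl_map_comp (G.isWeights_tiltedWeight P p t) Sum.inl_injective⟩

/-- The average covariance produced by differentiating the normalization is the overlap with a new
replica. -/
theorem integral_mul_meanCov {p : ℕ} {t : ℝ} {g : (ι → ℕ) × (Ω × (ℕ → ℝ)) → ℝ}
    (hg : Integrable g (G.tiltedRepl P p t ι)) (k : ι) :
    ∫ z, g z * G.meanCov p t k z ∂G.tiltedRepl P p t ι =
      ∫ z, g (restr z) * G.overlaps z (Sum.inl k) (Sum.inr ()) ^ p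
        ∂G.tiltedRepl P p t (ι ⊕ Unit) := by
  have hm := G.measurePreserving_restr P (ι := ι) p t Unit
  have hi : Integrable (fun z => g (restr z) * G.overlaps z (Sum.inl k) (Sum.inr ()) ^ p)
      (G.tiltedRepl P p t (ι ⊕ Unit)) :=
    (hm.integrable_comp_of_integrable hg).mul_bdd
      ((G.measurable_overlap _ _).pow_const p).aestronglyMeasurable
      (ae_of_all _ fun z => G.abs_overlaps_pow_le z _ _ p)
  refine Eq.trans ?_ (integral_repl_sum (G.isWeights_tiltedWeight P p t) hi).symm
  refine integral_congr_ae (ae_of_all _ fun z => ?_)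
  beta_reduce
  rw [← (Equiv.funUnique Unit ℕ).symm.tsum_eq, meanCov, ← tsum_mul_left]
  refine tsum_congr fun j => ?_
  simp only [Fintype.prod_unique]
  exact mul_left_comm _ _ _

end RandomAtomicMeasure

end SpinGlass

/-! ### Test functions, the untilted overlap array, and replica forms of stability -/

namespace SpinGlass

section Test

variable {ι κ : Type}

/-- Measurable functions of the overlaps that are bounded on the range of the overlaps. -/
structure IsTest (f : (ι → ι → ℝ) → ℝ) : Prop where
  measurable : Measurable f
  bounded : ∃ B, ∀ R : ι → ι → ℝ, (∀ i j, |R i j| ≤ 1) → |f R| ≤ B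

namespace IsTest

theorem const (c : ℝ) : IsTest fun _ : ι → ι → ℝ => c := ⟨measurable_const, |c|, fun _ _ => le_rfl⟩

theorem coord (i j : ι) : IsTest fun R : ι → ι → ℝ => R i j :=
  ⟨by fun_prop, 1, fun _ h => h i j⟩

theorem add {f g : (ι → ι → ℝ) → ℝ} (hf : IsTest f) (hg : IsTest g) : IsTest fun R => f R + g R := by
  obtain ⟨A, hA⟩ := hf.bounded
  obtain ⟨B, hB⟩ := hg.bounded
  exact ⟨hf.measurable.add hg.measurable, A + B, fun R h =>
    (abs_add_le _ _).trans (add_le_add (hA R h) (hB R h))⟩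

theorem mul {f g : (ι → ι → ℝ) → ℝ} (hf : IsTest f) (hg : IsTest g) : IsTest fun R => f R * g R := by
  obtain ⟨A, hA⟩ := hf.bounded
  obtain ⟨B, hB⟩ := hg.bounded
  refine ⟨hf.measurable.mul hg.measurable, A * B, fun R h => ?_⟩
  rw [abs_mul]
  exact mul_le_mul (hA R h) (hB R h) (abs_nonneg _) ((abs_nonneg _).trans (hA R h))

theorem pow {f : (ι → ι → ℝ) → ℝ} (hf : IsTest f) (n : ℕ) : IsTest fun R => f R ^ n := by
  induction n with
  | zero => simpa using const 1
  | succ n ih => simpa only [pow_succ] using ih.mul hf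

theorem sum {α : Type*} {f : α → (ι → ι → ℝ) → ℝ} (s : Finset α) (hf : ∀ a, IsTest (f a)) :
    IsTest fun R => ∑ a ∈ s, f a R := by
  classical
  induction s using Finset.induction_on with
  | empty => simpa using const 0
  | insert a s ha ih => simpa only [Finset.sum_insert ha] using (hf a).add ih

theorem comp {f : (ι → ι → ℝ) → ℝ} (hf : IsTest f) (e : ι → κ) :
    IsTest fun R : κ → κ → ℝ => f fun i j => R (e i) (e j) := by
  obtain ⟨B, hB⟩ := hf.bounded
  exact ⟨hf.measurable.comp (by fun_prop), B, fun R h => hB _ fun i j => h _ _⟩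

theorem indicator {s : Set (ι → ι → ℝ)} (hs : MeasurableSet s) :
    IsTest (s.indicator fun _ => (1 : ℝ)) := by
  refine ⟨measurable_const.indicator hs, 1, fun R _ => ?_⟩
  by_cases h : R ∈ s <;> simp [h]

end IsTest

end Test

namespace RandomAtomicMeasure

variable {Ω : Type*} [MeasurableSpace Ω] (G : RandomAtomicMeasure Ω) (P : Measure Ω)
  [IsProbabilityMeasure P] {ι κ : Type} [Fintype ι] [Fintype κ]

/-- The law of the overlaps of replicas. -/
def overlapArray (ι : Type) [Fintype ι] : Measure (ι → ι → ℝ) :=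
  (G.tiltedRepl P 0 0 ι).map G.overlaps

instance : IsProbabilityMeasure (G.overlapArray P ι) :=
  Measure.isProbabilityMeasure_map G.measurable_overlaps.aemeasurable

omit [IsProbabilityMeasure P] in
theorem tiltedRepl_zero (p : ℕ) : G.tiltedRepl P p 0 ι = G.tiltedRepl P 0 0 ι := by
  simp only [tiltedRepl, tiltedWeight_zero]

omit [IsProbabilityMeasure P] in
theorem ae_overlapArray_iff {s : (ι → ι → ℝ) → Prop} (hs : MeasurableSet {R | s R}) :
    (∀ᵐ R ∂G.overlapArray P ι, s R) ↔ ∀ᵐ z ∂G.tiltedRepl P 0 0 ι, s (G.overlaps z) :=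
  ae_map_iff G.measurable_overlaps.aemeasurable hs

omit [IsProbabilityMeasure P] in
theorem ae_overlapArray_abs_le : ∀ᵐ R ∂G.overlapArray P ι, ∀ i j, |R i j| ≤ 1 := by
  refine (G.ae_overlapArray_iff P ?_).2 (ae_of_all _ G.abs_overlaps_le)
  simp only [Set.ofPred_forall]
  exact MeasurableSet.iInter fun i => MeasurableSet.iInter fun j =>
    measurableSet_le (by fun_prop) measurable_const

theorem IsTest.integrable_tiltedRepl {f : (ι → ι → ℝ) → ℝ} (hf : IsTest f) (p : ℕ) (t : ℝ) :
    Integrable (fun z => f (G.overlaps z)) (G.tiltedRepl P p t ι) := by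
  obtain ⟨B, hB⟩ := hf.bounded
  exact Integrable.of_bound (hf.measurable.comp G.measurable_overlaps).aestronglyMeasurable B
    (ae_of_all _ fun z => hB _ (G.abs_overlaps_le z))

theorem IsTest.integrable {f : (ι → ι → ℝ) → ℝ} (hf : IsTest f) :
    Integrable f (G.overlapArray P ι) :=
  (integrable_map_measure hf.measurable.aestronglyMeasurable
    G.measurable_overlaps.aemeasurable).2 (IsTest.integrable_tiltedRepl G P hf 0 0)

omit [IsProbabilityMeasure P] in
theorem integral_overlapArray {f : (ι → ι → ℝ) → ℝ} (hf : Measurable f) :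
    ∫ R, f R ∂G.overlapArray P ι = ∫ z, f (G.overlaps z) ∂G.tiltedRepl P 0 0 ι :=
  integral_map G.measurable_overlaps.aemeasurable hf.aestronglyMeasurable

theorem measurePreserving_overlapArray {e : ι → κ} (he : Function.Injective e) :
    MeasurePreserving (fun (R : κ → κ → ℝ) i j => R (e i) (e j)) (G.overlapArray P κ)
      (G.overlapArray P ι) := by
  have hm : Measurable fun (R : κ → κ → ℝ) (i j : ι) => R (e i) (e j) := by fun_prop
  have hm2 : Measurable fun z : (κ → ℕ) × (Ω × (ℕ → ℝ)) => (z.1 ∘ e, z.2) :=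
    measurable_comp_fst measurable_id e
  refine ⟨hm, ?_⟩
  rw [overlapArray, overlapArray, Measure.map_map hm G.measurable_overlaps, tiltedRepl, tiltedRepl,
    ← repl_map_comp (G.isWeights_tiltedWeight P 0 0) he, Measure.map_map G.measurable_overlaps hm2]
  rfl

theorem integral_overlapArray_comp {e : ι → κ} (he : Function.Injective e) {f : (ι → ι → ℝ) → ℝ}
    (hf : Measurable f) :
    ∫ R, f (fun i j => R (e i) (e j)) ∂G.overlapArray P κ = ∫ R, f R ∂G.overlapArray P ι := by
  have h := G.measurePreserving_overlapArray P he
  rw [← h.map_eq, integral_map h.measurable.aemeasurable hf.aestronglyMeasurable]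

/-- Link between the averages over `Ω` in the Ghirlanda–Guerra identities and the overlap array
built over `Ω × ℝ^ℕ`: without tilt the Gaussian factor integrates out. -/
theorem meanAvg_eq {n : ℕ} {f : (Fin n → Fin n → ℝ) → ℝ} (hf : IsTest f) :
    G.meanAvg P n (fun σ => f (overlap σ)) = ∫ R, f R ∂G.overlapArray P (Fin n) := by
  have hv := G.isWeights_tiltedWeight P 0 0
  rw [G.integral_overlapArray P hf.measurable, tiltedRepl, integral_repl hv.measurable hv.nonneg
    (IsTest.integrable_tiltedRepl G P hf 0 0)]
  simp only [tiltedWeight_zero]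
  refine Eq.trans ?_ (integral_fun_fst (μ := P) (ν := stdGaussianSeq) fun ω =>
    ∑' l : Fin n → ℕ, (∏ i, G.w (l i) ω) * f fun i j => G.Q ω (l i) (l j)).symm
  rw [probReal_univ, one_smul]
  rfl

/-- The moments of the overlap of two replicas. -/
def overlapMoment (p : ℕ) : ℝ := ∫ R, R 0 1 ^ p ∂G.overlapArray P (Fin 2)

theorem meanAvg_overlap_pow (p : ℕ) :
    G.meanAvg P 2 (fun σ => overlap σ 0 1 ^ p) = G.overlapMoment P p :=
  G.meanAvg_eq P ((IsTest.coord (0 : Fin 2) 1).pow p)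

theorem b_eq (p : ℕ) : G.b P p = G.qStar P ^ p - G.overlapMoment P p := by
  rw [b, meanAvg_overlap_pow]

/-! ### Consequences of stability for the laws of replicas -/

variable {G P}

/-- Replicas ignore the order of the atoms, so stability of the sorted array passes to them. The
marks are set to zero since stochastic stability says nothing about the field. -/
theorem AizenmanContucci.map_overlaps (h : G.AizenmanContucci P) {p : ℕ} (hp : 1 ≤ p) (t : ℝ) :
    (G.tiltedRepl P p t ι).map G.overlaps = G.overlapArray P ι := by
  have hS := G.markedWeights_zero P p t
  have hS' := G.markedWeights_zero P p 0
  have key := replLaw_eq_of_identDistrib hS hS' (G.perm p t) (fun n => by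
    have h1 := h p hp t n
    have h2 : IdentDistrib (fun ω : Ω => ((fun l : Fin n => G.w l ω),
        (fun l l' : Fin n => G.Q ω l l'))) (fun x : Ω × (ℕ → ℝ) => ((fun l : Fin n => G.w l x.1),
        (fun l l' : Fin n => G.Q x.1 l l'))) P (P.prod stdGaussianSeq) := by
      have hm : Measurable fun ω : Ω => ((fun l : Fin n => G.w l ω),
          (fun l l' : Fin n => G.Q ω l l')) :=
        (measurable_pi_iff.2 fun l : Fin n => G.measurable_w l).prodMk
          (measurable_pi_iff.2 fun l : Fin n => measurable_pi_iff.2 fun l' : Fin n => G.measurable_Q l l')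
      refine ⟨hm.aemeasurable, (hm.comp measurable_fst).aemeasurable, ?_⟩
      rw [← (measurePreserving_fst (μ := P) (ν := stdGaussianSeq)).map_eq,
        Measure.map_map hm measurable_fst]
      rw [(measurePreserving_fst (μ := P) (ν := stdGaussianSeq)).map_eq]
      rfl
    have h3 := (h1.trans h2).comp (u := fun y : (Fin n → ℝ) × (Fin n → Fin n → ℝ) =>
      (y.1, (fun _ : Fin n => (0 : ℝ)), y.2)) (by fun_prop)
    simp only [tiltedWeight_zero]
    exact h3) ι
  have key2 := congrArg (Measure.map Prod.snd) key
  rw [replLaw, replLaw, Measure.map_map measurable_snd hS.measurable_replData,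
    Measure.map_map measurable_snd hS'.measurable_replData] at key2
  rw [overlapArray, ← tiltedRepl_zero G P p]
  exact key2

theorem UnifiedStability.replLaw_eq (h : G.UnifiedStability P) {p : ℕ} (hp : 1 ≤ p) (t : ℝ)
    (ι : Type) [Fintype ι] :
    replLaw (P.prod stdGaussianSeq) (fun l x => G.tiltedWeight p t x l)
        (fun l x => G.field p x l - G.b P p * t) (fun l l' x => G.Q x.1 l l') ι =
      replLaw (P.prod stdGaussianSeq) (fun l x => G.tiltedWeight p 0 x l)
        (fun l x => G.field p x l - 0) (fun l l' x => G.Q x.1 l l') ι :=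
  replLaw_eq_of_identDistrib (G.markedWeights_tilted P p t _) (G.markedWeights_tilted P p 0 0)
    (G.perm p t) (fun n => by
      simp only [tiltedWeight_zero, sub_zero]
      exact h p hp t n) ι

omit [IsProbabilityMeasure P] in
theorem UnifiedStability.aizenmanContucci (h : G.UnifiedStability P) : G.AizenmanContucci P := by
  intro p hp t n
  have h1 := (h p hp t n).comp (u := fun y : (Fin n → ℝ) × (Fin n → ℝ) × (Fin n → Fin n → ℝ) =>
    (y.1, y.2.2)) (by fun_prop)
  have hm : Measurable fun ω : Ω => ((fun l : Fin n => G.w l ω),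
      (fun l l' : Fin n => G.Q ω l l')) :=
    (measurable_pi_iff.2 fun l : Fin n => G.measurable_w l).prodMk
      (measurable_pi_iff.2 fun l : Fin n => measurable_pi_iff.2 fun l' : Fin n => G.measurable_Q l l')
  refine ⟨h1.aemeasurable_fst, hm.aemeasurable, h1.map_eq.trans ?_⟩
  conv_rhs => rw [← (measurePreserving_fst (μ := P) (ν := stdGaussianSeq)).map_eq,
    Measure.map_map hm measurable_fst]
  rfl

end RandomAtomicMeasure

end SpinGlass

/-! ### The Ghirlanda–Guerra identities for arbitrary finite families of replicas -/

namespace SpinGlass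

namespace RandomAtomicMeasure

variable {Ω : Type*} [MeasurableSpace Ω] {G : RandomAtomicMeasure Ω} {P : Measure Ω}
  [IsProbabilityMeasure P] {ι κ : Type} [Fintype ι] [Fintype κ]

/-- Test functions of some of the overlaps, multiplied by a power of another overlap. -/
theorem isTest_comp_mul_pow {ι κ : Type} {f : (ι → ι → ℝ) → ℝ} (hf : IsTest f) (e : ι → κ) (a b : κ)
    (p : ℕ) : IsTest fun R : κ → κ → ℝ => f (fun i j => R (e i) (e j)) * R a b ^ p :=
  (hf.comp e).mul ((IsTest.coord a b).pow p)

/-- The Ghirlanda-Guerra identity for the replicas `ι` and the test function `f`. -/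
def ReplicaIdentity (G : RandomAtomicMeasure Ω) (P : Measure Ω) (f : (ι → ι → ℝ) → ℝ) (j : ι)
    (p : ℕ) : Prop :=
  (Fintype.card ι : ℝ) * ∫ R, f (fun a b => R (Sum.inl a) (Sum.inl b)) *
      R (Sum.inl j) (Sum.inr ()) ^ p ∂G.overlapArray P (ι ⊕ Unit) =
    (∫ R, f R ∂G.overlapArray P ι) * G.overlapMoment P p +
      (∑ l, ∫ R, f R * R j l ^ p ∂G.overlapArray P ι - ∫ R, f R * R j j ^ p ∂G.overlapArray P ι)

theorem meanAvg_last {n : ℕ} [NeZero n] {f : (Fin n → Fin n → ℝ) → ℝ} (hf : IsTest f) (p : ℕ) :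
    G.meanAvg P (n + 1) (fun σ =>
        f (overlap fun i : Fin n => σ i.castSucc) * overlap σ 0 (Fin.last n) ^ p) =
      ∫ R, f (fun a b => R (Sum.inl a) (Sum.inl b)) * R (Sum.inl 0) (Sum.inr ()) ^ p
        ∂G.overlapArray P (Fin n ⊕ Unit) := by
  have he : Function.Injective (Sum.elim Fin.castSucc fun _ : Unit => Fin.last n) :=
    (Fin.castSucc_injective n).sumElim (fun _ _ _ => rfl) fun a _ => (Fin.castSucc_lt_last a).ne
  refine (G.meanAvg_eq P (isTest_comp_mul_pow hf Fin.castSucc 0 (Fin.last n) p)).trans ?_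
  rw [← G.integral_overlapArray_comp P he
    (isTest_comp_mul_pow hf Sum.inl (Sum.inl 0) (Sum.inr ()) p).measurable]
  rfl

theorem meanAvg_sum {n : ℕ} {f : (Fin n → Fin n → ℝ) → ℝ} (hf : IsTest f) (j : Fin n) (p : ℕ) :
    ∑ l : Fin n with l ≠ j, G.meanAvg P n (fun σ => f (overlap σ) * overlap σ j l ^ p) =
      ∑ l, ∫ R, f R * R j l ^ p ∂G.overlapArray P (Fin n) -
        ∫ R, f R * R j j ^ p ∂G.overlapArray P (Fin n) := by
  rw [Finset.filter_ne', ← Finset.sum_erase_eq_sub (Finset.mem_univ j)]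
  exact Finset.sum_congr rfl fun l _ => G.meanAvg_eq P (isTest_comp_mul_pow hf id j l p)

theorem GhirlandaGuerra.of_replicaIdentity
    (h : ∀ (n : ℕ) (j : Fin n) (f : (Fin n → Fin n → ℝ) → ℝ), IsTest f → ∀ p, 1 ≤ p →
      ReplicaIdentity G P f j p) : G.GhirlandaGuerra P := by
  intro n hn f hf ⟨B, hB⟩ p hp
  have : NeZero n := ⟨by omega⟩
  have hT : IsTest f := ⟨hf, B, fun R _ => hB R⟩
  have hn0 : (n : ℝ) ≠ 0 := by positivity
  rw [meanAvg_last hT, meanAvg_sum hT, G.meanAvg_eq P hT, meanAvg_overlap_pow]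
  have := h n 0 f hT p hp
  rw [ReplicaIdentity, Fintype.card_fin] at this
  have hz : (⟨0, by omega⟩ : Fin n) = 0 := rfl
  rw [hz, ← mul_add, one_div, ← this, inv_mul_cancel_left₀ hn0]

-- The identities are assumed for globally bounded functions only. Cutting a test function off
-- outside the range of the overlaps makes it bounded and changes no average.
omit [IsProbabilityMeasure P] [Fintype ι] in
theorem isTest_ind_mul {f : (ι → ι → ℝ) → ℝ} [Finite ι] (hf : IsTest f) :
    IsTest ({R : ι → ι → ℝ | ∀ i j, |R i j| ≤ 1}.indicator f) ∧
      ∃ B, ∀ R, |{R : ι → ι → ℝ | ∀ i j, |R i j| ≤ 1}.indicator f R| ≤ B := by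
  have hs : MeasurableSet {R : ι → ι → ℝ | ∀ i j, |R i j| ≤ 1} := by
    simp only [Set.ofPred_forall]
    exact MeasurableSet.iInter fun i => MeasurableSet.iInter fun j =>
      measurableSet_le (by fun_prop) measurable_const
  obtain ⟨B, hB⟩ := hf.bounded
  have hB0 : 0 ≤ B := (abs_nonneg _).trans (hB 0 (by simp))
  have key : ∀ R, |{R : ι → ι → ℝ | ∀ i j, |R i j| ≤ 1}.indicator f R| ≤ B := fun R => by
    by_cases h : R ∈ {R : ι → ι → ℝ | ∀ i j, |R i j| ≤ 1}
    · rw [Set.indicator_of_mem h]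
      exact hB R h
    · rw [Set.indicator_of_notMem h, abs_zero]
      exact hB0
  exact ⟨⟨hf.measurable.indicator hs, B, fun R _ => key R⟩, B, key⟩

theorem GhirlandaGuerra.replicaIdentity_fin (h : G.GhirlandaGuerra P) {n : ℕ} (hn : 2 ≤ n) [NeZero n]
    {f : (Fin n → Fin n → ℝ) → ℝ} (hf : IsTest f) {p : ℕ} (hp : 1 ≤ p) :
    ReplicaIdentity G P f 0 p := by
  set f' := {R : Fin n → Fin n → ℝ | ∀ i j, |R i j| ≤ 1}.indicator f with hf'
  obtain ⟨hT, hB⟩ := isTest_ind_mul hf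
  have hn0 : (n : ℝ) ≠ 0 := by positivity
  have key := h n hn f' hT.measurable hB p hp
  have hz : (⟨0, by omega⟩ : Fin n) = 0 := rfl
  rw [meanAvg_last hT, meanAvg_sum hT, G.meanAvg_eq P hT, meanAvg_overlap_pow] at key
  have hff : ∀ R : Fin n → Fin n → ℝ, (∀ i j, |R i j| ≤ 1) → f' R = f R := fun R hR =>
    Set.indicator_of_mem (by exact hR) f
  have e1 : ∀ g : (Fin n → Fin n → ℝ) → ℝ, ∫ R, f' R * g R ∂G.overlapArray P (Fin n) =
      ∫ R, f R * g R ∂G.overlapArray P (Fin n) := fun g =>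
    integral_congr_ae ((G.ae_overlapArray_abs_le P).mono fun R hR => by simp only [hff R hR])
  have e2 : ∫ R, f' R ∂G.overlapArray P (Fin n) = ∫ R, f R ∂G.overlapArray P (Fin n) :=
    integral_congr_ae ((G.ae_overlapArray_abs_le P).mono fun R hR => hff R hR)
  have e3 : ∫ R, f' (fun a b => R (Sum.inl a) (Sum.inl b)) * R (Sum.inl 0) (Sum.inr ()) ^ p
      ∂G.overlapArray P (Fin n ⊕ Unit) = ∫ R, f (fun a b => R (Sum.inl a) (Sum.inl b)) *
        R (Sum.inl 0) (Sum.inr ()) ^ p ∂G.overlapArray P (Fin n ⊕ Unit) :=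
    integral_congr_ae ((G.ae_overlapArray_abs_le P).mono fun R hR => by
      simp only [hff (fun a b => R (Sum.inl a) (Sum.inl b)) fun i j => hR _ _])
  simp only [← hf', hz, e1, e2, e3] at key
  rw [ReplicaIdentity, Fintype.card_fin]
  rw [key]
  field_simp

/-- By exchangeability the distinguished replica `j` may be given the label 0. -/
theorem GhirlandaGuerra.replicaIdentity_of_two_le (h : G.GhirlandaGuerra P)
    (hι : 2 ≤ Fintype.card ι) {f : (ι → ι → ℝ) → ℝ} (hf : IsTest f) (j : ι) {p : ℕ} (hp : 1 ≤ p) :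
    ReplicaIdentity G P f j p := by
  obtain ⟨n, hn⟩ : ∃ n, n = Fintype.card ι := ⟨_, rfl⟩
  have : NeZero n := ⟨by omega⟩
  obtain ⟨e, he⟩ : ∃ e : ι ≃ Fin n, e j = 0 := by
    have e0 := (Fintype.equivFin ι).trans (finCongr hn.symm)
    exact ⟨e0.trans (Equiv.swap (e0 j) 0), by simp⟩
  have key := h.replicaIdentity_fin (hn ▸ hι) (hf.comp e) hp
  have e1 : ∀ {g : (ι → ι → ℝ) → ℝ}, Measurable g →
      ∫ R, g (fun a b => R (e a) (e b)) ∂G.overlapArray P (Fin n) = ∫ R, g R ∂G.overlapArray P ι :=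
    fun hg => G.integral_overlapArray_comp P e.injective hg
  have he' : Function.Injective (Sum.map e id : ι ⊕ Unit → Fin n ⊕ Unit) :=
    Function.Injective.sumMap e.injective Function.injective_id
  have e2 : ∀ {g : (ι ⊕ Unit → ι ⊕ Unit → ℝ) → ℝ}, Measurable g →
      ∫ R, g (fun a b => R (Sum.map e id a) (Sum.map e id b)) ∂G.overlapArray P (Fin n ⊕ Unit) =
        ∫ R, g R ∂G.overlapArray P (ι ⊕ Unit) :=
    fun hg => G.integral_overlapArray_comp P he' hg
  have hm : ∀ a b, Measurable fun R : ι → ι → ℝ => f R * R a b ^ p := fun a b =>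
    (isTest_comp_mul_pow hf id a b p).measurable
  rw [ReplicaIdentity, Fintype.card_fin, ← e.sum_comp, e1 hf.measurable] at key
  simp only [← he] at key
  rw [ReplicaIdentity, ← hn, ← e2 (isTest_comp_mul_pow hf Sum.inl (Sum.inl j) (Sum.inr ()) p).measurable,
    ← e1 (hm j j)]
  simp only [← fun l => e1 (hm j l)]
  exact key

/-- Exponent zero is trivial but needed for total masses. For a single replica the identity for two
is used with `f` depending on the first: then 2X = 𝔼⟨f⟩ 𝔼⟨R_{1,2}^p⟩ + X, where X = 𝔼⟨f R_{1,2}^p⟩.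
-/
theorem GhirlandaGuerra.replicaIdentity (h : G.GhirlandaGuerra P) {f : (ι → ι → ℝ) → ℝ}
    (hf : IsTest f) (j : ι) (p : ℕ) : ReplicaIdentity G P f j p := by
  rcases Nat.eq_zero_or_pos p with rfl | hp
  · rw [ReplicaIdentity]
    simp only [pow_zero, mul_one, overlapMoment, integral_const, probReal_univ, smul_eq_mul,
      Finset.sum_const, Finset.card_univ, nsmul_eq_mul]
    rw [G.integral_overlapArray_comp P Sum.inl_injective hf.measurable]
    ring
  rcases Nat.lt_or_ge (Fintype.card ι) 2 with hι | hι
  · have hone : Fintype.card ι = 1 :=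
      le_antisymm (by omega) (Fintype.card_pos_iff.2 ⟨j⟩)
    have : Subsingleton ι := Fintype.card_le_one_iff_subsingleton.1 hone.le
    have key := h.replicaIdentity_of_two_le (ι := ι ⊕ Unit) (by simp [hone]) (hf.comp Sum.inl)
      (Sum.inl j) hp
    have he : Function.Injective (Sum.elim (Sum.inl ∘ Sum.inl) Sum.inr :
        ι ⊕ Unit → (ι ⊕ Unit) ⊕ Unit) := by
      refine (Sum.inl_injective.comp Sum.inl_injective).sumElim Sum.inr_injective ?_
      simp
    have e1 := G.integral_overlapArray_comp P he
      (isTest_comp_mul_pow hf Sum.inl (Sum.inl j) (Sum.inr ()) p).measurable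
    simp only [Sum.elim_inl, Sum.elim_inr, Function.comp_apply] at e1
    rw [ReplicaIdentity, e1, G.integral_overlapArray_comp P Sum.inl_injective hf.measurable,
      Fintype.sum_sum_type] at key
    rw [ReplicaIdentity]
    have hs : ∀ F : ι → ℝ, ∑ l, F l = F j := fun F => Fintype.sum_subsingleton F j
    rw [hs] at key ⊢
    simp only [Fintype.card_sum, hone, Fintype.card_unit, Finset.univ_unique, Finset.sum_singleton,
      Nat.cast_add, Nat.cast_one, PUnit.default_eq_unit] at key ⊢
    linarith
  · exact h.replicaIdentity_of_two_le hι hf j hp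

end RandomAtomicMeasure
end SpinGlass

/-! ### Harmonic decay, and the Ghirlanda–Guerra identities for events -/

namespace SpinGlass

/-- If δ were positive, step `n` would lower `c` by at least δθ/(n+K). These decrements sum to
infinity, although `c` stays above δ. -/
theorem nonpos_of_harmonic_decay {c : ℕ → ℝ} {δ θ K : ℝ} (hθ : 0 < θ) (hK : 0 < K)
    (hδ : ∀ n, δ ≤ c n) (h : ∀ n : ℕ, (n + K) * c (n + 1) ≤ (n + K - θ) * c n) : δ ≤ 0 := by
  by_contra! hpos
  obtain ⟨M, hM⟩ := exists_nat_gt K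
  have hstep : ∀ n : ℕ, δ * θ * (1 / ((n + M : ℕ) : ℝ)) ≤ c n - c (n + 1) := fun n => by
    have hn : 0 < (n : ℝ) + K := by positivity
    have hnM : (n : ℝ) + K ≤ ((n + M : ℕ) : ℝ) := by
      push_cast
      linarith
    have h1 : δ * θ / (n + K) ≤ c n - c (n + 1) := by
      rw [div_le_iff₀ hn]
      nlinarith [h n, hδ n]
    refine le_trans ?_ h1
    rw [mul_one_div]
    exact div_le_div_of_nonneg_left (by positivity) hn hnM
  have hsum : Summable fun n : ℕ => δ * θ * (1 / ((n + M : ℕ) : ℝ)) := by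
    refine summable_of_sum_range_le (c := c 0 - δ) (fun n => by positivity) fun N => ?_
    refine (Finset.sum_le_sum fun n _ => hstep n).trans ?_
    rw [Finset.sum_range_sub']
    linarith [hδ N]
  rw [summable_mul_left_iff (by positivity), summable_nat_add_iff (f := fun n : ℕ => 1 / (n : ℝ))]
    at hsum
  exact Real.not_summable_one_div_natCast hsum

/-- Almost sure properties of replicas are properties of the atoms of positive weight. -/
theorem ae_repl_iff {X : Type*} [MeasurableSpace X] {μ : Measure X} [SFinite μ] {v : ℕ → X → ℝ}
    {ι : Type} [Fintype ι] (hv : ∀ l, Measurable (v l)) {s : (ι → ℕ) × X → Prop}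
    (hs : MeasurableSet {z | s z}) :
    (∀ᵐ z ∂repl μ v ι, s z) ↔
      ∀ᵐ x ∂μ, ∀ l : ι → ℕ, (∀ i, 0 < v (l i) x) → s (l, x) := by
  have hm : Measurable ({z | ¬ s z}.indicator fun _ : (ι → ℕ) × X => (1 : ℝ≥0∞)) :=
    measurable_const.indicator hs.compl
  have h2 : Measurable fun x => ∑' l : ι → ℕ, (∏ i, ENNReal.ofReal (v (l i) x)) *
      {z | ¬ s z}.indicator (fun _ : (ι → ℕ) × X => (1 : ℝ≥0∞)) (l, x) :=
    Measurable.tsum fun l => (Finset.measurable_fun_prod _ fun i _ => (hv (l i)).ennreal_ofReal).mul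
      (hm.comp measurable_prodMk_left)
  have h1 := lintegral_repl' (μ := μ) hv hm
  have h0 : ∫⁻ z, {z | ¬ s z}.indicator (fun _ : (ι → ℕ) × X => (1 : ℝ≥0∞)) z ∂repl μ v ι =
    repl μ v ι {z | s z}ᶜ := lintegral_indicator_one hs.compl
  rw [ae_iff]
  change repl μ v ι {z | s z}ᶜ = 0 ↔ _
  rw [← h0, h1, lintegral_eq_zero_iff h2]
  refine Filter.eventually_congr (ae_of_all _ fun x => ?_)
  simp only [Pi.zero_apply, ENNReal.tsum_eq_zero, mul_eq_zero, Finset.prod_eq_zero_iff,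
    Finset.mem_univ, true_and, ENNReal.ofReal_eq_zero]
  refine forall_congr' fun l => ?_
  by_cases h : s (l, x)
  · simp [h]
  · simp only [h, imp_false, not_forall, not_lt]
    rw [Set.indicator_of_mem (by exact h)]
    simp

namespace RandomAtomicMeasure

variable {Ω : Type*} [MeasurableSpace Ω] {G : RandomAtomicMeasure Ω} {P : Measure Ω}
  [IsProbabilityMeasure P] {ι κ : Type} [Fintype ι] [Fintype κ]

omit [Fintype ι] in
theorem measurable_coord (a b : ι) : Measurable fun R : ι → ι → ℝ => R a b := by fun_prop

omit [IsProbabilityMeasure P] in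
theorem integral_pow_map_restrict {s : Set (ι → ι → ℝ)} (hs : MeasurableSet s) (a b : ι) (m : ℕ) :
    ∫ x, x ^ m ∂((G.overlapArray P ι).restrict s).map (fun R => R a b) =
      ∫ R, s.indicator (fun _ => 1) R * R a b ^ m ∂G.overlapArray P ι := by
  rw [integral_map (measurable_coord a b).aemeasurable (by fun_prop), ← integral_indicator hs]
  refine integral_congr_ae (ae_of_all _ fun R => ?_)
  by_cases h : R ∈ s <;> simp [h]

theorem integrable_exp_map_restrict (s : Set (ι → ι → ℝ)) (a b : ι) (u : ℝ) :
    Integrable (fun x => Real.exp (u * x))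
      (((G.overlapArray P ι).restrict s).map fun R => R a b) := by
  rw [integrable_map_measure (by fun_prop) (measurable_coord a b).aemeasurable]
  refine Integrable.restrict (IsTest.integrable G P (f := fun R : ι → ι → ℝ => Real.exp (u * R a b))
    ⟨by fun_prop, Real.exp |u|, fun R h => ?_⟩)
  rw [Real.abs_exp, Real.exp_le_exp]
  refine (le_abs_self _).trans ?_
  rw [abs_mul]
  exact mul_le_of_le_one_right (abs_nonneg _) (h a b)

theorem integrable_pow_map_restrict (s : Set (ι → ι → ℝ)) (a b : ι) (m : ℕ) :
    Integrable (fun x => x ^ m) (((G.overlapArray P ι).restrict s).map fun R => R a b) := by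
  rw [integrable_map_measure (by fun_prop) (measurable_coord a b).aemeasurable]
  exact Integrable.restrict (IsTest.integrable G P ((IsTest.coord a b).pow m))

/-- The Ghirlanda-Guerra identities for indicator functions. -/
theorem GhirlandaGuerra.measure_eq (h : G.GhirlandaGuerra P) {s : Set (ι → ι → ℝ)}
    (hs : MeasurableSet s) (j : ι) {S : Set ℝ} (hS : MeasurableSet S) :
    (Fintype.card ι : ℝ) * (G.overlapArray P (ι ⊕ Unit)).real
        {R | (fun a b => R (Sum.inl a) (Sum.inl b)) ∈ s ∧ R (Sum.inl j) (Sum.inr ()) ∈ S} +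
        (G.overlapArray P ι).real {R | R ∈ s ∧ R j j ∈ S} =
      (G.overlapArray P ι).real s * (G.overlapArray P (Fin 2)).real {R | R 0 1 ∈ S} +
        ∑ l, (G.overlapArray P ι).real {R | R ∈ s ∧ R j l ∈ S} := by
  have hs' : MeasurableSet {R : ι ⊕ Unit → ι ⊕ Unit → ℝ |
      (fun a b => R (Sum.inl a) (Sum.inl b)) ∈ s} :=
    (show Measurable fun (R : ι ⊕ Unit → ι ⊕ Unit → ℝ) (a b : ι) => R (Sum.inl a) (Sum.inl b) by
      fun_prop) hs
  have hsm : ∀ {α : Type} (t : Set (α → α → ℝ)) (ht : MeasurableSet t) (ν : Measure (α → α → ℝ))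
      (a b : α), (ν.restrict t).map (fun R => R a b) S = ν {R | R ∈ t ∧ R a b ∈ S} := by
    intro α t ht ν a b
    have hm : Measurable fun R : α → α → ℝ => R a b := by fun_prop
    rw [Measure.map_apply hm hS, Measure.restrict_apply (hm hS), Set.inter_comm]
    rfl
  -- The diagonal term of the identity is moved to the left, so that both sides are moments of
  -- positive finite measures; the moments determine these measures.
  set ρ : Measure ℝ := (Fintype.card ι : ℝ≥0∞) • ((G.overlapArray P (ι ⊕ Unit)).restrict
      {R | (fun a b => R (Sum.inl a) (Sum.inl b)) ∈ s}).map
        (fun R => R (Sum.inl j) (Sum.inr ())) +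
    ((G.overlapArray P ι).restrict s).map (fun R => R j j) with hρ
  set τ : Measure ℝ := G.overlapArray P ι s •
      ((G.overlapArray P (Fin 2)).restrict Set.univ).map (fun R => R 0 1) +
    Finset.sum Finset.univ fun l => ((G.overlapArray P ι).restrict s).map fun R => R j l with hτ
  have hcard : (Fintype.card ι : ℝ≥0∞) ≠ ∞ := ENNReal.natCast_ne_top _
  have hf1 : IsFiniteMeasure ((Fintype.card ι : ℝ≥0∞) • ((G.overlapArray P (ι ⊕ Unit)).restrict
      {R | (fun a b => R (Sum.inl a) (Sum.inl b)) ∈ s}).map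
        (fun R => R (Sum.inl j) (Sum.inr ()))) := Measure.smul_finite _ hcard
  have hf2 : IsFiniteMeasure (G.overlapArray P ι s •
      ((G.overlapArray P (Fin 2)).restrict Set.univ).map (fun R => R 0 1)) :=
    Measure.smul_finite _ (measure_ne_top _ _)
  have key : ρ = τ := by
    refine ext_of_moments (fun u => ?_) (fun u => ?_) fun m => ?_
    · exact ((integrable_exp_map_restrict _ _ _ u).smul_measure hcard).add_measure
        (integrable_exp_map_restrict _ _ _ u)
    · exact ((integrable_exp_map_restrict _ _ _ u).smul_measure (measure_ne_top _ _)).add_measure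
        (integrable_finsetSum_measure.2 fun l _ => integrable_exp_map_restrict _ _ _ u)
    · rw [hρ, hτ, integral_add_measure ((integrable_pow_map_restrict _ _ _ m).smul_measure hcard)
        (integrable_pow_map_restrict _ _ _ m),
        integral_add_measure ((integrable_pow_map_restrict _ _ _ m).smul_measure
          (measure_ne_top _ _))
          (integrable_finsetSum_measure.2 fun l _ => integrable_pow_map_restrict _ _ _ m),
        integral_finsetSum_measure fun l _ => integrable_pow_map_restrict _ _ _ m,
        integral_smul_measure, integral_smul_measure, integral_pow_map_restrict hs',
        integral_pow_map_restrict MeasurableSet.univ]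
      simp only [integral_pow_map_restrict hs]
      have := h.replicaIdentity (IsTest.indicator hs) j m
      rw [ReplicaIdentity, integral_indicator_const _ hs] at this
      simp only [overlapMoment, smul_eq_mul, mul_one, ENNReal.toReal_natCast, Set.indicator_univ,
        one_mul, measureReal_def] at this ⊢
      have e : ∀ R : ι ⊕ Unit → ι ⊕ Unit → ℝ, {R : ι ⊕ Unit → ι ⊕ Unit → ℝ |
          (fun a b => R (Sum.inl a) (Sum.inl b)) ∈ s}.indicator (fun _ => (1 : ℝ)) R =
          s.indicator (fun _ => 1) fun a b => R (Sum.inl a) (Sum.inl b) := fun R => rfl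
      simp only [e]
      linarith
  have hk := congrArg (fun μ : Measure ℝ => (μ S).toReal) key
  simp only [hρ, hτ, Measure.add_apply, Measure.smul_apply, Measure.finsetSum_apply, smul_eq_mul,
    hsm _ hs, hsm _ hs', hsm _ MeasurableSet.univ, Set.mem_univ, true_and] at hk
  rw [ENNReal.toReal_add (ENNReal.mul_ne_top hcard (measure_ne_top _ _)) (measure_ne_top _ _),
    ENNReal.toReal_add (ENNReal.mul_ne_top (measure_ne_top _ _) (measure_ne_top _ _))
      (ENNReal.sum_ne_top.2 fun _ _ => measure_ne_top _ _),
    ENNReal.toReal_sum fun _ _ => measure_ne_top _ _, ENNReal.toReal_mul, ENNReal.toReal_mul,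
    ENNReal.toReal_natCast] at hk
  exact hk

end RandomAtomicMeasure
end SpinGlass

/-! ### The distribution of the overlap and its upper end point q* -/

namespace SpinGlass

namespace RandomAtomicMeasure

variable {Ω : Type*} [MeasurableSpace Ω] (G : RandomAtomicMeasure Ω) (P : Measure Ω)
  [IsProbabilityMeasure P] {ι κ : Type} [Fintype ι] [Fintype κ]

theorem overlapLaw_eq :
    G.overlapLaw P = (G.overlapArray P (Fin 2)).map fun R => R 0 1 := by
  have hv := G.isWeights_tiltedWeight P 0 0
  refine Measure.ext_of_lintegral _ fun F hF => ?_
  have hQ : ∀ l : ℕ × ℕ, Measurable fun ω => G.Q ω l.1 l.2 := fun l => G.measurable_Q l.1 l.2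
  have hw : ∀ l : ℕ × ℕ, Measurable fun ω => ENNReal.ofReal (G.w l.1 ω * G.w l.2 ω) := fun l =>
    ((G.measurable_w l.1).mul (G.measurable_w l.2)).ennreal_ofReal
  have hm : Measurable fun z : (Fin 2 → ℕ) × (Ω × (ℕ → ℝ)) => F (G.overlaps z 0 1) :=
    hF.comp (G.measurable_overlap 0 1)
  rw [overlapArray, Measure.map_map (measurable_coord 0 1) G.measurable_overlaps,
    lintegral_map hF ((measurable_coord 0 1).comp G.measurable_overlaps), tiltedRepl]
  refine Eq.trans ?_ (lintegral_repl hv.measurable hm).symm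
  rw [overlapLaw, lintegral_sum_measure, ← (finTwoArrowEquiv ℕ).symm.tsum_eq]
  refine tsum_congr fun l => ?_
  rw [lintegral_map hF (hQ l)]
  refine (lintegral_withDensity_eq_lintegral_mul P (hw l) (hF.comp (hQ l))).trans ?_
  have hm2 : Measurable fun ω => ENNReal.ofReal (G.w l.1 ω * G.w l.2 ω) * F (G.Q ω l.1 l.2) :=
    (hw l).mul (hF.comp (hQ l))
  refine ((measurePreserving_fst (μ := P) (ν := stdGaussianSeq)).lintegral_comp hm2).symm.trans ?_
  refine lintegral_congr fun x => ?_
  simp [tiltedWeight_zero, overlaps, ENNReal.ofReal_mul (G.w_nonneg _ _)]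

instance : IsProbabilityMeasure (G.overlapLaw P) := by
  rw [overlapLaw_eq]
  exact Measure.isProbabilityMeasure_map (measurable_coord 0 1).aemeasurable

theorem bddAbove_support : BddAbove (G.overlapLaw P).support := by
  refine ⟨1, fun x hx => ?_⟩
  refine Measure.support_subset_of_isClosed (t := Set.Iic 1) isClosed_Iic ?_ hx
  rw [overlapLaw_eq, mem_ae_map_iff (measurable_coord 0 1).aemeasurable measurableSet_Iic]
  exact (G.ae_overlapArray_abs_le P).mono fun R hR => (abs_le.1 (hR 0 1)).2

theorem nonempty_support : (G.overlapLaw P).support.Nonempty :=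
  Measure.nonempty_support (IsProbabilityMeasure.ne_zero _)

theorem ae_overlap_le_qStar : ∀ᵐ R ∂G.overlapArray P (Fin 2), R 0 1 ≤ G.qStar P := by
  have h : ∀ᵐ x ∂G.overlapLaw P, x ≤ G.qStar P := by
    filter_upwards [Measure.support_mem_ae (μ := G.overlapLaw P)] with x hx
    exact le_csSup (G.bddAbove_support P) hx
  rw [overlapLaw_eq] at h
  exact ae_of_ae_map (measurable_coord 0 1).aemeasurable h

theorem measure_overlap_lt_lt_one {s : ℝ} (hs : s < G.qStar P) :
    (G.overlapArray P (Fin 2)).real {R | R 0 1 ∈ Set.Iio s} < 1 := by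
  obtain ⟨x, hx, hsx⟩ := exists_lt_of_lt_csSup (G.nonempty_support P) hs
  have h := (Measure.mem_support_iff_forall x).1 hx _ (Ioi_mem_nhds hsx)
  rw [overlapLaw_eq, Measure.map_apply (measurable_coord 0 1) measurableSet_Ioi] at h
  refine lt_of_not_ge fun hge => ?_
  have hm : MeasurableSet {R : Fin 2 → Fin 2 → ℝ | R 0 1 ∈ Set.Iio s} :=
    measurable_coord 0 1 measurableSet_Iio
  have h0 : (G.overlapArray P (Fin 2)).real {R | R 0 1 ∈ Set.Iio s}ᶜ = 0 := by
    rw [probReal_compl_eq_one_sub hm]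
    linarith [measureReal_le_one (μ := G.overlapArray P (Fin 2))
      (s := {R | R 0 1 ∈ Set.Iio s})]
  rw [measureReal_eq_zero_iff] at h0
  refine h.ne' (measure_mono_null (fun R hR => ?_) h0)
  exact not_lt.2 (le_of_lt (show s < R 0 1 from hR))

/-- Properties of pairs of replicas are properties of pairs of atoms. -/
theorem ae_overlapArray_iff_atoms {s : (ι → ι → ℝ) → Prop} (hs : MeasurableSet {R | s R}) :
    (∀ᵐ R ∂G.overlapArray P ι, s R) ↔
      ∀ᵐ ω ∂P, ∀ l : ι → ℕ, (∀ i, 0 < G.w (l i) ω) → s fun i j => G.Q ω (l i) (l j) := by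
  have hm : MeasurableSet {z : (ι → ℕ) × (Ω × (ℕ → ℝ)) | s (G.overlaps z)} :=
    G.measurable_overlaps hs
  have hm2 : MeasurableSet {ω | ∀ l : ι → ℕ, (∀ i, 0 < G.w (l i) ω) →
      s fun i j => G.Q ω (l i) (l j)} := by
    simp only [Set.ofPred_forall]
    refine MeasurableSet.iInter fun l => ?_
    have h1 : MeasurableSet {ω | ∀ i, 0 < G.w (l i) ω} := by
      simp only [Set.ofPred_forall]
      exact MeasurableSet.iInter fun i => measurableSet_lt measurable_const (G.measurable_w (l i))
    have h2 : MeasurableSet {ω | s fun i j => G.Q ω (l i) (l j)} :=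
      (measurable_pi_iff.2 fun i => measurable_pi_iff.2 fun j => G.measurable_Q (l i) (l j)) hs
    exact h1.imp h2
  rw [G.ae_overlapArray_iff P hs, tiltedRepl,
    ae_repl_iff (G.isWeights_tiltedWeight P 0 0).measurable hm]
  simp only [tiltedWeight_zero]
  conv_rhs => rw [← (measurePreserving_fst (μ := P) (ν := stdGaussianSeq)).map_eq]
  rw [ae_map_iff measurable_fst.aemeasurable hm2]
  rfl

/-- The case l = l' matters: two replicas may fall on the same atom, so squared norms are overlaps
as well and are bounded by q*. -/
theorem ae_Q_le_qStar : ∀ᵐ ω ∂P, ∀ l l', 0 < G.w l ω → 0 < G.w l' ω → G.Q ω l l' ≤ G.qStar P := by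
  have hm : MeasurableSet {R : Fin 2 → Fin 2 → ℝ | R 0 1 ≤ G.qStar P} :=
    measurableSet_le (measurable_coord 0 1) measurable_const
  filter_upwards [(G.ae_overlapArray_iff_atoms P hm).1 (G.ae_overlap_le_qStar P)] with ω h l l' hl hl'
  exact h ![l, l'] fun i => by fin_cases i <;> assumption

theorem qStar_nonneg : 0 ≤ G.qStar P := by
  obtain ⟨ω, hω⟩ := (G.ae_Q_le_qStar P).exists
  exact (real_inner_self_nonneg (F := ℓ²(ℕ, ℝ))).trans
    (hω 0 0 (G.w_zero_pos ω) (G.w_zero_pos ω))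

theorem concentratedOnSphere_iff :
    G.ConcentratedOnSphere P ↔ ∀ᵐ ω ∂P, ∀ l, 0 < G.w l ω → G.Q ω l l = G.qStar P := by
  refine Filter.eventually_congr (ae_of_all _ fun ω => ?_)
  rw [toMeasure, Measure.ae_sum_iff']
  · refine forall_congr' fun l => ?_
    have hn : ‖G.ξ l ω‖ = √(G.qStar P) ↔ G.Q ω l l = G.qStar P := by
      rw [Q, Matrix.of_apply, real_inner_self_eq_norm_sq, eq_comm,
        Real.sqrt_eq_iff_eq_sq (G.qStar_nonneg P) (norm_nonneg _), eq_comm]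
    rw [← hn]
    by_cases hw : 0 < G.w l ω
    · simp only [hw, true_imp_iff]
      rw [Measure.ae_ennreal_smul_measure_iff (by simpa using hw), ae_dirac_iff]
      exact measurableSet_eq_fun measurable_norm measurable_const
    · simp [hw, ENNReal.ofReal_of_nonpos (not_lt.1 hw)]
  · exact measurableSet_eq_fun measurable_norm measurable_const

end RandomAtomicMeasure
end SpinGlass

/-! ### Concentration on the sphere -/

namespace SpinGlass

namespace RandomAtomicMeasure

variable {Ω : Type*} [MeasurableSpace Ω] {G : RandomAtomicMeasure Ω} {P : Measure Ω}
  [IsProbabilityMeasure P] {ι κ : Type} [Fintype ι] [Fintype κ]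

/-- The last replica of a family, singled out. -/
def splitLast (ι : Type) (m : ℕ) : ι ⊕ Fin (m + 1) → (ι ⊕ Fin m) ⊕ Unit :=
  Sum.elim (fun a => Sum.inl (Sum.inl a))
    (Fin.lastCases (Sum.inr ()) fun c => Sum.inl (Sum.inr c))

omit [Fintype ι] in
theorem splitLast_injective (m : ℕ) : Function.Injective (splitLast ι m) := by
  refine Function.Injective.sumElim (fun a b h => by simpa using h) (fun a b => ?_) fun a b => ?_
  · refine Fin.lastCases ?_ (fun a => ?_) a <;> refine Fin.lastCases ?_ (fun b => ?_) b <;> simp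
  · refine Fin.lastCases ?_ (fun b => ?_) b <;> simp

theorem measure_splitLast (m : ℕ) {s : Set (ι ⊕ Fin (m + 1) → ι ⊕ Fin (m + 1) → ℝ)}
    (hs : MeasurableSet s) :
    (G.overlapArray P (ι ⊕ Fin (m + 1))).real s = (G.overlapArray P ((ι ⊕ Fin m) ⊕ Unit)).real
      {R | (fun a b => R (splitLast ι m a) (splitLast ι m b)) ∈ s} := by
  rw [measureReal_def, measureReal_def, ← (G.measurePreserving_overlapArray P
    (splitLast_injective m)).measure_preimage hs.nullMeasurableSet]
  rfl

/-- 2 x·y ≤ ‖x‖² + ‖y‖² and ‖y‖² ≤ q*. -/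
theorem ae_le_half_add : ∀ᵐ R ∂G.overlapArray P ι, ∀ i j, R i j ≤ (R i i + G.qStar P) / 2 := by
  have hm : MeasurableSet {R : ι → ι → ℝ | ∀ i j, R i j ≤ (R i i + G.qStar P) / 2} := by
    simp only [Set.ofPred_forall]
    exact MeasurableSet.iInter fun i => MeasurableSet.iInter fun j =>
      measurableSet_le (by fun_prop) (by fun_prop)
  rw [G.ae_overlapArray_iff_atoms P hm]
  filter_upwards [G.ae_Q_le_qStar P] with ω hω l hl i j
  have h1 := hω _ _ (hl j) (hl j)
  have h2 : 0 ≤ ‖G.ξ (l i) ω - G.ξ (l j) ω‖ ^ 2 := sq_nonneg _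
  rw [@norm_sub_sq_real, ← real_inner_self_eq_norm_sq, ← real_inner_self_eq_norm_sq] at h2
  simp only [Q, Matrix.of_apply] at h1 ⊢
  linarith

/-- A replica of squared norm below s has all its overlaps below s' = (s + q*)/2. Let c_m be the
probability that its overlaps with m other replicas are all below s'. The identities give (m+1)
c_{m+1} = (m+α) c_m, where α = ℙ(R_{1,2} < s') < 1 by the choice of q*, so the lower bound ℙ(‖σ‖² <
s) for all c_m must vanish. -/
theorem GhirlandaGuerra.le_diag (h : G.GhirlandaGuerra P) {s : ℝ} (hs : s < G.qStar P) :
    ∀ᵐ R ∂G.overlapArray P Unit, s ≤ R () () := by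
  set s' := (s + G.qStar P) / 2 with hs'
  set α := (G.overlapArray P (Fin 2)).real {R | R 0 1 ∈ Set.Iio s'} with hα
  have hα1 : α < 1 := G.measure_overlap_lt_lt_one P (by rw [hs']; linarith)
  let B : ∀ m, Set (Unit ⊕ Fin m → Unit ⊕ Fin m → ℝ) := fun m =>
    {R | ∀ c, R (Sum.inl ()) (Sum.inr c) ∈ Set.Iio s'}
  have hB : ∀ m, MeasurableSet (B m) := fun m => by
    simp only [B, Set.ofPred_forall]
    exact MeasurableSet.iInter fun c => measurable_coord _ _ measurableSet_Iio
  have hD : MeasurableSet {R : Unit → Unit → ℝ | R () () < s} :=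
    measurableSet_lt (by fun_prop) measurable_const
  have key := nonpos_of_harmonic_decay (c := fun m => (G.overlapArray P (Unit ⊕ Fin m)).real (B m))
    (δ := (G.overlapArray P Unit).real {R | R () () < s}) (θ := 1 - α) (K := 1) (by linarith)
    one_pos (fun m => ?_) fun m => ?_
  · replace key := (measureReal_eq_zero_iff).1 (le_antisymm key measureReal_nonneg)
    filter_upwards [measure_eq_zero_iff_ae_notMem.1 key] with R hR
    exact not_lt.1 hR
  · rw [measureReal_def, ← (G.measurePreserving_overlapArray P
      (Sum.inl_injective (β := Fin m))).measure_preimage hD.nullMeasurableSet]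
    refine ENNReal.toReal_mono (measure_ne_top _ _) (measure_mono_ae ?_)
    filter_upwards [ae_le_half_add (G := G) (P := P) (ι := Unit ⊕ Fin m)] with R hR hRs c
    have h1 : R (Sum.inl ()) (Sum.inl ()) < s := hRs
    exact (hR _ _).trans_lt (by rw [hs']; linarith)
  · have hGG := h.measure_eq (hB m) (Sum.inl ()) (S := Set.Iio s') measurableSet_Iio
    have e1 : {R : (Unit ⊕ Fin m) ⊕ Unit → (Unit ⊕ Fin m) ⊕ Unit → ℝ |
        (fun a b => R (Sum.inl a) (Sum.inl b)) ∈ B m ∧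
          R (Sum.inl (Sum.inl ())) (Sum.inr ()) ∈ Set.Iio s'} =
        {R | (fun a b => R (splitLast Unit m a) (splitLast Unit m b)) ∈ B (m + 1)} := by
      ext R
      simp only [B, Set.mem_ofPred_eq, Fin.forall_fin_succ', splitLast, Sum.elim_inl, Sum.elim_inr,
        Fin.lastCases_castSucc, Fin.lastCases_last]
    have e2 : ∀ c : Fin m, {R | R ∈ B m ∧ R (Sum.inl ()) (Sum.inr c) ∈ Set.Iio s'} = B m :=
      fun c => Set.ext fun R => ⟨fun h => h.1, fun h => ⟨h, h c⟩⟩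
    rw [e1, ← measure_splitLast m (hB (m + 1)), Fintype.sum_sum_type] at hGG
    simp only [e2, Finset.univ_unique, Finset.sum_singleton, Finset.sum_const, Finset.card_univ,
      Fintype.card_fin, nsmul_eq_mul, Fintype.card_sum, Fintype.card_unit, PUnit.default_eq_unit,
      Nat.cast_add, Nat.cast_one, ← hα] at hGG
    linarith

/-- The Ghirlanda-Guerra identities force the measure to live on a sphere. -/
theorem GhirlandaGuerra.concentratedOnSphere (h : G.GhirlandaGuerra P) :
    G.ConcentratedOnSphere P := by
  rw [concentratedOnSphere_iff]
  have hm : ∀ s : ℝ, MeasurableSet {R : Unit → Unit → ℝ | s ≤ R () ()} := fun s =>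
    measurableSet_le measurable_const (by fun_prop)
  have h1 : ∀ n : ℕ, ∀ᵐ ω ∂P, ∀ l, 0 < G.w l ω → G.qStar P - 1 / ((n : ℝ) + 1) ≤ G.Q ω l l := by
    intro n
    have := h.le_diag (s := G.qStar P - 1 / ((n : ℝ) + 1)) (sub_lt_self _ (by positivity))
    filter_upwards [(G.ae_overlapArray_iff_atoms P (hm _)).1 this] with ω hω l hl
    exact hω (fun _ => l) fun _ => hl
  filter_upwards [ae_all_iff.2 h1, G.ae_Q_le_qStar P] with ω h1 h2 l hl
  refine le_antisymm (h2 l l hl hl) ?_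
  refine le_of_tendsto' (x := Filter.atTop) (f := fun n : ℕ => G.qStar P - 1 / ((n : ℝ) + 1)) ?_ fun n => h1 n l hl
  simpa using tendsto_one_div_add_atTop_nhds_zero_nat.const_sub (G.qStar P)

/-- For points x, y of the sphere, ‖x - y‖² = 2q* - 2 x·y. Hence the overlap alone tells whether two
replicas sit on the same atom. -/
theorem ConcentratedOnSphere.ae_Q_eq_iff (h : G.ConcentratedOnSphere P) :
    ∀ᵐ ω ∂P, ∀ l l', 0 < G.w l ω → 0 < G.w l' ω → (G.Q ω l l' = G.qStar P ↔ l = l') := by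
  filter_upwards [(G.concentratedOnSphere_iff P).1 h] with ω hω l l' hl hl'
  refine ⟨fun hQ => ?_, fun hll => hll ▸ hω l hl⟩
  by_contra hne
  refine G.ξ_ne ω l l' hne hl hl' ?_
  have h1 := hω l hl
  have h2 := hω l' hl'
  simp only [Q, Matrix.of_apply] at h1 h2 hQ
  rw [← sub_eq_zero, ← norm_eq_zero, ← sq_eq_zero_iff, @norm_sub_sq_real,
    ← real_inner_self_eq_norm_sq, ← real_inner_self_eq_norm_sq]
  linarith

theorem ConcentratedOnSphere.ae_diag (h : G.ConcentratedOnSphere P) :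
    ∀ᵐ R ∂G.overlapArray P ι, ∀ i, R i i = G.qStar P := by
  have hm : MeasurableSet {R : ι → ι → ℝ | ∀ i, R i i = G.qStar P} := by
    simp only [Set.ofPred_forall]
    exact MeasurableSet.iInter fun i => measurableSet_eq_fun (measurable_coord i i) measurable_const
  rw [G.ae_overlapArray_iff_atoms P hm]
  filter_upwards [(G.concentratedOnSphere_iff P).1 h] with ω hω l hl i
  exact hω _ (hl i)

theorem ConcentratedOnSphere.ae_overlap_trans (h : G.ConcentratedOnSphere P) :
    ∀ᵐ R ∂G.overlapArray P ι, ∀ i j k, R i k = G.qStar P → R j k = G.qStar P →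
      R i j = G.qStar P := by
  have hm : MeasurableSet {R : ι → ι → ℝ | ∀ i j k, R i k = G.qStar P → R j k = G.qStar P →
      R i j = G.qStar P} := by
    have hc : ∀ i j, MeasurableSet {R : ι → ι → ℝ | R i j = G.qStar P} := fun i j =>
      measurableSet_eq_fun (measurable_coord i j) measurable_const
    simp only [Set.ofPred_forall]
    exact MeasurableSet.iInter fun i => MeasurableSet.iInter fun j => MeasurableSet.iInter fun k =>
      (hc i k).imp ((hc j k).imp (hc i j))
  rw [G.ae_overlapArray_iff_atoms P hm]
  filter_upwards [h.ae_Q_eq_iff] with ω hω l hl i j k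
  rw [hω _ _ (hl i) (hl k), hω _ _ (hl j) (hl k), hω _ _ (hl i) (hl j)]
  exact fun h1 h2 => h1.trans h2.symm

end RandomAtomicMeasure
end SpinGlass

/-! ### Infinitely many atoms -/

namespace SpinGlass

namespace RandomAtomicMeasure

variable {Ω : Type*} [MeasurableSpace Ω] {G : RandomAtomicMeasure Ω} {P : Measure Ω}
  [IsProbabilityMeasure P] {ι κ : Type} [Fintype ι] [Fintype κ]

omit [IsProbabilityMeasure P] in
theorem ae_of_ae_prod {s : Ω → Prop} (hs : MeasurableSet {ω | s ω})
    (h : ∀ᵐ x ∂P.prod stdGaussianSeq, s x.1) : ∀ᵐ ω ∂P, s ω := by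
  rw [← (measurePreserving_fst (μ := P) (ν := stdGaussianSeq)).map_eq,
    ae_map_iff measurable_fst.aemeasurable hs]
  exact h

/-- The replicas `K` are different, and every other replica coincides with one of them. -/
def clusterSet (q : ℝ) (K m : ℕ) : Set (Fin K ⊕ Fin m → Fin K ⊕ Fin m → ℝ) :=
  {R | (∀ a b, a ≠ b → R (Sum.inl a) (Sum.inl b) ≠ q) ∧ ∀ c, ∃ a, R (Sum.inl a) (Sum.inr c) = q}

theorem measurableSet_clusterSet (q : ℝ) (K m : ℕ) : MeasurableSet (clusterSet q K m) := by
  have hc : ∀ i j, MeasurableSet {R : Fin K ⊕ Fin m → Fin K ⊕ Fin m → ℝ | R i j = q} := fun i j =>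
    measurableSet_eq_fun (measurable_coord i j) measurable_const
  have h1 : MeasurableSet {R : Fin K ⊕ Fin m → Fin K ⊕ Fin m → ℝ |
      ∀ a b, a ≠ b → R (Sum.inl a) (Sum.inl b) ≠ q} := by
    simp only [Set.ofPred_forall]
    exact MeasurableSet.iInter fun a => MeasurableSet.iInter fun b => MeasurableSet.iInter fun _ =>
      (hc _ _).compl
  have h2 : MeasurableSet {R : Fin K ⊕ Fin m → Fin K ⊕ Fin m → ℝ |
      ∀ c, ∃ a, R (Sum.inl a) (Sum.inr c) = q} := by
    simp only [Set.ofPred_forall, Set.ofPred_exists]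
    exact MeasurableSet.iInter fun c => MeasurableSet.iUnion fun a => hc _ _
  exact h1.inter h2

/-- A new replica must join one of the `K` clusters. The identity is applied to each cluster
representative `a` and summed over `a`: the other representatives contribute nothing, and each of
the `m` old replicas is counted at most once because it lies in a single cluster. -/
theorem GhirlandaGuerra.measure_clusterSet_succ (h : G.GhirlandaGuerra P) (K m : ℕ) :
    ((m : ℝ) + K) * (G.overlapArray P (Fin K ⊕ Fin (m + 1))).real
        (clusterSet (G.qStar P) K (m + 1)) ≤
      (m + K - K * (1 - (G.overlapArray P (Fin 2)).real {R | R 0 1 ∈ ({G.qStar P} : Set ℝ)})) *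
        (G.overlapArray P (Fin K ⊕ Fin m)).real (clusterSet (G.qStar P) K m) := by
  classical
  set q := G.qStar P with hq
  set α := (G.overlapArray P (Fin 2)).real {R | R 0 1 ∈ ({q} : Set ℝ)} with hα
  set B := clusterSet q K m with hB
  set ν := G.overlapArray P (Fin K ⊕ Fin m) with hν
  have hBm := measurableSet_clusterSet q K m
  set x : Fin K → ℝ := fun a => (G.overlapArray P ((Fin K ⊕ Fin m) ⊕ Unit)).real
    {R | (fun a b => R (Sum.inl a) (Sum.inl b)) ∈ B ∧
      R (Sum.inl (Sum.inl a)) (Sum.inr ()) ∈ ({q} : Set ℝ)} with hx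
  have hle : (G.overlapArray P (Fin K ⊕ Fin (m + 1))).real (clusterSet q K (m + 1)) ≤ ∑ a, x a := by
    rw [measure_splitLast m (measurableSet_clusterSet q K (m + 1))]
    refine le_trans (measureReal_mono ?_ (measure_ne_top _ _)) (measureReal_iUnion_fintype_le _)
    intro R hR
    obtain ⟨h1, h2⟩ := hR
    simp only [splitLast, Fin.forall_fin_succ', Sum.elim_inl, Sum.elim_inr,
      Fin.lastCases_castSucc, Fin.lastCases_last] at h1 h2
    obtain ⟨a, ha⟩ := h2.2
    exact Set.mem_iUnion.2 ⟨a, ⟨h1, h2.1⟩, ha⟩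
  have hx2 : ∀ a, ((m : ℝ) + K) * x a =
      ν.real B * α + ∑ c, ν.real {R | R ∈ B ∧ R (Sum.inl a) (Sum.inr c) ∈ ({q} : Set ℝ)} := by
    intro a
    have hGG := h.measure_eq hBm (Sum.inl a) (measurableSet_singleton q)
    have h0 : ∀ b, b ≠ a →
        ν.real {R | R ∈ B ∧ R (Sum.inl a) (Sum.inl b) ∈ ({q} : Set ℝ)} = 0 := by
      intro b hb
      rw [← measureReal_empty (μ := ν)]
      congr 1
      ext R
      exact iff_of_false (fun hR => hR.1.1 a b hb.symm hR.2) (fun h => h)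
    rw [Fintype.sum_sum_type, Finset.sum_eq_single a (fun b _ hb => h0 b hb) (by simp)] at hGG
    simp only [Fintype.card_sum, Fintype.card_fin, Nat.cast_add] at hGG
    linarith
  have hdisj : ∀ c, ∑ a, ν.real {R | R ∈ B ∧ R (Sum.inl a) (Sum.inr c) ∈ ({q} : Set ℝ)} ≤
      ν.real B := by
    intro c
    have hms : ∀ a, MeasurableSet {R | R ∈ B ∧ R (Sum.inl a) (Sum.inr c) ∈ ({q} : Set ℝ)} :=
      fun a => hBm.inter (measurable_coord _ _ (measurableSet_singleton q))
    have h1 := tsum_meas_le_meas_iUnion_of_disjoint₀ ν (fun a => (hms a).nullMeasurableSet)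
      fun a b hab => (by
        refine measure_mono_null ?_ (ae_iff.1
          (h.concentratedOnSphere.ae_overlap_trans (ι := Fin K ⊕ Fin m)))
        intro R hR hcon
        exact hR.1.1.1 a b hab (hcon _ _ _ hR.1.2 hR.2.2))
    rw [tsum_fintype] at h1
    simp only [measureReal_def]
    rw [← ENNReal.toReal_sum fun a _ => measure_ne_top _ _]
    exact ENNReal.toReal_mono (measure_ne_top _ _)
      (h1.trans (measure_mono (Set.iUnion_subset fun a R hR => hR.1)))
  have hsum : ((m : ℝ) + K) * ∑ a, x a ≤ K * (ν.real B * α) + m * ν.real B := by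
    rw [Finset.mul_sum, Finset.sum_congr rfl fun a _ => hx2 a, Finset.sum_add_distrib,
      Finset.sum_const, Finset.card_univ, Fintype.card_fin, nsmul_eq_mul, Finset.sum_comm]
    have := Finset.sum_le_sum fun c (_ : c ∈ Finset.univ) => hdisj c
    rw [Finset.sum_const, Finset.card_univ, Fintype.card_fin, nsmul_eq_mul] at this
    linarith
  have := mul_le_mul_of_nonneg_left hle (by positivity : 0 ≤ (m : ℝ) + K)
  linarith

/-- If two replicas may differ, then there are infinitely many atoms. -/
theorem GhirlandaGuerra.ae_w_pos (h : G.GhirlandaGuerra P)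
    (ha : (G.overlapArray P (Fin 2)).real {R | R 0 1 ∈ ({G.qStar P} : Set ℝ)} < 1) :
    ∀ᵐ ω ∂P, ∀ l, 0 < G.w l ω := by
  suffices hstep : ∀ k : ℕ, ∀ᵐ ω ∂P, 0 < G.w k ω → 0 < G.w (k + 1) ω by
    filter_upwards [ae_all_iff.2 hstep] with ω hω l
    induction l with
    | zero => exact G.w_zero_pos ω
    | succ l ih => exact hω l ih
  intro k
  set q := G.qStar P with hq
  have hv := G.isWeights_tiltedWeight P 0 0
  have hwm : ∀ l, MeasurableSet {ω | 0 < G.w l ω} := fun l =>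
    measurableSet_lt measurable_const (G.measurable_w l)
  have hDm : MeasurableSet {z : (Fin (k + 1) → ℕ) × (Ω × (ℕ → ℝ)) |
      (∀ a, z.1 a = a) ∧ 0 < G.w k z.2.1 ∧ ¬ 0 < G.w (k + 1) z.2.1} := by
    have h1 : MeasurableSet {z : (Fin (k + 1) → ℕ) × (Ω × (ℕ → ℝ)) | ∀ a, z.1 a = a} := by
      simp only [Set.ofPred_forall]
      exact MeasurableSet.iInter fun a => measurableSet_eq_fun
        ((measurable_pi_apply a).comp measurable_fst) measurable_const
    refine h1.inter ?_
    exact (measurable_fst.comp measurable_snd) ((hwm k).inter (hwm (k + 1)).compl)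
  set D : Set ((Fin (k + 1) → ℕ) × (Ω × (ℕ → ℝ))) :=
    {z | (∀ a, z.1 a = a) ∧ 0 < G.w k z.2.1 ∧ ¬ 0 < G.w (k + 1) z.2.1} with hD
  -- If exactly k+1 atoms have positive weight and the first replicas occupy all of them, every
  -- later replica repeats one of these. This bounds the cluster probability below for all `m`.
  have hδ : ∀ m, (G.tiltedRepl P 0 0 (Fin (k + 1))).real D ≤
      (G.overlapArray P (Fin (k + 1) ⊕ Fin m)).real (clusterSet q (k + 1) m) := by
    intro m
    have hmp := G.measurePreserving_restr P (ι := Fin (k + 1)) 0 0 (Fin m)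
    rw [measureReal_def, ← hmp.measure_preimage hDm.nullMeasurableSet, measureReal_def, overlapArray,
      Measure.map_apply G.measurable_overlaps (measurableSet_clusterSet q _ m)]
    refine ENNReal.toReal_mono (measure_ne_top _ _) (measure_mono_ae ?_)
    have hpm : MeasurableSet {z : (Fin (k + 1) ⊕ Fin m → ℕ) × (Ω × (ℕ → ℝ)) |
        z ∈ restr ⁻¹' D → z ∈ G.overlaps ⁻¹' clusterSet q (k + 1) m} :=
      (hmp.measurable hDm).imp (G.measurable_overlaps (measurableSet_clusterSet q _ m))
    refine (ae_repl_iff hv.measurable hpm).2 ?_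
    filter_upwards [(measurePreserving_fst (μ := P) (ν := stdGaussianSeq)).quasiMeasurePreserving.ae
      h.concentratedOnSphere.ae_Q_eq_iff] with x hx l hl hlD
    simp only [tiltedWeight_zero] at hl
    obtain ⟨hl1, -, hl3⟩ := hlD
    have hl1' : ∀ a : Fin (k + 1), l (Sum.inl a) = a := hl1
    refine ⟨fun a b hab hQ => hab ?_, fun c => ?_⟩
    · have := (hx _ _ (hl _) (hl _)).1 hQ
      rw [hl1' a, hl1' b] at this
      exact Fin.ext this
    · have hc : l (Sum.inr c) < k + 1 := by
        by_contra! hcon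
        exact hl3 ((hl (Sum.inr c)).trans_le (G.w_antitone x.1 hcon))
      refine ⟨⟨l (Sum.inr c), hc⟩, (hx _ _ (hl _) (hl _)).2 ?_⟩
      exact hl1' _
  have key := nonpos_of_harmonic_decay
    (c := fun m => (G.overlapArray P (Fin (k + 1) ⊕ Fin m)).real (clusterSet q (k + 1) m))
    (K := ((k + 1 : ℕ) : ℝ)) (mul_pos (by positivity) (sub_pos.2 ha)) (by positivity) hδ
    fun m => h.measure_clusterSet_succ (k + 1) m
  have h0 := measure_eq_zero_iff_ae_notMem.1
    ((measureReal_eq_zero_iff).1 (le_antisymm key measureReal_nonneg))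
  refine ae_of_ae_prod ((hwm k).imp (hwm (k + 1))) ?_
  filter_upwards [(ae_repl_iff hv.measurable hDm.compl).1 h0] with x hx hk
  by_contra hcon
  refine hx (fun a => a) (fun a => ?_) ⟨fun _ => rfl, hk, hcon⟩
  rw [tiltedWeight_zero]
  exact hk.trans_le (G.w_antitone x.1 (Nat.lt_succ_iff.1 a.2))

end RandomAtomicMeasure
end SpinGlass

/-! ### Moments of the shifted field under the tilted average -/

namespace SpinGlass

/-- The moments of the centered Gaussian law of variance `V`. -/
def gaussianMoment (V : ℝ) : ℕ → ℝ
  | 0 => 1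
  | 1 => 0
  | m + 2 => (m + 1) * V * gaussianMoment V m

theorem gaussianMoment_succ (V : ℝ) (m : ℕ) :
    gaussianMoment V (m + 1) = m * V * gaussianMoment V (m - 1) := by
  cases m with
  | zero => simp [gaussianMoment]
  | succ m => simp [gaussianMoment]

/-- The variance of a linear combination of the field. -/
def combVar {ι : Type} [Fintype ι] (p : ℕ) (lam : ι → ℝ) (R : ι → ι → ℝ) : ℝ :=
  ∑ k, lam k * ∑ i, lam i * R k i ^ p

theorem isTest_combVar {ι : Type} [Fintype ι] (p : ℕ) (lam : ι → ℝ) : IsTest (combVar p lam) :=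
  IsTest.sum _ fun k => (IsTest.const _).mul
    (IsTest.sum _ fun i => (IsTest.const _).mul ((IsTest.coord k i).pow p))

theorem isTest_gaussianMoment {ι : Type} [Fintype ι] (p : ℕ) (lam : ι → ℝ) (m : ℕ) :
    IsTest fun R => gaussianMoment (combVar p lam R) m := by
  induction m using Nat.twoStepInduction with
  | zero => exact IsTest.const 1
  | one => exact IsTest.const 0
  | more m ih _ => exact ((IsTest.const _).mul (isTest_combVar p lam)).mul ih

namespace RandomAtomicMeasure

variable {Ω : Type*} [MeasurableSpace Ω] {G : RandomAtomicMeasure Ω} {P : Measure Ω}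
  [IsProbabilityMeasure P] {ι : Type} [Fintype ι]

theorem IsTest.integrable_mul_comb_pow {f : (ι → ι → ℝ) → ℝ} (hf : IsTest f) (p : ℕ) (t : ℝ)
    (lam : ι → ℝ) (c : ℝ) (m : ℕ) :
    Integrable (fun z => f (G.overlaps z) * G.comb p lam c z ^ m) (G.tiltedRepl P p t ι) := by
  obtain ⟨B, hB⟩ := hf.bounded
  exact G.integrable_bdd_mul_comb_pow P (hf.measurable.comp G.measurable_overlaps).aestronglyMeasurable
    (ae_of_all _ fun z => hB _ (G.abs_overlaps_le z)) _ _ _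

theorem comb_restr (p : ℕ) (lam : ι → ℝ) (c : ℝ) (z : (ι ⊕ Unit → ℕ) × (Ω × (ℕ → ℝ))) :
    G.comb p lam c (restr z) = G.comb p (Sum.elim lam 0) c z := by
  simp [comb, restr]

theorem combVar_restr (p : ℕ) (lam : ι → ℝ) (R : ι ⊕ Unit → ι ⊕ Unit → ℝ) :
    combVar p (Sum.elim lam 0) R = combVar p lam fun a b => R (Sum.inl a) (Sum.inl b) := by
  simp [combVar]

/-- The step from one moment to the next, by Gaussian integration by parts. -/
theorem integral_comb_pow_succ {f : (ι → ι → ℝ) → ℝ} (hf : IsTest f) (p : ℕ) (t : ℝ)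
    (lam : ι → ℝ) (c : ℝ) (m : ℕ) :
    ∫ z, f (G.overlaps z) * G.comb p lam c z ^ (m + 1) ∂G.tiltedRepl P p t ι =
      ∑ k, lam k * (m * ∑ i, lam i * ∫ z, f (G.overlaps z) * G.overlaps z k i ^ p *
          G.comb p lam c z ^ (m - 1) ∂G.tiltedRepl P p t ι +
        t * (∑ i, ∫ z, f (G.overlaps z) * G.overlaps z k i ^ p * G.comb p lam c z ^ m
            ∂G.tiltedRepl P p t ι -
          Fintype.card ι * ∫ z, f (fun a b => G.overlaps z (Sum.inl a) (Sum.inl b)) *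
            G.overlaps z (Sum.inl k) (Sum.inr ()) ^ p * G.comb p (Sum.elim lam 0) c z ^ m
            ∂G.tiltedRepl P p t (ι ⊕ Unit)) -
        c * ∫ z, f (G.overlaps z) * G.comb p lam c z ^ m ∂G.tiltedRepl P p t ι) := by
  obtain ⟨B, hB⟩ := hf.bounded
  have hi := IsTest.integrable_mul_comb_pow (G := G) (P := P) hf p t lam c m
  have hg : ∀ k, Integrable (fun z => f (G.overlaps z) *
      (G.comb p lam c z ^ m * G.field p z.2 (z.1 k))) (G.tiltedRepl P p t ι) := fun k =>
    (G.integrable_comb_pow_mul_field P p t lam c m k).bdd_mul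
      (hf.measurable.comp G.measurable_overlaps).aestronglyMeasurable
      (ae_of_all _ fun z => hB _ (G.abs_overlaps_le z))
  have hnew : ∀ k, ∫ z, f (G.overlaps z) * G.meanCov p t k z * G.comb p lam c z ^ m
      ∂G.tiltedRepl P p t ι = ∫ z, f (fun a b => G.overlaps z (Sum.inl a) (Sum.inl b)) *
            G.overlaps z (Sum.inl k) (Sum.inr ()) ^ p * G.comb p (Sum.elim lam 0) c z ^ m
            ∂G.tiltedRepl P p t (ι ⊕ Unit) := fun k => by
    have h := G.integral_mul_meanCov P hi k
    simp only [comb_restr] at h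
    refine Eq.trans ?_ (h.trans ?_) <;> refine integral_congr_ae (ae_of_all _ fun z => ?_)
    · exact mul_right_comm _ _ _
    · exact mul_right_comm _ _ _
  have hexp : ∀ z, f (G.overlaps z) * G.comb p lam c z ^ (m + 1) =
      ∑ k, lam k * (f (G.overlaps z) * (G.comb p lam c z ^ m * G.field p z.2 (z.1 k)) -
        c * (f (G.overlaps z) * G.comb p lam c z ^ m)) := fun z => by
    rw [pow_succ, ← mul_assoc, comb, Finset.mul_sum]
    exact Finset.sum_congr rfl fun k _ => by ring
  have hd : ∀ k, Integrable (fun z => f (G.overlaps z) * (G.comb p lam c z ^ m *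
      G.field p z.2 (z.1 k)) - c * (f (G.overlaps z) * G.comb p lam c z ^ m))
      (G.tiltedRepl P p t ι) := fun k => (hg k).sub (hi.const_mul c)
  simp only [hexp]
  rw [integral_finsetSum _ fun k _ => (hd k).const_mul (lam k)]
  refine Finset.sum_congr rfl fun k _ => ?_
  rw [integral_const_mul, integral_sub (hg k) (hi.const_mul c), integral_const_mul,
    G.integral_comb_pow_mul_field P hf.measurable hB, hnew]

/-- Integration by parts lowers the degree, and what is left after the cancellation of the terms in
`t` is the recursion of Gaussian moments. The family `ι` is quantified inside the induction since
each step adds a replica. -/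
theorem integral_comb_pow (hGG : G.GhirlandaGuerra P) (hAC : G.AizenmanContucci P) {p : ℕ}
    (hp : 1 ≤ p) (t : ℝ) (m : ℕ) : ∀ (ι : Type) [Fintype ι] (lam : ι → ℝ) (f : (ι → ι → ℝ) → ℝ),
      IsTest f → ∫ z, f (G.overlaps z) * G.comb p lam (G.b P p * t) z ^ m ∂G.tiltedRepl P p t ι =
        ∫ R, f R * gaussianMoment (combVar p lam R) m ∂G.overlapArray P ι := by
  induction m using Nat.strong_induction_on with
  | _ m ih =>
    intro ι _ lam f hf
    cases m with
    | zero =>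
      simp only [pow_zero, gaussianMoment, mul_one]
      rw [← hAC.map_overlaps hp t]
      exact (integral_map G.measurable_overlaps.aemeasurable
        hf.measurable.aestronglyMeasurable).symm
    | succ m =>
      have hH := isTest_gaussianMoment p lam m
      have hH' := isTest_gaussianMoment p lam (m - 1)
      have h1 : ∀ k i, (m : ℝ) * ∫ z, f (G.overlaps z) * G.overlaps z k i ^ p *
          G.comb p lam (G.b P p * t) z ^ (m - 1) ∂G.tiltedRepl P p t ι =
          m * ∫ R, f R * R k i ^ p * gaussianMoment (combVar p lam R) (m - 1)
            ∂G.overlapArray P ι := fun k i => by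
        rw [ih (m - 1) (by omega) ι lam _ (hf.mul ((IsTest.coord k i).pow p))]
      have h2 : ∀ k i, ∫ z, f (G.overlaps z) * G.overlaps z k i ^ p *
          G.comb p lam (G.b P p * t) z ^ m ∂G.tiltedRepl P p t ι =
          ∫ R, f R * R k i ^ p * gaussianMoment (combVar p lam R) m
            ∂G.overlapArray P ι := fun k i =>
        ih m (by omega) ι lam _ (hf.mul ((IsTest.coord k i).pow p))
      have h3 : ∀ k, ∫ z, f (fun a b => G.overlaps z (Sum.inl a) (Sum.inl b)) *
            G.overlaps z (Sum.inl k) (Sum.inr ()) ^ p *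
            G.comb p (Sum.elim lam 0) (G.b P p * t) z ^ m ∂G.tiltedRepl P p t (ι ⊕ Unit) =
          ∫ R, f (fun a b => R (Sum.inl a) (Sum.inl b)) *
            R (Sum.inl k) (Sum.inr ()) ^ p * gaussianMoment (combVar p (Sum.elim lam 0) R) m
            ∂G.overlapArray P (ι ⊕ Unit) := fun k =>
        -- The new replica enters through an overlap only, so its coefficient in the combination is
        -- zero.
        ih m (by omega) (ι ⊕ Unit) (Sum.elim lam 0) _
          (isTest_comp_mul_pow hf Sum.inl (Sum.inl k) (Sum.inr ()) p)
      have h4 := ih m (by omega) ι lam f hf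
      rw [integral_comb_pow_succ hf]
      simp only [h2, h3, h4, combVar_restr]
      -- The Ghirlanda–Guerra identity with R_{k,k} = q* leaves b_p times the average, so the drift
      -- of the tilt is cancelled exactly by the shift b_p t.
      have h5 : ∀ k, (Fintype.card ι : ℝ) * ∫ R, f (fun a b => R (Sum.inl a) (Sum.inl b)) *
          R (Sum.inl k) (Sum.inr ()) ^ p *
            gaussianMoment (combVar p lam fun a b => R (Sum.inl a) (Sum.inl b)) m
            ∂G.overlapArray P (ι ⊕ Unit) =
          ∑ i, ∫ R, f R * R k i ^ p * gaussianMoment (combVar p lam R) m ∂G.overlapArray P ι -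
            G.b P p * ∫ R, f R * gaussianMoment (combVar p lam R) m ∂G.overlapArray P ι := by
        intro k
        have h := hGG.replicaIdentity (hf.mul hH) k p
        rw [ReplicaIdentity] at h
        have hd : ∫ R, f R * gaussianMoment (combVar p lam R) m * R k k ^ p ∂G.overlapArray P ι =
            G.qStar P ^ p * ∫ R, f R * gaussianMoment (combVar p lam R) m ∂G.overlapArray P ι := by
          rw [← integral_const_mul]
          refine integral_congr_ae ?_
          filter_upwards [hGG.concentratedOnSphere.ae_diag (ι := ι)] with R hR
          rw [hR k, mul_comm]
        rw [hd] at h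
        simp only [mul_right_comm _ (gaussianMoment _ m)] at h
        rw [h, b_eq]
        ring
      simp only [h5]
      have h6 : ∀ k, (m : ℝ) * ∑ i, lam i * ∫ z, f (G.overlaps z) * G.overlaps z k i ^ p *
          G.comb p lam (G.b P p * t) z ^ (m - 1) ∂G.tiltedRepl P p t ι =
          ∑ i, lam i * (m * ∫ R, f R * R k i ^ p * gaussianMoment (combVar p lam R) (m - 1)
            ∂G.overlapArray P ι) := fun k => by
        rw [Finset.mul_sum]
        exact Finset.sum_congr rfl fun i _ => by rw [← h1, mul_left_comm]
      simp only [h6]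
      have h7 : ∀ R : ι → ι → ℝ, f R * gaussianMoment (combVar p lam R) (m + 1) =
          ∑ k, lam k * ∑ i, lam i * (m * (f R * R k i ^ p *
            gaussianMoment (combVar p lam R) (m - 1))) := fun R => by
        rw [gaussianMoment_succ]
        nth_rw 1 [combVar]
        simp only [Finset.mul_sum, Finset.sum_mul]
        exact Finset.sum_congr rfl fun k _ => Finset.sum_congr rfl fun i _ => by ring
      simp only [h7]
      have h8 : ∀ k i, Integrable (fun R => (m : ℝ) * (f R * R k i ^ p *
            gaussianMoment (combVar p lam R) (m - 1))) (G.overlapArray P ι) := fun k i =>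
        (IsTest.integrable G P ((hf.mul ((IsTest.coord k i).pow p)).mul hH')).const_mul _
      rw [integral_finsetSum _ fun k _ => (integrable_finsetSum _ fun i _ =>
        (h8 k i).const_mul (lam i)).const_mul (lam k)]
      refine Finset.sum_congr rfl fun k _ => ?_
      rw [integral_const_mul, integral_finsetSum _ fun i _ => (h8 k i).const_mul (lam i)]
      simp only [integral_const_mul]
      ring

end RandomAtomicMeasure
end SpinGlass

/-! ### Equality of the tilted and untilted replica laws -/

namespace SpinGlass

namespace RandomAtomicMeasure

variable {Ω : Type*} [MeasurableSpace Ω] {G : RandomAtomicMeasure Ω} {P : Measure Ω}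
  [IsProbabilityMeasure P] {ι : Type} [Fintype ι]

variable (G) in
/-- The shifted field at the replicas. -/
def marks (p : ℕ) (c : ℝ) (z : (ι → ℕ) × (Ω × (ℕ → ℝ))) (i : ι) : ℝ := G.field p z.2 (z.1 i) - c

omit [Fintype ι] in
theorem measurable_marks [Finite ι] (p : ℕ) (c : ℝ) : Measurable (G.marks (ι := ι) p c) :=
  measurable_of_countable_fst fun l => measurable_pi_iff.2 fun i =>
    (G.measurable_field p (l i)).sub_const c

/-- The moments computed in `integral_comb_pow` do not involve `t`, so they may be compared with the
case t = 0; exponential moments make them determine the law. -/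
theorem map_comb_restrict_eq (hGG : G.GhirlandaGuerra P) (hAC : G.AizenmanContucci P) {p : ℕ}
    (hp : 1 ≤ p) (t : ℝ) (lam : ι → ℝ) {A : Set (ι → ι → ℝ)} (hA : MeasurableSet A) :
    ((G.tiltedRepl P p t ι).restrict (G.overlaps ⁻¹' A)).map (G.comb p lam (G.b P p * t)) =
      ((G.tiltedRepl P p 0 ι).restrict (G.overlaps ⁻¹' A)).map (G.comb p lam 0) := by
  have hA' : MeasurableSet (G.overlaps ⁻¹' A : Set ((ι → ℕ) × (Ω × (ℕ → ℝ)))) :=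
    G.measurable_overlaps hA
  have hexp : ∀ t c u, Integrable (fun x => Real.exp (u * x))
      (((G.tiltedRepl P p t ι).restrict (G.overlaps ⁻¹' A)).map (G.comb p lam c)) := by
    intro t c u
    rw [integrable_map_measure (by fun_prop) (G.measurable_comb p lam c).aemeasurable]
    exact (G.integrable_exp_comb P p t u lam c).restrict
  have hmom : ∀ t m, ∫ x, x ^ m ∂((G.tiltedRepl P p t ι).restrict (G.overlaps ⁻¹' A)).map
      (G.comb p lam (G.b P p * t)) =
      ∫ R, A.indicator (fun _ => 1) R * gaussianMoment (combVar p lam R) m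
        ∂G.overlapArray P ι := by
    intro t m
    rw [← integral_comb_pow hGG hAC hp t m ι lam _ (IsTest.indicator hA),
      integral_map (G.measurable_comb p lam _).aemeasurable (by fun_prop), ← integral_indicator hA']
    refine integral_congr_ae (ae_of_all _ fun z => ?_)
    by_cases h : G.overlaps z ∈ A
    · simp [h]
    · simp [h]
  refine ext_of_moments (hexp _ _) (hexp _ _) fun m => ?_
  rw [hmom t m, ← hmom 0 m, mul_zero]

/-- Stability of the joint law of the shifted field and the overlaps of the replicas. -/
theorem replLaw_tilted_eq (hGG : G.GhirlandaGuerra P) (hAC : G.AizenmanContucci P) {p : ℕ}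
    (hp : 1 ≤ p) (t : ℝ) (ι : Type) [Fintype ι] :
    replLaw (P.prod stdGaussianSeq) (fun l x => G.tiltedWeight p t x l)
        (fun l x => G.field p x l - G.b P p * t) (fun l l' x => G.Q x.1 l l') ι =
      replLaw (P.prod stdGaussianSeq) (fun l x => G.tiltedWeight p 0 x l)
        (fun l x => G.field p x l - 0) (fun l l' x => G.Q x.1 l l') ι := by
  classical
  have hS := fun t c => G.markedWeights_tilted P p t c
  have hfin : IsFiniteMeasure (replLaw (P.prod stdGaussianSeq) (fun l x => G.tiltedWeight p t x l)
      (fun l x => G.field p x l - G.b P p * t) (fun l l' x => G.Q x.1 l l') ι) := by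
    have : IsFiniteMeasure (repl (P.prod stdGaussianSeq) (fun l x => G.tiltedWeight p t x l) ι) :=
      inferInstanceAs (IsFiniteMeasure (G.tiltedRepl P p t ι))
    unfold replLaw
    infer_instance
  have hrect : ∀ (t c : ℝ) (s : Set (ι → ℝ)) (A : Set (ι → ι → ℝ)), MeasurableSet s →
      MeasurableSet A → replLaw (P.prod stdGaussianSeq) (fun l x => G.tiltedWeight p t x l)
        (fun l x => G.field p x l - c) (fun l l' x => G.Q x.1 l l') ι (s ×ˢ A) =
      ((G.tiltedRepl P p t ι).restrict (G.overlaps ⁻¹' A)).map (G.marks p c) s := by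
    intro t c s A hs hA
    rw [replLaw, Measure.map_apply (hS t c).measurable_replData (hs.prod hA),
      Measure.map_apply (measurable_marks p c) hs, Measure.restrict_apply (measurable_marks p c hs)]
    rfl
  refine Measure.ext_prod fun {s A} hs hA => ?_
  rw [hrect _ _ s A hs hA, hrect _ _ s A hs hA]
  -- Cramér–Wold: on a fixed overlap event, the law of the vector of marks is determined by its
  -- one-dimensional projections.
  refine DFunLike.congr_fun (Measure.ext_of_charFunDual (funext fun L => ?_)) s
  rw [charFunDual_eq_charFun_map_one, charFunDual_eq_charFun_map_one,
    Measure.map_map (by fun_prop) (measurable_marks p _),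
    Measure.map_map (by fun_prop) (measurable_marks p _)]
  have hL : ∀ c, (L ∘ G.marks p c : (ι → ℕ) × (Ω × (ℕ → ℝ)) → ℝ) =
      G.comb p (fun i => L (Pi.single i 1)) c := by
    intro c
    funext z
    have h := L.toLinearMap.pi_apply_eq_sum_univ (G.marks p c z)
    simp only [ContinuousLinearMap.coe_coe] at h
    rw [Function.comp_apply, h, comb]
    refine Finset.sum_congr rfl fun i _ => ?_
    rw [smul_eq_mul, mul_comm]
    congr 2
    funext j
    simp [Pi.single_apply, eq_comm]
  rw [hL, hL, map_comb_restrict_eq hGG hAC hp t _ hA]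

/-! ### The weights have no ties -/

theorem ConcentratedOnSphere.ae_prod_Q_eq_iff (h : G.ConcentratedOnSphere P)
    (hpos : ∀ᵐ ω ∂P, ∀ l, 0 < G.w l ω) :
    ∀ᵐ x ∂P.prod stdGaussianSeq, (∀ l, 0 < G.w l x.1) ∧
      ∀ l l', G.Q x.1 l l' = G.qStar P ↔ l = l' := by
  have : ∀ᵐ ω ∂P, (∀ l, 0 < G.w l ω) ∧ ∀ l l', G.Q ω l l' = G.qStar P ↔ l = l' := by
    filter_upwards [hpos, h.ae_Q_eq_iff] with ω h1 h2
    exact ⟨h1, fun l l' => h2 l l' (h1 l) (h1 l')⟩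
  exact (measurePreserving_fst (μ := P) (ν := stdGaussianSeq)).quasiMeasurePreserving.ae this

/-- Differences of the field at different atoms have no atoms. -/
theorem ae_gaussianSeq_sub_ne {C : Matrix ℕ ℕ ℝ} (hC : C.PosSemidef) {l l' : ℕ}
    (h : 0 < C l l - C l l' - C l' l + C l' l') (a : ℝ) :
    ∀ᵐ γ ∂stdGaussianSeq, gaussianSeq C γ l - gaussianSeq C γ l' ≠ a := by
  have hG : HasGaussianLaw (fun γ => gaussianSeq C γ l - gaussianSeq C γ l') stdGaussianSeq :=
    (isGaussianProcess_gaussianSeq C).hasGaussianLaw_fun_sub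
  have hX := fun l => memLp_gaussianSeq C l 2
  have hm : Measurable fun γ => gaussianSeq C γ l - gaussianSeq C γ l' :=
    (measurable_gaussianSeq C l).sub (measurable_gaussianSeq C l')
  have hvar : Var[fun γ => gaussianSeq C γ l - gaussianSeq C γ l'; stdGaussianSeq] =
      C l l - C l l' - C l' l + C l' l' := by
    rw [← covariance_self hm.aemeasurable, covariance_fun_sub_fun_sub (hX l) (hX l') (hX l) (hX l'),
      covariance_gaussianSeq hC, covariance_gaussianSeq hC, covariance_gaussianSeq hC,
      covariance_gaussianSeq hC]
  have hmap := hG.map_eq_gaussianReal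
  rw [hvar] at hmap
  have hna := nullSingletonClass_gaussianReal (μ := ∫ γ, gaussianSeq C γ l - gaussianSeq C γ l'
    ∂stdGaussianSeq) (v := (C l l - C l l' - C l' l + C l' l').toNNReal) (by simpa using h)
  have h0 : stdGaussianSeq.map (fun γ => gaussianSeq C γ l - gaussianSeq C γ l') {a} = 0 := by
    rw [hmap]
    exact measure_singleton a
  rw [Measure.map_apply hm (measurableSet_singleton a)] at h0
  exact measure_eq_zero_iff_ae_notMem.1 h0

omit [IsProbabilityMeasure P] in
theorem ae_summable_tilted (p : ℕ) (t : ℝ) : ∀ᵐ x ∂P.prod stdGaussianSeq,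
    Summable fun l => G.w l x.1 * Real.exp (t * G.field p x l) := by
  have hv := (G.isWeights_tiltedWeight P p t).hasSum
  filter_upwards [hv] with x hx
  -- Were the series divergent, the junk value 0 of the partition function would make all tilted
  -- weights vanish, and they would not sum to one.
  by_contra hns
  have h0 : ∀ l, G.tiltedWeight p t x l = 0 := fun l => by
    rw [tiltedWeight, tsum_eq_zero_of_not_summable hns, div_zero]
  simp only [h0] at hx
  exact zero_ne_one (hasSum_zero.unique hx)

omit [IsProbabilityMeasure P] in
theorem ae_tsum_tilted_pos (p : ℕ) (t : ℝ) : ∀ᵐ x ∂P.prod stdGaussianSeq,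
    0 < ∑' l, G.w l x.1 * Real.exp (t * G.field p x l) := by
  filter_upwards [ae_summable_tilted (G := G) (P := P) p t] with x hx
  exact tsum_gibbs_pos (fun l => G.w_nonneg l x.1) (G.w_zero_pos x.1) hx

/-- A tie prescribes the value of the difference of the field at two atoms. For p = 1 this Gaussian
variable has variance ‖ξ_l - ξ_{l'}‖², positive since the atoms are distinct. -/
theorem ConcentratedOnSphere.ae_tiltedWeight_injective (h : G.ConcentratedOnSphere P)
    (hpos : ∀ᵐ ω ∂P, ∀ l, 0 < G.w l ω) :
    ∀ᵐ x ∂P.prod stdGaussianSeq, Function.Injective (G.tiltedWeight 1 1 x) := by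
  have hne : ∀ l l' : ℕ, l ≠ l' → ∀ᵐ x ∂P.prod stdGaussianSeq,
      G.field 1 x l - G.field 1 x l' ≠ Real.log (G.w l' x.1) - Real.log (G.w l x.1) := by
    intro l l' hll
    have hm : MeasurableSet {x : Ω × (ℕ → ℝ) |
        G.field 1 x l - G.field 1 x l' ≠ Real.log (G.w l' x.1) - Real.log (G.w l x.1)} := by
      refine (measurableSet_eq_fun ((G.measurable_field 1 l).sub (G.measurable_field 1 l')) ?_).compl
      exact (((G.measurable_w l').comp measurable_fst).log).sub
        (((G.measurable_w l).comp measurable_fst).log)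
    refine (Measure.ae_prod_iff_ae_ae hm).2 ?_
    filter_upwards [hpos] with ω hω
    refine ae_gaussianSeq_sub_ne (G.cov_posSemidef 1 ω) ?_ _
    have hξ := G.ξ_ne ω l l' hll (hω l) (hω l')
    have h2 : 0 < ‖G.ξ l ω - G.ξ l' ω‖ ^ 2 := pow_pos (norm_pos_iff.2 (sub_ne_zero.2 hξ)) 2
    rw [@norm_sub_sq_real, ← real_inner_self_eq_norm_sq, ← real_inner_self_eq_norm_sq] at h2
    simp only [cov, Q, Matrix.of_apply, pow_one, real_inner_comm (G.ξ l ω) (G.ξ l' ω)] at h2 ⊢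
    linarith
  filter_upwards [ae_all_iff.2 fun l => ae_all_iff.2 fun l' => ae_all_iff.2 fun h => hne l l' h,
    ae_tsum_tilted_pos (G := G) (P := P) 1 1, h.ae_prod_Q_eq_iff hpos] with x hx hZ hw l l' hll
  by_contra hcon
  refine hx l l' hcon ?_
  have h1 := (div_left_inj' hZ.ne').1 hll
  have h2 := congrArg Real.log h1
  rw [Real.log_mul (hw.1 l).ne' (Real.exp_pos _).ne', Real.log_mul (hw.1 l').ne' (Real.exp_pos _).ne',
    Real.log_exp, Real.log_exp] at h2
  linarith

omit [IsProbabilityMeasure P] in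
theorem ae_tiltedWeight_pos (hpos : ∀ᵐ ω ∂P, ∀ l, 0 < G.w l ω) (p : ℕ) (t : ℝ) :
    ∀ᵐ x ∂P.prod stdGaussianSeq, ∀ l, 0 < G.tiltedWeight p t x l := by
  filter_upwards [ae_tsum_tilted_pos (G := G) (P := P) p t,
    (measurePreserving_fst (μ := P) (ν := stdGaussianSeq)).quasiMeasurePreserving.ae hpos]
    with x hZ hw l
  exact div_pos (mul_pos (hw l) (Real.exp_pos _)) hZ

omit [IsProbabilityMeasure P] in
theorem ae_isSorting_perm (hpos : ∀ᵐ ω ∂P, ∀ l, 0 < G.w l ω) (p : ℕ) (t : ℝ) :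
    ∀ᵐ x ∂P.prod stdGaussianSeq, IsSorting (G.tiltedWeight p t x) (G.perm p t x) := by
  filter_upwards [ae_tiltedWeight_pos hpos p t, (G.isWeights_tiltedWeight P p t).hasSum]
    with x hx hs
  obtain ⟨π, hπ⟩ := exists_isSorting hx hs.summable.tendsto_cofinite_zero
  rw [perm, sortPerm_eq hπ]
  exact hπ

/-- The tilt with p = t = 1 has no ties, and its sorted weights have the same law as the original
ones. -/
theorem AizenmanContucci.ae_w_strictAnti (hAC : G.AizenmanContucci P)
    (h : G.ConcentratedOnSphere P) (hpos : ∀ᵐ ω ∂P, ∀ l, 0 < G.w l ω) :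
    ∀ᵐ ω ∂P, StrictAnti fun l => G.w l ω := by
  have key : ∀ l, ∀ᵐ ω ∂P, G.w (l + 1) ω < G.w l ω := by
    intro l
    have hm : MeasurableSet {y : (Fin (l + 2) → ℝ) × (Fin (l + 2) → Fin (l + 2) → ℝ) |
        y.1 (Fin.last (l + 1)) < y.1 (Fin.last l).castSucc} :=
      measurableSet_lt (by fun_prop) (by fun_prop)
    refine (hAC 1 le_rfl 1 (l + 2)).ae_snd (p := fun y => y.1 (Fin.last (l + 1)) <
      y.1 (Fin.last l).castSucc) hm ?_
    filter_upwards [ae_isSorting_perm hpos 1 1, h.ae_tiltedWeight_injective hpos] with x hx hi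
    rcases hx l (l + 1) l.lt_succ_self with h1 | h1
    · exact h1
    · exact absurd (hi h1.1) h1.2.ne'
  filter_upwards [ae_all_iff.2 key] with ω hω
  exact strictAnti_nat_of_succ_lt hω

theorem AizenmanContucci.ae_sortedWeight_strictAnti (hAC : G.AizenmanContucci P)
    (h : G.ConcentratedOnSphere P) (hpos : ∀ᵐ ω ∂P, ∀ l, 0 < G.w l ω) {p : ℕ} (hp : 1 ≤ p) (t : ℝ) :
    ∀ᵐ x ∂P.prod stdGaussianSeq, StrictAnti fun l => G.sortedWeight p t x l := by
  have key : ∀ l, ∀ᵐ x ∂P.prod stdGaussianSeq, G.sortedWeight p t x (l + 1) <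
      G.sortedWeight p t x l := by
    intro l
    have hm : MeasurableSet {y : (Fin (l + 2) → ℝ) × (Fin (l + 2) → Fin (l + 2) → ℝ) |
        y.1 (Fin.last (l + 1)) < y.1 (Fin.last l).castSucc} :=
      measurableSet_lt (by fun_prop) (by fun_prop)
    refine (hAC p hp t (l + 2)).symm.ae_snd (p := fun y => y.1 (Fin.last (l + 1)) <
      y.1 (Fin.last l).castSucc) hm ?_
    filter_upwards [hAC.ae_w_strictAnti h hpos] with ω hω
    exact hω l.lt_succ_self
  filter_upwards [ae_all_iff.2 key] with ω hω
  exact strictAnti_nat_of_succ_lt hω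

end RandomAtomicMeasure
end SpinGlass

/-! ### The two implications -/

namespace SpinGlass

namespace RandomAtomicMeasure

variable {Ω : Type*} [MeasurableSpace Ω] {G : RandomAtomicMeasure Ω} {P : Measure Ω}
  [IsProbabilityMeasure P]

variable (G) in
/-- The first sorted weights, with the shifted field and the overlaps. -/
def sortedArray (P : Measure Ω) (p : ℕ) (t : ℝ) (n : ℕ) (x : Ω × (ℕ → ℝ)) :
    (Fin n → ℝ) × (Fin n → ℝ) × (Fin n → Fin n → ℝ) :=
  ((fun l : Fin n => G.sortedWeight p t x l),
    (fun l : Fin n => G.field p x (G.perm p t x l) - G.b P p * t),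
    (fun l l' : Fin n => G.sortedQ p t x l l'))

variable (G) in
/-- The first weights, with the field and the overlaps. -/
def baseArray (p n : ℕ) (x : Ω × (ℕ → ℝ)) :
    (Fin n → ℝ) × (Fin n → ℝ) × (Fin n → Fin n → ℝ) :=
  ((fun l : Fin n => G.w l x.1), (fun l : Fin n => G.field p x l),
    (fun l l' : Fin n => G.Q x.1 l l'))

theorem measurable_baseArray (p n : ℕ) : Measurable (G.baseArray p n) :=
  (measurable_pi_iff.2 fun l : Fin n => (G.measurable_w l).comp measurable_fst).prodMk
    ((measurable_pi_iff.2 fun l : Fin n => G.measurable_field p l).prodMk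
      (measurable_pi_iff.2 fun l : Fin n => measurable_pi_iff.2 fun l' : Fin n =>
        (G.measurable_Q l l').comp measurable_fst))

omit [IsProbabilityMeasure P] in
theorem aemeasurable_sortedArray (hpos : ∀ᵐ ω ∂P, ∀ l, 0 < G.w l ω) (p : ℕ) (t : ℝ) (n : ℕ) :
    AEMeasurable (G.sortedArray P p t n) (P.prod stdGaussianSeq) := by
  have hperm : ∀ i, AEMeasurable (fun x => G.perm p t x i) (P.prod stdGaussianSeq) := fun i =>
    aemeasurable_sortPerm (fun l => G.measurable_tiltedWeight p t l)
      ((ae_isSorting_perm hpos p t).mono fun x hx => ⟨_, hx⟩) i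
  have hcomp : ∀ (F : ℕ → Ω × (ℕ → ℝ) → ℝ), (∀ k, Measurable (F k)) → ∀ i,
      AEMeasurable (fun x => F (G.perm p t x i) x) (P.prod stdGaussianSeq) := fun F hF i =>
    (measurable_of_countable_fst (f := fun y : ℕ × (Ω × (ℕ → ℝ)) => F y.1 y.2) hF).comp_aemeasurable
      ((hperm i).prodMk aemeasurable_id)
  have hcomp2 : ∀ i j,
      AEMeasurable (fun x => G.Q x.1 (G.perm p t x i) (G.perm p t x j)) (P.prod stdGaussianSeq) :=
    fun i j => (measurable_of_countable_fst (f := fun y : ℕ × (ℕ × (Ω × (ℕ → ℝ))) =>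
      G.Q y.2.2.1 y.1 y.2.1) fun k => measurable_of_countable_fst fun k' =>
        (G.measurable_Q k k').comp measurable_fst).comp_aemeasurable
      ((hperm i).prodMk ((hperm j).prodMk aemeasurable_id))
  refine (aemeasurable_pi_lambda _ fun l => ?_).prodMk ((aemeasurable_pi_lambda _ fun l => ?_).prodMk
    (aemeasurable_pi_lambda _ fun l => aemeasurable_pi_lambda _ fun l' => ?_))
  · exact hcomp (fun k x => G.tiltedWeight p t x k) (fun k => G.measurable_tiltedWeight p t k) l
  · exact hcomp (fun k x => G.field p x k - G.b P p * t)
      (fun k => (G.measurable_field p k).sub_const _) l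
  · exact hcomp2 l l'

/-- Unified stability when there are infinitely many atoms. -/
theorem identDistrib_of_pos (hGG : G.GhirlandaGuerra P) (hAC : G.AizenmanContucci P)
    (hpos : ∀ᵐ ω ∂P, ∀ l, 0 < G.w l ω) {p : ℕ} (hp : 1 ≤ p) (t : ℝ) (n : ℕ) :
    IdentDistrib (G.sortedArray P p t n) (G.baseArray p n)
      (P.prod stdGaussianSeq) (P.prod stdGaussianSeq) := by
  have hsph := hGG.concentratedOnSphere
  have hS := G.markedWeights_tilted P p t (G.b P p * t)
  have hS' := G.markedWeights_tilted P p 0 0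
  have hq := (hsph.ae_prod_Q_eq_iff hpos).mono fun x hx => hx.2
  have ham := aemeasurable_sortedArray hpos p t n
  refine ⟨ham, (measurable_baseArray p n).aemeasurable, Measure.ext_of_lintegral _ fun F hF => ?_⟩
  rw [lintegral_map' hF.aemeasurable ham, lintegral_map hF (measurable_baseArray p n)]
  have h1 := lintegral_leading_eq hS (ae_tiltedWeight_pos hpos p t) (π := G.perm p t)
    (hAC.ae_sortedWeight_strictAnti hsph hpos hp t) hF
  have h2 := lintegral_leading_eq hS' (ae_tiltedWeight_pos hpos p 0) (π := fun _ => 1)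
    (by
      simp only [tiltedWeight_zero]
      exact (measurePreserving_fst (μ := P) (ν := stdGaussianSeq)).quasiMeasurePreserving.ae
        (hAC.ae_w_strictAnti hsph hpos)) hF
  -- Both arrays are the same functional of the joint law of replica data and weight statistics, and
  -- these joint laws agree.
  rw [map_weightStat_eq hS hS' hq hq fun κ _ => replLaw_tilted_eq hGG hAC hp t κ, ← h2] at h1
  simp only [tiltedWeight_zero, sub_zero, Equiv.Perm.coe_one, id_eq] at h1
  exact h1

/-- Unified stability when there is a single atom. -/
theorem identDistrib_of_single (h : G.ConcentratedOnSphere P)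
    (ha : ∀ᵐ R ∂G.overlapArray P (Fin 2), R 0 1 = G.qStar P) (p : ℕ) (t : ℝ) (n : ℕ) :
    IdentDistrib (G.sortedArray P p t n) (G.baseArray p n)
      (P.prod stdGaussianSeq) (P.prod stdGaussianSeq) := by
  have hb : G.b P p = 0 := by
    rw [b_eq, overlapMoment, integral_congr_ae (ha.mono fun R hR => by rw [hR]), integral_const,
      probReal_univ, one_smul, sub_self]
  have hm : MeasurableSet {R : Fin 2 → Fin 2 → ℝ | R 0 1 = G.qStar P} :=
    measurableSet_eq_fun (measurable_coord 0 1) measurable_const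
  have hw : ∀ᵐ ω ∂P, ∀ l, G.w (l + 1) ω = 0 := by
    filter_upwards [(G.ae_overlapArray_iff_atoms P hm).1 ha, h.ae_Q_eq_iff] with ω h1 h2 l
    by_contra hne
    have hl : 0 < G.w (l + 1) ω := (G.w_nonneg _ ω).lt_of_ne' hne
    have h3 := h1 ![0, l + 1] fun i => by
      fin_cases i
      · exact G.w_zero_pos ω
      · exact hl
    exact absurd ((h2 _ _ (G.w_zero_pos ω) hl).1 h3) l.succ_ne_zero.symm
  refine (IdentDistrib.of_ae_eq (measurable_baseArray p n).aemeasurable ?_).symm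
  filter_upwards [(measurePreserving_fst (μ := P) (ν := stdGaussianSeq)).quasiMeasurePreserving.ae hw]
    with x hx
  have hw0 : G.w 0 x.1 = 1 := by
    have h1 := hasSum_single (f := fun l => G.w l x.1) 0 fun l hl => by
      obtain ⟨k, rfl⟩ := Nat.exists_eq_succ_of_ne_zero hl
      exact hx k
    exact h1.unique (G.hasSum_w x.1)
  have ht : ∀ l, G.tiltedWeight p t x l = G.w l x.1 := by
    intro l
    have hZ : ∑' j, G.w j x.1 * Real.exp (t * G.field p x j) = Real.exp (t * G.field p x 0) := by
      rw [tsum_eq_single 0 fun l hl => by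
        obtain ⟨k, rfl⟩ := Nat.exists_eq_succ_of_ne_zero hl
        rw [hx k, zero_mul], hw0, one_mul]
    rw [tiltedWeight, hZ]
    cases l with
    | zero => rw [hw0, one_mul, div_self (Real.exp_pos _).ne']
    | succ k => rw [hx k, zero_mul, zero_div]
  -- A single atom keeps its weight one under the tilt. The vanishing weights are tied, and breaking
  -- ties by the original index makes the sorting permutation the identity.
  have hs : IsSorting (G.tiltedWeight p t x) 1 := by
    intro i j hij
    obtain ⟨k, rfl⟩ := Nat.exists_eq_succ_of_ne_zero (Nat.ne_zero_of_lt hij)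
    simp only [Equiv.Perm.coe_one, id_eq, ht, hx k]
    cases i with
    | zero => exact Or.inl (by rw [hw0]; exact one_pos)
    | succ i => exact Or.inr ⟨(hx i).symm, hij⟩
  have hp : G.perm p t x = 1 := sortPerm_eq hs
  simp [baseArray, sortedArray, sortedWeight, sortedQ, hp, hb, ht]

/-- Either two replicas can have an overlap different from q*, and then there are infinitely many
atoms, or they almost surely coincide and there is only one. -/
theorem GhirlandaGuerra.unifiedStability (hGG : G.GhirlandaGuerra P)
    (hAC : G.AizenmanContucci P) : G.UnifiedStability P := by
  intro p hp t n
  by_cases ha : (G.overlapArray P (Fin 2)).real {R | R 0 1 ∈ ({G.qStar P} : Set ℝ)} < 1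
  · exact identDistrib_of_pos hGG hAC (hGG.ae_w_pos ha) hp t n
  · have hm : MeasurableSet {R : Fin 2 → Fin 2 → ℝ | R 0 1 = G.qStar P} :=
      measurableSet_eq_fun (measurable_coord 0 1) measurable_const
    have h1 : (G.overlapArray P (Fin 2)).real {R | R 0 1 = G.qStar P} = 1 :=
      le_antisymm measureReal_le_one (not_lt.1 ha)
    refine identDistrib_of_single hGG.concentratedOnSphere ?_ p t n
    have h2 : (G.overlapArray P (Fin 2)).real {R | R 0 1 = G.qStar P}ᶜ = 0 := by
      rw [probReal_compl_eq_one_sub hm, h1, sub_self]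
    exact (measureReal_eq_zero_iff).1 h2

/-- Unified stability on a sphere yields the Ghirlanda-Guerra identities. -/
theorem UnifiedStability.ghirlandaGuerra (h : G.UnifiedStability P)
    (hsph : G.ConcentratedOnSphere P) : G.GhirlandaGuerra P := by
  refine GhirlandaGuerra.of_replicaIdentity fun n j f hf p hp => ?_
  have hAC := h.aizenmanContucci
  obtain ⟨B, hB⟩ := hf.bounded
  have hfm : Measurable fun z : (Fin n → ℕ) × (Ω × (ℕ → ℝ)) => f (G.overlaps z) :=
    hf.measurable.comp G.measurable_overlaps
  -- Degree zero of the general formula: only the terms that come from differentiating the weights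
  -- remain.
  have ibp : ∀ t : ℝ, ∫ z, f (G.overlaps z) * G.field p z.2 (z.1 j) ∂G.tiltedRepl P p t (Fin n) =
      t * (∑ i, ∫ z, f (G.overlaps z) * G.overlaps z j i ^ p ∂G.tiltedRepl P p t (Fin n) -
        n * ∫ z, f (fun a b => G.overlaps z (Sum.inl a) (Sum.inl b)) *
          G.overlaps z (Sum.inl j) (Sum.inr ()) ^ p ∂G.tiltedRepl P p t (Fin n ⊕ Unit)) := by
    intro t
    have h1 := G.integral_comb_pow_mul_field P (t := t) (p := p) hf.measurable hB j 0 0 0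
    have h2 := G.integral_mul_meanCov P (IsTest.integrable_tiltedRepl G P hf p t) j
    simp only [pow_zero, mul_one, one_mul, Nat.cast_zero, zero_mul, zero_add, Fintype.card_fin] at h1
    rw [h1, h2]
    rfl
  have htr : ∀ {ι : Type} [Fintype ι] {g : (ι → ι → ℝ) → ℝ}, Measurable g →
      ∫ z, g (G.overlaps z) ∂G.tiltedRepl P p 1 ι = ∫ R, g R ∂G.overlapArray P ι := fun hg => by
    rw [← hAC.map_overlaps hp 1]
    exact (integral_map G.measurable_overlaps.aemeasurable hg.aestronglyMeasurable).symm
  -- By unified stability this average equals the one without tilt and shift, which vanishes by the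
  -- same formula at t = 0.
  have hg1 : ∫ z, f (G.overlaps z) * (G.field p z.2 (z.1 j) - G.b P p * 1)
      ∂G.tiltedRepl P p 1 (Fin n) = 0 := by
    have hF : Measurable fun D : ReplData (Fin n) => f D.2 * D.1 j :=
      (hf.measurable.comp measurable_snd).mul ((measurable_pi_apply j).comp measurable_fst)
    have h1 := congrArg (fun μ => ∫ D, f D.2 * D.1 j ∂μ) (h.replLaw_eq hp 1 (Fin n))
    simp only [replLaw] at h1
    rw [integral_map (G.markedWeights_tilted P p 1 _).measurable_replData.aemeasurable
        hF.aestronglyMeasurable,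
      integral_map (G.markedWeights_tilted P p 0 _).measurable_replData.aemeasurable
        hF.aestronglyMeasurable] at h1
    refine h1.trans ?_
    have h2 := ibp 0
    rw [zero_mul] at h2
    refine Eq.trans ?_ h2
    refine integral_congr_ae (ae_of_all _ fun z => ?_)
    simp only [replData, sub_zero]
    rfl
  have hi1 : Integrable (fun z => f (G.overlaps z) * G.field p z.2 (z.1 j))
      (G.tiltedRepl P p 1 (Fin n)) := by
    have := (G.integrable_comb_pow_mul_field P p 1 (0 : Fin n → ℝ) 0 0 j).bdd_mul
      hfm.aestronglyMeasurable (ae_of_all _ fun z => hB _ (G.abs_overlaps_le z))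
    simpa only [pow_zero, one_mul] using this
  have hi2 := (IsTest.integrable_tiltedRepl G P hf p 1).mul_const (G.b P p)
  simp only [mul_one, mul_sub] at hg1
  rw [integral_sub hi1 hi2, ibp 1, integral_mul_const, htr hf.measurable, one_mul,
    htr (isTest_comp_mul_pow hf Sum.inl (Sum.inl j) (Sum.inr ()) p).measurable] at hg1
  have htr2 : ∀ i, ∫ z, f (G.overlaps z) * G.overlaps z j i ^ p ∂G.tiltedRepl P p 1 (Fin n) =
      ∫ R, f R * R j i ^ p ∂G.overlapArray P (Fin n) := fun i =>
    htr (isTest_comp_mul_pow hf id j i p).measurable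
  simp only [htr2] at hg1
  have hd : ∫ R, f R * R j j ^ p ∂G.overlapArray P (Fin n) =
      (∫ R, f R ∂G.overlapArray P (Fin n)) * G.qStar P ^ p := by
    rw [← integral_mul_const]
    refine integral_congr_ae ?_
    filter_upwards [hsph.ae_diag (ι := Fin n)] with R hR
    rw [hR j]
  rw [ReplicaIdentity, hd, Fintype.card_fin]
  rw [b_eq] at hg1
  linarith

end RandomAtomicMeasure
end SpinGlass

end

theorem theorem1 {Ω : Type*} [MeasurableSpace Ω] (P : MeasureTheory.Measure Ω)
    [MeasureTheory.IsProbabilityMeasure P] (G : SpinGlass.RandomAtomicMeasure Ω) :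
    (G.GhirlandaGuerra P ∧ G.AizenmanContucci P) ↔
      (G.ConcentratedOnSphere P ∧ G.UnifiedStability P) := by
  constructor
  · rintro ⟨hGG, hAC⟩
    exact ⟨hGG.concentratedOnSphere, hGG.unifiedStability hAC⟩
  · rintro ⟨hsph, h⟩
    exact ⟨h.ghirlandaGuerra hsph, h.aizenmanContucci⟩
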